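/- Let $\alpha_B\ge\alpha_E>0$, $\lambda_B,\lambda_E>0$, $\Delta>0$, $\mathcal A>0$ with $\lambda_B/\alpha_B\le\lambda_E/\alpha_E$, and suppose that at least one of the inequalities $\alpha_B\ge\alpha_E$, $\lambda_B/\alpha_B\le\lambda_E/\alpha_E$ is strict. In the degraded discrete-time Poisson wiretap channel, an input intensity $X\ge 0$ is sent in each time slot of $\Delta$ seconds; given $X=x$, the output $Y$ of the legitimate receiver and the output $Z$ of the eavesdropper are Poisson distributed with means $(\alpha_Bx+\lambda_B)\Delta$ and $(\alpha_Ex+\lambda_E)\Delta$, and successive slots are independent given the inputs. Logarithms are natural, and rates and mutual informations are measured in nats per second. For $\mathcal E>0$ let $C_S=C_S(\mathcal A,\mathcal E)$ be the secrecy capacity under the constraints $0\le X\le\mathcal A$ and $\mathbb E[X]\le\mathcal E$, that is, the supremum of the rates $R\ge 0$ for which there are codes, one for every block length $n$, with $\lceil e^{n\Delta R}\rceil$ equiprobable messages $W$, a (randomized) encoder whose inputs $X_1,\dots,X_n$ lie in $[0,\mathcal A]$ and satisfy $\frac1n\sum_{i}\mathbb E[X_i]\le\mathcal E$, and a decoder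 $g_n$, such that $\Pr[g_n(Y^n)\ne W]\to 0$ and $\frac1n I(W;Z^n)\to 0$ as $n\to\infty$. For a probability distribution $F$ on $[0,\mathcal A]$ put $f_0(F)=\frac1\Delta\left[I(X;Y)-I(X;Z)\right]$, where $X\sim F$ and both mutual informations are in nats per slot. Then, with $\mathcal A$ held fixed, $$\lim_{\mathcal E\downarrow 0}\frac{C_S}{\mathcal E}=L:=\left(\alpha_B+\frac{\lambda_B}{\mathcal A}\right)\log\left(1+\frac{\alpha_B\mathcal A}{\lambda_B}\right)-\left(\alpha_E+\frac{\lambda_E}{\mathcal A}\right)\log\left(1+\frac{\alpha_E\mathcal A}{\lambda_E}\right)+(\alpha_E-\alpha_B),$$ and $L>0$. The same limit holds with $C_S$ replaced by its single-letter expression $\sup_F f_0(F)$, the supremum being over all distributions $F$ on $[0,\mathcal A]$ with mean at most $\mathcal E$. (For every $\mathcal E>0$ both suprema are finite and over nonempty sets, and all the mutual informations $I(X;Y)$, $I(X;Z)$ occurring are finite.) The limit is achieved asymptotically by the binary input distribution $F_{\mathcal E}$ on $\{0,\mathcal A\}$ with $P(\mathcal A)=\mathcal E/\mathcal A$ and $P(0)=1-\mathcal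 E/\mathcal A$: it satisfies the constraints for $0<\mathcal E\le\mathcal A$, and $f_0(F_{\mathcal E})/\mathcal E\to L$ and $f_0(F_{\mathcal E})/C_S\to 1$ as $\mathcal E\downarrow 0$. -/

import Mathlib

open MeasureTheory ProbabilityTheory Filter Topology
open scoped ENNReal NNReal

namespace PoissonWiretap

/-- A map into the measures on a countable discrete space is measurable as soon as the mass of
every point is a measurable function. -/
theorem measurable_of_singleton {α β : Type*} [MeasurableSpace α] [MeasurableSpace β]
    [Countable β] [MeasurableSingletonClass β] {f : α → Measure β}
    (h : ∀ b, Measurable fun a => f a {b}) : Measurable f := by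
  refine Measure.measurable_of_measurable_coe _ fun s _ => ?_
  have hs : (fun a => f a s) = fun a => ∑' b : s, f a {(b : β)} := by
    funext a
    have hc := measure_biUnion (μ := f a) (s := s) (f := fun b => {b}) (Set.to_countable s)
      (fun x _ y _ hxy => by simpa [Function.onFun] using hxy)
      (fun b _ => measurableSet_singleton b)
    simpa using hc
  rw [hs]
  exact Measurable.tsum fun b => h b

/-- One use of the discrete-time Poisson channel with channel gain `a`, dark current `l` and pulse
duration `Δ` (seconds): given the intensity `x`, the output (the photon count) is Poisson
distributed with mean `(a * x + l) * Δ`. Only inputs `x ≥ 0` are ever used. -/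
noncomputable def poissonChannel (a l Δ : ℝ) : Kernel ℝ ℕ where
  toFun x := poissonMeasure ((a * x + l) * Δ).toNNReal
  measurable' := by
    refine measurable_of_singleton fun k => ?_
    simp only [poissonMeasure_singleton]
    fun_prop

instance (a l Δ : ℝ) : IsMarkovKernel (poissonChannel a l Δ) :=
  ⟨fun x => inferInstanceAs (IsProbabilityMeasure (poissonMeasure ((a * x + l) * Δ).toNNReal))⟩

/-- `n` memoryless uses of a channel with outputs in `ℕ`. -/
noncomputable def memoryless (κ : Kernel ℝ ℕ) [IsMarkovKernel κ] (n : ℕ) :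
    Kernel (Fin n → ℝ) (Fin n → ℕ) where
  toFun x := Measure.pi fun i => κ (x i)
  measurable' := by
    refine measurable_of_singleton fun y => ?_
    simp only [Measure.pi_singleton]
    exact Finset.measurable_prod _ fun i _ =>
      (κ.measurable_coe (measurableSet_singleton (y i))).comp (measurable_pi_apply i)

instance (κ : Kernel ℝ ℕ) [IsMarkovKernel κ] (n : ℕ) : IsMarkovKernel (memoryless κ n) :=
  ⟨fun x => inferInstanceAs (IsProbabilityMeasure (Measure.pi fun i => κ (x i)))⟩

/-- The mutual information (in nats) between the input, of law `μ`, and the output of the channel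
`κ`: the divergence of the joint law from the product of its marginals. -/
noncomputable def mutualInfo {α β : Type*} [MeasurableSpace α] [MeasurableSpace β]
    (μ : Measure α) (κ : Kernel α β) : ℝ≥0∞ :=
  InformationTheory.klDiv (μ ⊗ₘ κ) (μ.prod (κ ∘ₘ μ))

/-- A wiretap code with block length `n` and `M` messages, peak intensity `A` and average
intensity `E`. The encoder may use local randomness: message `m` is sent as a random vector of
intensities of law `enc m`. The message is uniformly distributed. -/
structure WiretapCode (A E : ℝ) (n M : ℕ) where
  /-- the stochastic encoder -/
  enc : Kernel (Fin M) (Fin n → ℝ)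
  markov : IsMarkovKernel enc
  /-- the decoder of the legitimate receiver -/
  dec : (Fin n → ℕ) → Fin M
  /-- the nonnegativity and peak-intensity constraint `0 ≤ X ≤ A` -/
  peak : ∀ m, ∀ᵐ x ∂(enc m), ∀ i, x i ∈ Set.Icc 0 A
  /-- the average-intensity constraint `𝔼[X] ≤ E`, the expectation being over the slots of the
  block, the message and the randomness of the encoder -/
  average : (∑ i, ∫ x, x i ∂(enc ∘ₘ uniformOn (Set.univ : Set (Fin M)))) / n ≤ E

/-- The probability `Pr[g(Yⁿ) ≠ W]` when the legitimate receiver observes the output of `κ`. -/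
noncomputable def WiretapCode.errorProb {A E : ℝ} {n M : ℕ} (c : WiretapCode A E n M)
    (κ : Kernel ℝ ℕ) [IsMarkovKernel κ] : ℝ≥0∞ :=
  (uniformOn (Set.univ : Set (Fin M)) ⊗ₘ (memoryless κ n ∘ₖ c.enc)) {p | c.dec p.2 ≠ p.1}

/-- The information `I(W; Zⁿ)` leaked about the message through the channel `κ`. -/
noncomputable def WiretapCode.leakage {A E : ℝ} {n M : ℕ} (c : WiretapCode A E n M)
    (κ : Kernel ℝ ℕ) [IsMarkovKernel κ] : ℝ≥0∞ :=
  mutualInfo (uniformOn (Set.univ : Set (Fin M))) (memoryless κ n ∘ₖ c.enc)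

/-- The perfectly secure rates, in nats per second, for the main channel `κB` and the
eavesdropper's channel `κE`, one use of which takes `Δ` seconds: there are codes with
`⌈exp (n Δ R)⌉` messages whose error probability and normalized leakage tend to zero. -/
def secureRates (κB κE : Kernel ℝ ℕ) [IsMarkovKernel κB] [IsMarkovKernel κE] (Δ A E : ℝ) :
    Set ℝ :=
  {R | 0 ≤ R ∧ ∃ c : ∀ n : ℕ, WiretapCode A E n ⌈Real.exp (n * Δ * R)⌉₊,
    Tendsto (fun n => (c n).errorProb κB) atTop (𝓝 0) ∧
    Tendsto (fun n : ℕ => (c n).leakage κE / n) atTop (𝓝 0)}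

/-- The secrecy capacity (nats per second): the supremum of the perfectly secure rates. -/
noncomputable def secrecyCapacity (κB κE : Kernel ℝ ℕ) [IsMarkovKernel κB] [IsMarkovKernel κE]
    (Δ A E : ℝ) : ℝ :=
  sSup (secureRates κB κE Δ A E)

/-- The input distributions on `[0, A]` with mean at most `E`. -/
def feasible (A E : ℝ) : Set (Measure ℝ) :=
  {μ | IsProbabilityMeasure μ ∧ (∀ᵐ x ∂μ, x ∈ Set.Icc 0 A) ∧ ∫ x, x ∂μ ≤ E}

/-- The mutual information difference `I(X;Y) - I(X;Z)` in nats per second, for an input of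
law `μ`. -/
noncomputable def infoDiff (κB κE : Kernel ℝ ℕ) (Δ : ℝ) (μ : Measure ℝ) : ℝ :=
  ((mutualInfo μ κB).toReal - (mutualInfo μ κE).toReal) / Δ

/-- The single-letter expression of the secrecy capacity: the supremum of `I(X;Y) - I(X;Z)` over
the feasible input distributions. -/
noncomputable def singleLetter (κB κE : Kernel ℝ ℕ) (Δ A E : ℝ) : ℝ :=
  sSup (infoDiff κB κE Δ '' feasible A E)

/-- The binary input distribution on `{0, A}` with `P(A) = E / A`, `P(0) = 1 - E / A`. -/
noncomputable def binaryInput (A E : ℝ) : Measure ℝ :=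
  ENNReal.ofReal (1 - E / A) • Measure.dirac 0 + ENNReal.ofReal (E / A) • Measure.dirac A

end PoissonWiretap

namespace PoissonWiretap

open InformationTheory

/-! Everything is measured against the dark output, the output at intensity zero. The compensation
identity `lintegral_klDiv_eq` writes I(X;Y) as the mean of D(P_{Y|X} ‖ P_{Y|0}) minus D(P_Y ‖
P_{Y|0}), and similarly for Z. The first divergence at intensity x is `Δ * divRate a l x`, so I(X;Y)
- I(X;Z) equals Δ times the mean of the gap g(x) = `divRate aB lB x - divRate aE lE x`, minus the
difference of two output divergences.

Upper bound. Z is obtained from Y by thinning and added Poisson noise (`exists_degrading_kernel`),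
so by data processing the difference of output divergences is nonnegative. The gap is convex with
g(0) = 0 (`divRate_gap_le`), hence lies below its chord: g(x) ≤ L x on [0, A], where A L = g(A). The
mean constraint gives f₀ ≤ L E. The same computation on whole blocks, with the message included and
combined with Fano's inequality, bounds every secure rate by L E (`WiretapCode.converse`,
`secureRates_le`); no single-letter formula for the capacity is needed.

Lower bound. On {0, A} the chord bound is an equality, and the output divergence of a mixture with
weight E/A is O(E²), by comparison with the chi-square divergence. So the binary input reaches L E -
O(E²) (`exists_infoDiff_binaryInput_ge`).

For the operational capacity this value must be approached by codes. A random codebook of M K words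
is used, with K words per message. Threshold decoding controls the error, and a soft-covering
estimate bounds the divergence of each message's output from the product output law
(`IsChannelDensity.exists_codebook`). Chebyshev's inequality and a variance bound then make the
error vanish and keep the leakage O(√n) (`mem_secureRates_of_lt`). Random coding needs a mean
strictly below E; the binary input of mean E (1 - E) supplies it at a cost of second order. -/

theorem absolutelyContinuous_of_full_support {β : Type*} [MeasurableSpace β]
    {ν : Measure β} (h : ∀ b, ν {b} ≠ 0) (μ : Measure β) : μ ≪ ν := by
  intro s hs
  have : s = ∅ := by
    by_contra hne
    obtain ⟨b, hb⟩ := Set.nonempty_iff_ne_empty.2 hne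
    exact h b (measure_mono_null (Set.singleton_subset_iff.2 hb) hs)
  simp [this]

/-! ### Relative entropy and mutual information -/

section KL

variable {α β γ : Type*} [MeasurableSpace α] [MeasurableSpace β] [MeasurableSpace γ]

theorem klDiv_map_measurableEquiv (e : α ≃ᵐ β) (μ ν : Measure α) [IsFiniteMeasure μ]
    [IsFiniteMeasure ν] : klDiv (μ.map e) (ν.map e) = klDiv μ ν := by
  refine le_antisymm (klDiv_map_le _ _ e.measurable) ?_
  have h := klDiv_map_le (μ.map e) (ν.map e) e.symm.measurable
  simpa using h

theorem klDiv_map_swap (μ ν : Measure (α × β)) [IsFiniteMeasure μ] [IsFiniteMeasure ν] :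
    klDiv (μ.map Prod.swap) (ν.map Prod.swap) = klDiv μ ν :=
  klDiv_map_measurableEquiv MeasurableEquiv.prodComm μ ν

theorem klDiv_prod (μ ν : Measure α) (μ' ν' : Measure β) [IsProbabilityMeasure μ]
    [IsProbabilityMeasure ν] [IsProbabilityMeasure μ'] [IsProbabilityMeasure ν'] :
    klDiv (μ.prod μ') (ν.prod ν') = klDiv μ ν + klDiv μ' ν' := by
  rw [← Measure.compProd_const, ← Measure.compProd_const, klDiv_compProd_eq_add,
    Measure.compProd_const, Measure.compProd_const, ← klDiv_map_swap, Measure.prod_swap,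
    Measure.prod_swap, ← Measure.compProd_const, ← Measure.compProd_const, klDiv_compProd_left]

theorem klDiv_pi {n : ℕ} (μ ν : Fin n → Measure β) [∀ i, IsProbabilityMeasure (μ i)]
    [∀ i, IsProbabilityMeasure (ν i)] :
    klDiv (Measure.pi μ) (Measure.pi ν) = ∑ i, klDiv (μ i) (ν i) := by
  induction n with
  | zero =>
    rw [Measure.pi_of_empty, Measure.pi_of_empty]
    simp
  | succ n ih =>
    rw [← klDiv_map_measurableEquiv (MeasurableEquiv.piFinSuccAbove (fun _ => β) 0),
      (measurePreserving_piFinSuccAbove μ 0).map_eq, (measurePreserving_piFinSuccAbove ν 0).map_eq,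
      klDiv_prod, ih, Fin.sum_univ_succ]
    rfl

/-- The compensation identity. -/
theorem klDiv_compProd_prod [StandardBorelSpace α] [Nonempty α] (μ : Measure α)
    [IsProbabilityMeasure μ] (κ : Kernel α β) [IsMarkovKernel κ] (ν : Measure β)
    [IsProbabilityMeasure ν] :
    klDiv (μ ⊗ₘ κ) (μ.prod ν) = mutualInfo μ κ + klDiv (κ ∘ₘ μ) ν := by
  -- Disintegrating the joint law along the output lets the chain rule split off the divergence of
  -- the output marginals; what remains is the divergence of the posterior from μ, which is the
  -- mutual information.
  have h1 : (μ ⊗ₘ κ).map Prod.swap = (κ ∘ₘ μ) ⊗ₘ κ†μ := compProd_posterior_eq_map_swap.symm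
  rw [mutualInfo, ← klDiv_map_swap (μ ⊗ₘ κ), ← klDiv_map_swap (μ ⊗ₘ κ), h1, Measure.prod_swap,
    Measure.prod_swap, ← Measure.compProd_const, ← Measure.compProd_const,
    klDiv_compProd_eq_add, add_comm]

/-- Since ν dominates every `κ x`, one jointly measurable kernel density serves for the joint law
and for each fibre. The integrand `klFun` is nonnegative, so Tonelli applies and infinite values
need no separate treatment. -/
theorem klDiv_compProd_prod_eq_lintegral [Countable β] [MeasurableSingletonClass β]
    (μ : Measure α) [IsProbabilityMeasure μ] (κ : Kernel α β)
    [IsMarkovKernel κ] (ν : Measure β) [IsProbabilityMeasure ν] (hac : ∀ x, κ x ≪ ν) :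
    klDiv (μ ⊗ₘ κ) (μ.prod ν) = ∫⁻ x, klDiv (κ x) ν ∂μ := by
  set f := κ.rnDeriv (Kernel.const α ν) with hf
  have hfm : Measurable (Function.uncurry f) := Kernel.measurable_rnDeriv _ _
  have hκ (x : α) : κ x = ν.withDensity (f x) := by
    have h := Kernel.rnDeriv_eq_rnDeriv_measure (κ := κ) (η := Kernel.const α ν) (a := x)
    rw [Kernel.const_apply] at h
    rw [withDensity_congr_ae h, Measure.withDensity_rnDeriv_eq _ _ (hac x)]
  have hjoint : μ ⊗ₘ κ = (μ.prod ν).withDensity (Function.uncurry f) := by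
    ext s hs
    rw [Measure.compProd_apply hs, withDensity_apply _ hs, ← lintegral_indicator hs,
      lintegral_prod _ (hfm.indicator hs).aemeasurable]
    refine lintegral_congr fun x => ?_
    rw [hκ x, withDensity_apply _ (measurable_prodMk_left hs),
      ← lintegral_indicator (measurable_prodMk_left hs)]
    rfl
  rw [klDiv_eq_lintegral_klFun_of_ac (hjoint ▸ withDensity_absolutelyContinuous _ _)]
  have h1 : (μ ⊗ₘ κ).rnDeriv (μ.prod ν) =ᵐ[μ.prod ν] Function.uncurry f := by
    rw [hjoint]
    exact Measure.rnDeriv_withDensity _ hfm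
  rw [lintegral_congr_ae (h1.mono fun p hp => by
    show _ = ENNReal.ofReal (klFun ((Function.uncurry f) p).toReal); rw [hp]),
    lintegral_prod _ (by fun_prop)]
  refine lintegral_congr fun x => ?_
  rw [klDiv_eq_lintegral_klFun_of_ac (hac x)]
  refine lintegral_congr_ae ?_
  filter_upwards [Kernel.rnDeriv_eq_rnDeriv_measure (κ := κ) (η := Kernel.const α ν) (a := x)]
    with y hy
  rw [Kernel.const_apply] at hy
  rw [← hy]
  rfl

/-- The working form of the compensation identity. It is additive in `ℝ≥0∞`, so finiteness matters
only where a term is cancelled. -/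
theorem lintegral_klDiv_eq [StandardBorelSpace α] [Nonempty α] [Countable β]
    [MeasurableSingletonClass β] (μ : Measure α) [IsProbabilityMeasure μ] (κ : Kernel α β)
    [IsMarkovKernel κ] (ν : Measure β) [IsProbabilityMeasure ν] (hac : ∀ x, κ x ≪ ν) :
    ∫⁻ x, klDiv (κ x) ν ∂μ = mutualInfo μ κ + klDiv (κ ∘ₘ μ) ν := by
  rw [← klDiv_compProd_prod_eq_lintegral μ κ ν hac, klDiv_compProd_prod]

/-- The data processing inequality for the mutual information. -/
theorem mutualInfo_comp_le (μ : Measure α) [IsProbabilityMeasure μ]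
    (κ : Kernel α β) [IsMarkovKernel κ] (η : Kernel β γ) [IsMarkovKernel η] :
    mutualInfo μ (η ∘ₖ κ) ≤ mutualInfo μ κ := by
  have h := klDiv_comp_right_le (μ ⊗ₘ κ) (μ.prod (κ ∘ₘ μ)) (Kernel.id ∥ₖ η)
  have h1 : (Kernel.id ∥ₖ η) ∘ₘ (μ ⊗ₘ κ) = μ ⊗ₘ (η ∘ₖ κ) := by
    rw [Measure.compProd_eq_comp_prod, Measure.compProd_eq_comp_prod, Measure.comp_assoc,
      Kernel.parallelComp_comp_prod, Kernel.id_comp]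
  have h2 : (Kernel.id ∥ₖ η) ∘ₘ (μ.prod (κ ∘ₘ μ)) = μ.prod ((η ∘ₖ κ) ∘ₘ μ) := by
    rw [← Measure.compProd_const, ← Measure.compProd_const, Measure.compProd_eq_comp_prod,
      Measure.compProd_eq_comp_prod, Measure.comp_assoc,
      Kernel.parallelComp_comp_prod, Kernel.id_comp, Kernel.comp_const, Measure.comp_assoc]
  rwa [h1, h2] at h

/-- A lower bound on the divergence by the probabilities of one event. -/
theorem mul_measure_le_klDiv_add (μ ν : Measure α) [IsProbabilityMeasure μ]
    [IsProbabilityMeasure ν] {s : Set α} {c : ℝ} (hc : 0 ≤ c) :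
    ENNReal.ofReal c * μ s ≤ klDiv μ ν + ENNReal.ofReal (Real.exp c - 1) * ν s := by
  by_cases hac : μ ≪ ν
  swap
  · simp [klDiv_of_not_ac hac]
  have hexp : 0 ≤ Real.exp c - 1 := by linarith [Real.add_one_le_exp c]
  rw [klDiv_eq_lintegral_klFun_of_ac hac]
  calc ENNReal.ofReal c * μ s = ∫⁻ x in s, ENNReal.ofReal c * μ.rnDeriv ν x ∂ν := by
        rw [lintegral_const_mul _ (Measure.measurable_rnDeriv _ _),
          Measure.setLIntegral_rnDeriv hac]
    _ ≤ ∫⁻ x in s, (ENNReal.ofReal (klFun (μ.rnDeriv ν x).toReal)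
          + ENNReal.ofReal (Real.exp c - 1)) ∂ν := by
        refine lintegral_mono_ae (ae_restrict_of_ae ?_)
        filter_upwards [μ.rnDeriv_lt_top ν] with x hx
        set t := (μ.rnDeriv ν x).toReal with ht
        have ht0 : 0 ≤ t := ENNReal.toReal_nonneg
        rw [← ENNReal.ofReal_toReal hx.ne, ← ht, ← ENNReal.ofReal_mul hc,
          ← ENNReal.ofReal_add (klFun_nonneg ht0) hexp]
        refine ENNReal.ofReal_le_ofReal ?_
        rw [klFun_apply]
        rcases ht0.eq_or_lt with h0 | h0
        · rw [← h0]; simp; positivity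
        -- Fenchel–Young for `klFun`: multiplying 1 + c - log t ≤ exp c / t by t gives c t ≤ klFun t
        -- + exp c - 1.
        · have h1 := Real.add_one_le_exp (c - Real.log t)
          rw [Real.exp_sub, Real.exp_log h0, le_div_iff₀ h0] at h1
          nlinarith
    _ = ∫⁻ x in s, ENNReal.ofReal (klFun (μ.rnDeriv ν x).toReal) ∂ν
          + ENNReal.ofReal (Real.exp c - 1) * ν s := by
        rw [lintegral_add_right _ measurable_const, lintegral_const, Measure.restrict_apply_univ]
    _ ≤ _ := by gcongr; exact Measure.restrict_le_self

theorem klDiv_withDensity_eq_lintegral {ν : Measure α} [IsProbabilityMeasure ν] {u : α → ℝ}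
    (hu : Measurable u) (hu0 : ∀ x, 0 ≤ u x) (hui : Integrable u ν) :
    klDiv (ν.withDensity fun x => ENNReal.ofReal (u x)) ν
      = ∫⁻ x, ENNReal.ofReal (klFun (u x)) ∂ν := by
  have : IsFiniteMeasure (ν.withDensity fun x => ENNReal.ofReal (u x)) :=
    isFiniteMeasure_withDensity_ofReal hui.2
  rw [klDiv_eq_lintegral_klFun_of_ac (withDensity_absolutelyContinuous _ _)]
  refine lintegral_congr_ae ?_
  filter_upwards [Measure.rnDeriv_withDensity ν (f := fun x => ENNReal.ofReal (u x))
    (by fun_prop)] with x hx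
  rw [hx, ENNReal.toReal_ofReal (hu0 x)]

theorem klDiv_withDensity {ν : Measure α} [IsProbabilityMeasure ν] {u : α → ℝ}
    (hu : Measurable u) (hu0 : ∀ x, 0 ≤ u x) {B : ℝ} (huB : ∀ x, u x ≤ B)
    (hint : ∫ x, u x ∂ν = 1) :
    klDiv (ν.withDensity fun x => ENNReal.ofReal (u x)) ν
      = ENNReal.ofReal (∫ x, u x * Real.log (u x) ∂ν) := by
  have hui : Integrable u ν := Integrable.of_bound hu.aestronglyMeasurable B
    (ae_of_all _ fun x => by rw [Real.norm_eq_abs, abs_of_nonneg (hu0 x)]; exact huB x)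
  have hcont : Continuous fun t : ℝ => t * Real.log t := Real.continuous_mul_log
  obtain ⟨C, hC⟩ := (isCompact_Icc (a := (0:ℝ)) (b := B)).exists_bound_of_continuousOn
    hcont.continuousOn
  have hli : Integrable (fun x => u x * Real.log (u x)) ν := Integrable.of_bound
    (hcont.measurable.comp hu).aestronglyMeasurable C
    (ae_of_all _ fun x => hC _ ⟨hu0 x, huB x⟩)
  rw [klDiv_withDensity_eq_lintegral hu hu0 hui]
  have h2 : ∫ x, u x * Real.log (u x) ∂ν = ∫ x, klFun (u x) ∂ν := by
    simp only [klFun_apply]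
    rw [integral_sub (by fun_prop) hui, integral_add hli (integrable_const _), hint]
    simp
  rw [h2, ofReal_integral_eq_lintegral_ofReal]
  · simp only [klFun_apply]
    fun_prop
  · exact ae_of_all _ fun x => klFun_nonneg (hu0 x)

end KL

/-! ### Coordinatewise action of a kernel on product laws -/

section ProductKernel

theorem lintegral_prod_pi {n : ℕ} {β : Type*} [MeasurableSpace β] (μ : Fin n → Measure β)
    [∀ i, IsProbabilityMeasure (μ i)] (f : Fin n → β → ℝ≥0∞) (hf : ∀ i, Measurable (f i)) :
    ∫⁻ y, ∏ i, f i (y i) ∂Measure.pi μ = ∏ i, ∫⁻ b, f i b ∂μ i := by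
  have h := lintegral_prod_eq_prod_lintegral_of_indepFun (μ := Measure.pi μ) Finset.univ
    (fun i (y : Fin n → β) => f i (y i))
    (iIndepFun_pi (X := f) fun i => (hf i).aemeasurable) (fun i => by fun_prop)
  rw [h]
  refine Finset.prod_congr rfl fun i _ => ?_
  rw [← (measurePreserving_eval μ i).lintegral_comp (hf i)]

/-- The product of `n` copies of a kernel on a countable discrete space. -/
noncomputable def productKernel (T : Kernel ℕ ℕ) (n : ℕ) : Kernel (Fin n → ℕ) (Fin n → ℕ) :=
  Kernel.ofFunOfCountable fun y => Measure.pi fun i => T (y i)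

instance (T : Kernel ℕ ℕ) [IsMarkovKernel T] (n : ℕ) : IsMarkovKernel (productKernel T n) :=
  ⟨fun y => inferInstanceAs (IsProbabilityMeasure (Measure.pi fun i => T (y i)))⟩

theorem productKernel_comp_pi (T : Kernel ℕ ℕ) [IsMarkovKernel T] {n : ℕ}
    (μ : Fin n → Measure ℕ) [∀ i, IsProbabilityMeasure (μ i)] :
    productKernel T n ∘ₘ Measure.pi μ = Measure.pi fun i => T ∘ₘ μ i := by
  refine Measure.ext_of_singleton fun z => ?_
  rw [Measure.bind_apply (measurableSet_singleton z) (Kernel.aemeasurable _), Measure.pi_singleton]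
  have h (y : Fin n → ℕ) : productKernel T n y {z} = ∏ i, T (y i) {z i} :=
    Measure.pi_singleton _ _
  simp_rw [h]
  rw [lintegral_prod_pi μ (fun i y => T y {z i}) fun i => Measurable.of_discrete]
  refine Finset.prod_congr rfl fun i _ => ?_
  rw [Measure.bind_apply (measurableSet_singleton _) (Kernel.aemeasurable _)]

end ProductKernel

/-! ### Poisson laws: thinning, superposition, divergences -/

section Poisson

/-- Independent thinning of a count, every point being kept with probability `q`. -/
noncomputable def thinning (q : unitInterval) : Kernel ℕ ℕ :=
  Kernel.ofFunOfCountable fun n => binomial n q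

instance (q : unitInterval) : IsMarkovKernel (thinning q) :=
  ⟨fun n => inferInstanceAs (IsProbabilityMeasure (binomial n q))⟩

/-- Superposition with an independent Poisson count of mean `c`. -/
noncomputable def poissonNoise (c : ℝ≥0) : Kernel ℕ ℕ :=
  Kernel.ofFunOfCountable fun n => (poissonMeasure c).map (n + ·)

instance (c : ℝ≥0) : IsMarkovKernel (poissonNoise c) :=
  ⟨fun n => Measure.isProbabilityMeasure_map (μ := poissonMeasure c) (f := (n + ·))
    Measurable.of_discrete.aemeasurable⟩

theorem poissonNoise_comp_poissonMeasure (c r : ℝ≥0) :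
    poissonNoise c ∘ₘ poissonMeasure r = poissonMeasure (r + c) := by
  rw [← poissonMeasure_conv_poissonMeasure]
  ext s hs
  rw [Measure.bind_apply hs (Kernel.aemeasurable _), Measure.conv,
    Measure.map_apply (by fun_prop) hs, Measure.prod_apply (.of_discrete)]
  refine lintegral_congr fun n => ?_
  show (poissonMeasure c).map (n + ·) s = _
  rw [Measure.map_apply .of_discrete hs]
  rfl

theorem thinning_comp_poissonMeasure (q : unitInterval) (r : ℝ≥0) :
    thinning q ∘ₘ poissonMeasure r = poissonMeasure (Real.toNNReal q * r) := by
  refine Measure.ext_of_singleton fun k => ?_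
  have hq0 : (0 : ℝ) ≤ q := q.2.1
  have hq1 : (0 : ℝ) ≤ 1 - q := sub_nonneg.2 q.2.2
  rw [Measure.bind_apply (measurableSet_singleton k) (Kernel.aemeasurable _), lintegral_countable']
  have hterm (n : ℕ) : thinning q n {k} * poissonMeasure r {n} =
      ENNReal.ofReal ((n.choose k) * q ^ k * (1 - q) ^ (n - k)
        * (Real.exp (-r) * r ^ n / n.factorial)) := by
    rw [show thinning q n {k} = binomial n q {k} from rfl, binomial_singleton,
      poissonMeasure_singleton, ← ENNReal.ofReal_mul (by positivity)]
  simp_rw [hterm]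
  have hsum : HasSum (fun n : ℕ => (n.choose k) * (q : ℝ) ^ k * (1 - q) ^ (n - k)
        * (Real.exp (-r) * r ^ n / n.factorial))
      (Real.exp (-(q * r)) * (q * r) ^ k / k.factorial) := by
    -- Counts below k contribute nothing; after the shift by k the remaining series is the
    -- exponential series of (1 - q) r.
    rw [← hasSum_nat_add_iff' k]
    have hz : ∑ i ∈ Finset.range k, ((i.choose k) * (q : ℝ) ^ k * (1 - q) ^ (i - k)
        * (Real.exp (-r) * r ^ i / i.factorial)) = 0 := by
      refine Finset.sum_eq_zero fun i hi => ?_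
      rw [Nat.choose_eq_zero_of_lt (Finset.mem_range.1 hi)]
      simp
    rw [hz, sub_zero]
    have h := (NormedSpace.expSeries_div_hasSum_exp (𝔸 := ℝ) ((1 - q) * r)).mul_left
      (Real.exp (-r) * (q * r) ^ k / k.factorial)
    rw [← Real.exp_eq_exp_ℝ] at h
    convert! h using 1
    · funext n
      have hc : ((n + k).choose k : ℝ) * (k.factorial * n.factorial) = (n + k).factorial := by
        have := Nat.add_choose_mul_factorial_mul_factorial n k
        rw [Nat.add_comm n k, Nat.choose_symm_add, Nat.add_comm k n] at *
        norm_cast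
        rw [← this]; ring
      rw [Nat.add_sub_cancel, ← hc]
      have : ((n + k).choose k : ℝ) ≠ 0 := by
        exact_mod_cast (Nat.choose_pos (Nat.le_add_left k n)).ne'
      field_simp
      rw [mul_pow, mul_pow]
      ring
    · rw [show -((q : ℝ) * r) = -r + (1 - q) * r by ring, Real.exp_add]
      ring
  rw [← ENNReal.ofReal_tsum_of_nonneg (fun n => by positivity) hsum.summable, hsum.tsum_eq,
    poissonMeasure_singleton, NNReal.coe_mul, Real.coe_toNNReal _ hq0]

theorem summable_poisson_mul_pow (r : ℝ≥0) (ρ : ℝ) :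
    Integrable (fun n : ℕ => ρ ^ n) (poissonMeasure r) := by
  rw [integrable_poissonMeasure_iff]
  have h := (Real.summable_pow_div_factorial (r * |ρ|)).mul_left (Real.exp (-r))
  refine h.congr fun n => ?_
  rw [norm_pow, Real.norm_eq_abs, mul_pow]
  ring

theorem hasSum_poisson_mean (r : ℝ≥0) :
    HasSum (fun n : ℕ => Real.exp (-r) * r ^ n / n.factorial * (n : ℝ)) r := by
  rw [← hasSum_nat_add_iff' 1]
  have h := (hasSum_one_poissonMeasure r).mul_left (r : ℝ)
  convert! h using 1
  · funext n
    rw [Nat.factorial_succ]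
    push_cast
    field_simp
    ring
  · simp

theorem integrable_natCast_poissonMeasure (r : ℝ≥0) :
    Integrable (fun n : ℕ => (n : ℝ)) (poissonMeasure r) := by
  rw [integrable_poissonMeasure_iff]
  simpa using (hasSum_poisson_mean r).summable

theorem integral_natCast_poissonMeasure (r : ℝ≥0) :
    ∫ n : ℕ, (n : ℝ) ∂poissonMeasure r = r := by
  rw [integral_poissonMeasure]
  exact (hasSum_poisson_mean r).tsum_eq

theorem poissonMeasure_eq_withDensity {r s : ℝ≥0} (hs : 0 < s) :
    poissonMeasure r = (poissonMeasure s).withDensity fun n =>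
      ENNReal.ofReal (Real.exp (s - r) * ((r : ℝ) / s) ^ n) := by
  refine Measure.ext_of_singleton fun n => ?_
  have hs' : (0 : ℝ) < s := hs
  rw [withDensity_apply _ (measurableSet_singleton n), lintegral_singleton,
    poissonMeasure_singleton, poissonMeasure_singleton, ← ENNReal.ofReal_mul (by positivity),
    sub_eq_add_neg, Real.exp_add, div_pow, Real.exp_neg (s : ℝ)]
  congr 1
  field_simp

theorem klDiv_poissonMeasure {r s : ℝ≥0} (hr : 0 < r) (hs : 0 < s) :
    klDiv (poissonMeasure r) (poissonMeasure s)
      = ENNReal.ofReal (r * Real.log (r / s) + s - r) := by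
  have hs' : (0 : ℝ) < s := hs
  have hr' : (0 : ℝ) < r := hr
  have hac : poissonMeasure r ≪ poissonMeasure s := by
    rw [poissonMeasure_eq_withDensity (r := r) hs]
    exact withDensity_absolutelyContinuous _ _
  have hllr : llr (poissonMeasure r) (poissonMeasure s)
      =ᵐ[poissonMeasure r] fun n : ℕ => (s - r : ℝ) + n * Real.log (r / s) := by
    refine hac.ae_le ?_
    have h := Measure.rnDeriv_withDensity (poissonMeasure s) (f := fun n : ℕ =>
      ENNReal.ofReal (Real.exp (s - r) * ((r : ℝ) / s) ^ n)) .of_discrete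
    rw [← poissonMeasure_eq_withDensity hs] at h
    filter_upwards [h] with n hn
    rw [llr, hn, ENNReal.toReal_ofReal (by positivity), Real.log_mul (by positivity)
      (by positivity), Real.log_exp, Real.log_pow]
  have hint := (integrable_natCast_poissonMeasure r).mul_const (Real.log (r / s))
  rw [klDiv_of_ac_of_integrable hac, integral_congr_ae hllr,
    integral_add (integrable_const _) hint, integral_mul_const, integral_natCast_poissonMeasure]
  · simp only [integral_const, probReal_univ, smul_eq_mul]
    congr 1
    ring
  · rw [integrable_congr hllr]
    exact (integrable_const _).add hint

/-- The chi-square divergence between two Poisson laws is finite. -/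
theorem lintegral_poisson_chiSq_ne_top (r s : ℝ≥0) :
    ∫⁻ n : ℕ, ENNReal.ofReal ((Real.exp (s - r) * ((r : ℝ) / s) ^ n - 1) ^ 2)
      ∂poissonMeasure s ≠ ∞ := by
  have h : Integrable (fun n : ℕ => (Real.exp (s - r) * ((r : ℝ) / s) ^ n - 1) ^ 2)
      (poissonMeasure s) := by
    have h1 := (summable_poisson_mul_pow s (((r : ℝ) / s) ^ 2)).const_mul (Real.exp (s - r) ^ 2)
    have h2 := (summable_poisson_mul_pow s ((r : ℝ) / s)).const_mul (2 * Real.exp (s - r))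
    refine ((h1.sub h2).add (integrable_const (1 : ℝ))).congr (ae_of_all _ fun n => ?_)
    simp only [Pi.add_apply, Pi.sub_apply]
    ring
  exact (hasFiniteIntegral_iff_ofReal (ae_of_all _ fun n => sq_nonneg _)).1 h.2 |>.ne

/-- The divergence of a mixture from one of its components is quadratic in the weight of the
other component. -/
theorem klDiv_poisson_mixture_le {r s : ℝ≥0} (hs : 0 < s) {p : ℝ} (hp0 : 0 ≤ p) (hp1 : p ≤ 1) :
    klDiv (ENNReal.ofReal (1 - p) • poissonMeasure s + ENNReal.ofReal p • poissonMeasure r)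
        (poissonMeasure s)
      ≤ ENNReal.ofReal (p ^ 2) * ∫⁻ n : ℕ,
          ENNReal.ofReal ((Real.exp (s - r) * ((r : ℝ) / s) ^ n - 1) ^ 2) ∂poissonMeasure s := by
  set u : ℕ → ℝ := fun n => Real.exp (s - r) * ((r : ℝ) / s) ^ n with hu
  have hu0 (n : ℕ) : 0 ≤ u n := by positivity
  have h1p : 0 ≤ 1 - p := by linarith
  have hmix : ENNReal.ofReal (1 - p) • poissonMeasure s + ENNReal.ofReal p • poissonMeasure r
      = (poissonMeasure s).withDensity fun n => ENNReal.ofReal (1 - p + p * u n) := by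
    rw [poissonMeasure_eq_withDensity (r := r) hs]
    refine Measure.ext_of_singleton fun n => ?_
    simp only [Measure.add_apply, Measure.smul_apply, smul_eq_mul,
      withDensity_apply _ (measurableSet_singleton n), lintegral_singleton]
    rw [ENNReal.ofReal_add h1p (mul_nonneg hp0 (hu0 n)), ENNReal.ofReal_mul hp0, add_mul, mul_assoc]
  have hint : Integrable (fun n => 1 - p + p * u n) (poissonMeasure s) :=
    (integrable_const _).add (((summable_poisson_mul_pow s _).const_mul _).const_mul _)
  have hpos (n : ℕ) : 0 ≤ 1 - p + p * u n := by have := hu0 n; positivity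
  rw [hmix, klDiv_withDensity_eq_lintegral .of_discrete hpos hint,
    ← lintegral_const_mul _ .of_discrete]
  refine lintegral_mono fun n => ?_
  rw [← ENNReal.ofReal_mul (sq_nonneg p)]
  refine ENNReal.ofReal_le_ofReal ?_
  show klFun (1 - p + p * u n) ≤ p ^ 2 * (u n - 1) ^ 2
  set t := 1 - p + p * u n with ht
  have heq : p ^ 2 * (u n - 1) ^ 2 = (t - 1) ^ 2 := by rw [ht]; ring
  rw [heq, klFun_apply]
  rcases (hpos n).eq_or_lt with h | h
  · rw [← ht] at h
    simp [← h]
  -- From log t ≤ t - 1: klFun t = t log t + 1 - t ≤ (t - 1)².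
  · nlinarith [mul_le_mul_of_nonneg_left (Real.log_le_sub_one_of_pos h) (hpos n)]

end Poisson

/-- The divergence (nats per second) between the outputs for the intensities `x` and `0`. -/
noncomputable def divRate (a l x : ℝ) : ℝ := (a * x + l) * Real.log (1 + a * x / l) - a * x

theorem divRate_zero (a l : ℝ) : divRate a l 0 = 0 := by simp [divRate]

theorem hasDerivAt_divRate {a l x : ℝ} (ha : 0 < a) (hl : 0 < l) (hx : 0 ≤ x) :
    HasDerivAt (divRate a l) (a * Real.log (1 + a * x / l)) x := by
  have hpos : 0 < 1 + a * x / l := by positivity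
  have h1 : HasDerivAt (fun y : ℝ => a * y) a x := by simpa using (hasDerivAt_id x).const_mul a
  have h2 : HasDerivAt (fun y : ℝ => 1 + a * y / l) (a / l) x := (h1.div_const l).const_add 1
  have h3 := ((h1.add_const l).mul (h2.log hpos.ne')).sub h1
  refine h3.congr_deriv ?_
  have : a * x + l ≠ 0 := by positivity
  have : l + a * x ≠ 0 := by positivity
  field_simp
  ring

theorem hasDerivAt_mul_log {a l x : ℝ} (ha : 0 < a) (hl : 0 < l) (hx : 0 ≤ x) :
    HasDerivAt (fun y => a * Real.log (1 + a * y / l)) (a ^ 2 / (l + a * x)) x := by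
  have hpos : 0 < 1 + a * x / l := by positivity
  have h1 : HasDerivAt (fun y : ℝ => a * y) a x := by simpa using (hasDerivAt_id x).const_mul a
  have h2 : HasDerivAt (fun y : ℝ => 1 + a * y / l) (a / l) x := (h1.div_const l).const_add 1
  refine ((h2.log hpos.ne').const_mul a).congr_deriv ?_
  have : l + a * x ≠ 0 := by positivity
  field_simp

theorem divRate_nonneg {a l x : ℝ} (ha : 0 < a) (hl : 0 < l) (hx : 0 ≤ x) :
    0 ≤ divRate a l x := by
  have hpos : 0 < 1 + a * x / l := by positivity
  have h := klFun_nonneg hpos.le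
  rw [klFun_apply] at h
  -- The divergence rate is l times `klFun` of the intensity ratio 1 + a x / l.
  have h2 : divRate a l x = l * ((1 + a * x / l) * Real.log (1 + a * x / l) + 1
      - (1 + a * x / l)) := by
    rw [divRate]; field_simp; ring
  rw [h2]; positivity

/-! ### Convexity of the gap between the two divergence rates -/

section Gap

variable {aB lB aE lE : ℝ}

/-- The function is the derivative of the gap. Its own derivative is positive iff aE² (lB + aB x) <
aB² (lE + aE x), which is checked coefficient by coefficient in x: a strict gain inequality makes
the linear terms strict (x > 0), a strict dark-current inequality the constant terms. -/
theorem strictMonoOn_deriv_gap (haE : 0 < aE) (hlB : 0 < lB) (hlE : 0 < lE) (hgain : aE ≤ aB)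
    (hdark : lB / aB ≤ lE / aE) (hstrict : aE < aB ∨ lB / aB < lE / aE) :
    StrictMonoOn (fun x => aB * Real.log (1 + aB * x / lB) - aE * Real.log (1 + aE * x / lE))
      (Set.Ici 0) := by
  have haB : 0 < aB := haE.trans_le hgain
  have hder (x : ℝ) (hx : 0 ≤ x) := (hasDerivAt_mul_log haB hlB hx).sub
    (hasDerivAt_mul_log haE hlE hx)
  refine strictMonoOn_of_deriv_pos (convex_Ici 0)
    (fun x hx => (hder x hx).continuousAt.continuousWithinAt) fun x hx => ?_
  rw [interior_Ici] at hx
  have hx : 0 < x := hx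
  have h : deriv (fun x => aB * Real.log (1 + aB * x / lB) - aE * Real.log (1 + aE * x / lE)) x
      = aB ^ 2 / (lB + aB * x) - aE ^ 2 / (lE + aE * x) := (hder x hx.le).deriv
  rw [h, sub_pos, div_lt_div_iff₀ (by positivity) (by positivity)]
  rw [div_le_div_iff₀ haB haE] at hdark
  rw [div_lt_div_iff₀ haB haE] at hstrict
  have h1 : aE * (lB * aE) ≤ aE * (lE * aB) := by gcongr
  have h2 : aE * (lE * aB) ≤ aB * (lE * aB) := by gcongr
  have h3 : aE * (aE * aB * x) ≤ aB * (aE * aB * x) := by gcongr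
  rcases hstrict with hs | hs
  · have h4 : aE * (aE * aB * x) < aB * (aE * aB * x) := by gcongr
    nlinarith
  · have h4 : aE * (lB * aE) < aE * (lE * aB) := by gcongr
    nlinarith

/-- A convex function vanishing at 0 lies below its chord from 0 to A. This is why, per unit of mean
intensity, nothing beats signalling at the peak. -/
theorem divRate_gap_le (haE : 0 < aE) (hlB : 0 < lB) (hlE : 0 < lE) (hgain : aE ≤ aB)
    (hdark : lB / aB ≤ lE / aE) (hstrict : aE < aB ∨ lB / aB < lE / aE) {x A : ℝ} (hx : 0 ≤ x)
    (hxA : x ≤ A) (hA : 0 < A) :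
    divRate aB lB x - divRate aE lE x ≤ x / A * (divRate aB lB A - divRate aE lE A) := by
  have haB : 0 < aB := haE.trans_le hgain
  have hder (x : ℝ) (hx : 0 ≤ x) := (hasDerivAt_divRate haB hlB hx).sub
    (hasDerivAt_divRate haE hlE hx)
  have hmono := strictMonoOn_deriv_gap haE hlB hlE hgain hdark hstrict
  have hconv : StrictConvexOn ℝ (Set.Ici 0) (divRate aB lB - divRate aE lE) := by
    refine StrictMonoOn.strictConvexOn_of_deriv (convex_Ici 0)
      (fun x hx => (hder x hx).continuousAt.continuousWithinAt) ?_
    rw [interior_Ici]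
    intro y hy z hz hyz
    rw [(hder y (Set.mem_Ioi.1 hy).le).deriv, (hder z (Set.mem_Ioi.1 hz).le).deriv]
    exact hmono (Set.Ioi_subset_Ici_self hy) (Set.Ioi_subset_Ici_self hz) hyz
  have h := hconv.convexOn.2 (Set.mem_Ici.2 le_rfl) (Set.mem_Ici.2 hA.le)
    (sub_nonneg.2 ((div_le_one hA).2 hxA)) (div_nonneg hx hA.le) (by ring)
  simp only [smul_eq_mul, mul_zero, zero_add, Pi.sub_apply, divRate_zero, sub_zero,
    div_mul_cancel₀ x hA.ne'] at h
  exact h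

/-- The derivative of the gap vanishes at 0 and increases strictly, so the gap itself increases
strictly from 0. -/
theorem divRate_gap_pos (haE : 0 < aE) (hlB : 0 < lB) (hlE : 0 < lE) (hgain : aE ≤ aB)
    (hdark : lB / aB ≤ lE / aE) (hstrict : aE < aB ∨ lB / aB < lE / aE) {A : ℝ} (hA : 0 < A) :
    0 < divRate aB lB A - divRate aE lE A := by
  have haB : 0 < aB := haE.trans_le hgain
  have hder (x : ℝ) (hx : 0 ≤ x) := (hasDerivAt_divRate haB hlB hx).sub
    (hasDerivAt_divRate haE hlE hx)
  have hmono := strictMonoOn_deriv_gap haE hlB hlE hgain hdark hstrict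
  have h : StrictMonoOn (divRate aB lB - divRate aE lE) (Set.Ici 0) := by
    refine strictMonoOn_of_deriv_pos (convex_Ici 0)
      (fun x hx => (hder x hx).continuousAt.continuousWithinAt) fun x hx => ?_
    rw [interior_Ici] at hx
    rw [(hder x (Set.mem_Ioi.1 hx).le).deriv]
    simpa using hmono (Set.mem_Ici.2 le_rfl) (Set.Ioi_subset_Ici_self hx) hx
  simpa [divRate_zero] using h (Set.mem_Ici.2 le_rfl) (Set.mem_Ici.2 hA.le) hA

theorem divRate_gap_eq {A : ℝ} (hA : 0 < A) :
    divRate aB lB A - divRate aE lE A = A * ((aB + lB / A) * Real.log (1 + aB * A / lB)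
      - (aE + lE / A) * Real.log (1 + aE * A / lE) + (aE - aB)) := by
  rw [divRate, divRate]
  field_simp
  ring

end Gap

/-! ### The Poisson channels and their degradedness -/

section Channel

theorem poissonChannel_apply (a l Δ x : ℝ) :
    poissonChannel a l Δ x = poissonMeasure ((a * x + l) * Δ).toNNReal := rfl

theorem poissonChannel_ne_zero {a l Δ x : ℝ} (ha : 0 < a) (hl : 0 < l) (hΔ : 0 < Δ) (hx : 0 ≤ x)
    (k : ℕ) : poissonChannel a l Δ x {k} ≠ 0 := by
  have h : 0 < ((a * x + l) * Δ).toNNReal := Real.toNNReal_pos.2 (by positivity)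
  rw [poissonChannel_apply, poissonMeasure_singleton]
  have : (0 : ℝ) < ((a * x + l) * Δ).toNNReal := h
  simp only [ne_eq, ENNReal.ofReal_eq_zero, not_le]
  positivity

theorem klDiv_poissonChannel {a l Δ x : ℝ} (ha : 0 < a) (hl : 0 < l) (hΔ : 0 < Δ) (hx : 0 ≤ x) :
    klDiv (poissonChannel a l Δ x) (poissonChannel a l Δ 0)
      = ENNReal.ofReal (Δ * divRate a l x) := by
  rw [poissonChannel_apply, poissonChannel_apply, klDiv_poissonMeasure
    (Real.toNNReal_pos.2 (by positivity)) (Real.toNNReal_pos.2 (by positivity)),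
    Real.coe_toNNReal _ (by positivity), Real.coe_toNNReal _ (by positivity), divRate]
  congr 1
  have : (a * x + l) * Δ / ((a * 0 + l) * Δ) = 1 + a * x / l := by
    field_simp
    ring
  rw [this]
  ring

/-- The channel of the eavesdropper is a degraded version of the main channel. -/
theorem exists_degrading_kernel {aB lB aE lE Δ : ℝ} (haE : 0 < aE) (hlB : 0 < lB) (hlE : 0 < lE)
    (hΔ : 0 < Δ) (hgain : aE ≤ aB) (hdark : lB / aB ≤ lE / aE) :
    ∃ T : Kernel ℕ ℕ, IsMarkovKernel T ∧ ∀ x, 0 ≤ x →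
      T ∘ₘ poissonChannel aB lB Δ x = poissonChannel aE lE Δ x := by
  have haB : 0 < aB := haE.trans_le hgain
  have hq0 : 0 ≤ aE / aB := by positivity
  have hq : aE / aB ∈ unitInterval := ⟨hq0, (div_le_one haB).2 hgain⟩
  have hc : 0 ≤ (lE - aE / aB * lB) * Δ := by
    rw [div_le_div_iff₀ haB haE] at hdark
    refine mul_nonneg ?_ hΔ.le
    rw [sub_nonneg, div_mul_eq_mul_div, div_le_iff₀ haB]
    linarith
  -- Thinning with probability aE / aB corrects the gain and scales the dark current to aE lB / aB;
  -- the missing dark current, nonnegative by `hdark`, is added as independent Poisson noise.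
  refine ⟨poissonNoise ((lE - aE / aB * lB) * Δ).toNNReal ∘ₖ thinning ⟨_, hq⟩, inferInstance,
    fun x hx => ?_⟩
  rw [← Measure.comp_assoc, poissonChannel_apply, poissonChannel_apply,
    thinning_comp_poissonMeasure, poissonNoise_comp_poissonMeasure]
  congr 1
  ext
  rw [NNReal.coe_add, NNReal.coe_mul]
  rw [Real.coe_toNNReal _ hq0, Real.coe_toNNReal _ (by positivity), Real.coe_toNNReal _ hc,
    Real.coe_toNNReal _ (by positivity)]
  field_simp
  ring

end Channel

/-! ### Information through degraded channels; Fano's inequality -/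

section Degraded

variable {α β γ W : Type*} [MeasurableSpace α] [MeasurableSpace β] [MeasurableSpace γ]
  [MeasurableSpace W]

/-- Degradedness is required only almost everywhere, because the Poisson channels are related by the
degrading kernel only at nonnegative intensities. -/
theorem mutualInfo_le_of_degraded (μ : Measure α) [IsProbabilityMeasure μ] (κ : Kernel α β)
    [IsMarkovKernel κ] (η : Kernel α γ) [IsMarkovKernel η] (T : Kernel β γ) [IsMarkovKernel T]
    (hT : ∀ᵐ x ∂μ, T ∘ₘ κ x = η x) : mutualInfo μ η ≤ mutualInfo μ κ := by
  have h : (T ∘ₖ κ) =ᵐ[μ] η := by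
    filter_upwards [hT] with x hx
    rw [Kernel.comp_apply, hx]
  have h1 : mutualInfo μ η = mutualInfo μ (T ∘ₖ κ) := by
    rw [mutualInfo, mutualInfo, Measure.compProd_congr h, Measure.bind_congr_right h]
  rw [h1]
  exact mutualInfo_comp_le μ κ T

/-- The compensation identity used twice, for the input given the message and then for the message
itself. The terms on the right are I(X;Y|W), I(W;Y) and the divergence of the overall output from ν.
-/
theorem lintegral_lintegral_klDiv_eq [StandardBorelSpace α] [Nonempty α] [Countable β]
    [MeasurableSingletonClass β] [StandardBorelSpace W] [Nonempty W] [Countable W]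
    (U : Measure W) [IsProbabilityMeasure U]
    (enc : Kernel W α) [IsMarkovKernel enc] (κ : Kernel α β) [IsMarkovKernel κ] (ν : Measure β)
    [IsProbabilityMeasure ν] (hν : ∀ b, ν {b} ≠ 0) :
    ∫⁻ w, ∫⁻ x, klDiv (κ x) ν ∂enc w ∂U = ∫⁻ w, mutualInfo (enc w) κ ∂U
      + (mutualInfo U (κ ∘ₖ enc) + klDiv (κ ∘ₘ (enc ∘ₘ U)) ν) := by
  have hac (μ : Measure β) : μ ≪ ν := absolutelyContinuous_of_full_support hν μ
  have h1 (w : W) : ∫⁻ x, klDiv (κ x) ν ∂enc w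
      = mutualInfo (enc w) κ + klDiv ((κ ∘ₖ enc) w) ν := by
    rw [Kernel.comp_apply]
    exact lintegral_klDiv_eq (enc w) κ ν fun x => hac _
  have hI := lintegral_klDiv_eq U (κ ∘ₖ enc) ν fun x => hac _
  rw [← Measure.comp_assoc] at hI
  rw [← hI, ← lintegral_add_left (measurable_of_countable _), ← lintegral_congr h1]

/-- For a degraded channel, the information that is leaked falls short of the information that is
received by at most a difference of divergences. -/
theorem mutualInfo_add_le_of_degraded [StandardBorelSpace α] [Nonempty α] [Countable β]
    [MeasurableSingletonClass β] [Countable γ] [MeasurableSingletonClass γ]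
    [StandardBorelSpace W] [Nonempty W] [Countable W]
    (U : Measure W) [IsProbabilityMeasure U] (enc : Kernel W α) [IsMarkovKernel enc]
    (κ : Kernel α β) [IsMarkovKernel κ] (η : Kernel α γ) [IsMarkovKernel η]
    (T : Kernel β γ) [IsMarkovKernel T] (hT : ∀ w, ∀ᵐ x ∂enc w, T ∘ₘ κ x = η x)
    (ν : Measure β) [IsProbabilityMeasure ν] (hν : ∀ b, ν {b} ≠ 0)
    (hTν : ∀ c, (T ∘ₘ ν) {c} ≠ 0) :
    mutualInfo U (κ ∘ₖ enc) + ∫⁻ w, ∫⁻ x, klDiv (η x) (T ∘ₘ ν) ∂enc w ∂U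
      ≤ mutualInfo U (η ∘ₖ enc) + ∫⁻ w, ∫⁻ x, klDiv (κ x) ν ∂enc w ∂U := by
  have hU : η ∘ₘ (enc ∘ₘ U) = T ∘ₘ (κ ∘ₘ (enc ∘ₘ U)) := by
    rw [Measure.comp_assoc, Measure.comp_assoc, Measure.comp_assoc]
    congr 1
    ext w : 1
    rw [Kernel.comp_apply, Kernel.comp_apply]
    exact Measure.bind_congr_right ((hT w).mono fun x hx => by rw [Kernel.comp_apply, hx])
  rw [lintegral_lintegral_klDiv_eq U enc κ ν hν, lintegral_lintegral_klDiv_eq U enc η _ hTν, hU]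
  -- Degradedness enters through two data-processing inequalities: I(X;Z|W) ≤ I(X;Y|W), and
  -- contraction under T of the divergence of the overall output.
  have h1 : ∫⁻ w, mutualInfo (enc w) η ∂U ≤ ∫⁻ w, mutualInfo (enc w) κ ∂U :=
    lintegral_mono fun w => mutualInfo_le_of_degraded _ κ η T (hT w)
  have h2 := klDiv_comp_right_le (κ ∘ₘ (enc ∘ₘ U)) ν T
  calc _ = mutualInfo U (η ∘ₖ enc) + (∫⁻ w, mutualInfo (enc w) η ∂U + (mutualInfo U (κ ∘ₖ enc)
        + klDiv (T ∘ₘ (κ ∘ₘ (enc ∘ₘ U))) (T ∘ₘ ν))) := by ring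
    _ ≤ _ := by gcongr

/-- Fano's inequality. -/
theorem mul_one_sub_error_le {M : ℕ} [NeZero M] (η : Kernel (Fin M) β) [IsMarkovKernel η]
    [Countable β] [MeasurableSingletonClass β] (dec : β → Fin M) :
    ENNReal.ofReal (Real.log M) *
      (1 - (uniformOn (Set.univ : Set (Fin M)) ⊗ₘ η) {p | dec p.2 ≠ p.1})
      ≤ mutualInfo (uniformOn (Set.univ : Set (Fin M))) η + 1 := by
  set U := uniformOn (Set.univ : Set (Fin M)) with hU
  have hUp : IsProbabilityMeasure U :=
    isProbabilityMeasure_uniformOn Set.finite_univ Set.univ_nonempty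
  have hM : (1 : ℝ) ≤ M := by exact_mod_cast NeZero.one_le
  have hdec : Measurable dec := measurable_of_countable _
  have hs : MeasurableSet {p : Fin M × β | dec p.2 = p.1} :=
    measurableSet_eq_fun (hdec.comp measurable_snd) measurable_fst
  -- The event is correct decoding, of probability 1/M under the product law. With c = log M the
  -- correction term is (M - 1)/M ≤ 1, which replaces the binary entropy of the usual form.
  have h := mul_measure_le_klDiv_add (U ⊗ₘ η) (U.prod (η ∘ₘ U)) (s := {p | dec p.2 = p.1})
    (Real.log_nonneg hM)
  have h1 : (U ⊗ₘ η) {p | dec p.2 = p.1} = 1 - (U ⊗ₘ η) {p | dec p.2 ≠ p.1} := by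
    have h := prob_compl_eq_one_sub (μ := U ⊗ₘ η) hs.compl
    rwa [compl_compl] at h
  have h2 : (U.prod (η ∘ₘ U)) {p | dec p.2 = p.1} = (M : ℝ≥0∞)⁻¹ := by
    rw [Measure.prod_apply_symm hs]
    have : ∀ y, U ((fun x => (x, y)) ⁻¹' {p | dec p.2 = p.1}) = (M : ℝ≥0∞)⁻¹ := fun y => by
      have : ((fun x => (x, y)) ⁻¹' {p : Fin M × β | dec p.2 = p.1}) = {dec y} := by
        ext x; simp [eq_comm]
      rw [this, hU, uniformOn_univ]
      simp
    simp_rw [this]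
    simp
  rw [h1, h2, Real.exp_log (by linarith)] at h
  refine h.trans ?_
  have h3 : ENNReal.ofReal ((M : ℝ) - 1) * (M : ℝ≥0∞)⁻¹ ≤ 1 := by
    rw [← div_eq_mul_inv]
    refine ENNReal.div_le_of_le_mul ?_
    rw [one_mul]
    refine (ENNReal.ofReal_le_ofReal (sub_le_self _ zero_le_one)).trans ?_
    simp
  exact add_le_add le_rfl h3

end Degraded

/-! ### The converse for block codes -/

section Converse

variable {aB lB aE lE Δ A : ℝ}

/-- A crude uniform bound, used only to know that mean divergences are finite and may be cancelled.
-/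
theorem divRate_le {a l x A : ℝ} (ha : 0 < a) (hl : 0 < l) (hx : 0 ≤ x) (hxA : x ≤ A) :
    divRate a l x ≤ (a * A + l) * Real.log (1 + a * A / l) := by
  have hA : 0 ≤ A := hx.trans hxA
  have h1 : Real.log (1 + a * x / l) ≤ Real.log (1 + a * A / l) := by gcongr
  have h2 : 0 ≤ Real.log (1 + a * x / l) := Real.log_nonneg (by
    have : 0 ≤ a * x / l := by positivity
    linarith)
  have h3 : (a * x + l) * Real.log (1 + a * x / l) ≤ (a * A + l) * Real.log (1 + a * A / l) := by
    gcongr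
  have : 0 ≤ a * x := by positivity
  rw [divRate]
  linarith

theorem memoryless_apply (κ : Kernel ℝ ℕ) [IsMarkovKernel κ] {n : ℕ} (x : Fin n → ℝ) :
    memoryless κ n x = Measure.pi fun i => κ (x i) := rfl

theorem memoryless_ne_zero (κ : Kernel ℝ ℕ) [IsMarkovKernel κ] {n : ℕ} {x : Fin n → ℝ}
    (h : ∀ i k, κ (x i) {k} ≠ 0) (y : Fin n → ℕ) : memoryless κ n x {y} ≠ 0 := by
  rw [memoryless_apply, Measure.pi_singleton]
  exact Finset.prod_ne_zero_iff.2 fun i _ => h i _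

theorem klDiv_memoryless_poisson {a l : ℝ} (ha : 0 < a) (hl : 0 < l) (hΔ : 0 < Δ) {n : ℕ}
    {x : Fin n → ℝ} (hx : ∀ i, 0 ≤ x i) :
    klDiv (memoryless (poissonChannel a l Δ) n x) (memoryless (poissonChannel a l Δ) n 0)
      = ∑ i, ENNReal.ofReal (Δ * divRate a l (x i)) := by
  rw [memoryless_apply, memoryless_apply, klDiv_pi]
  exact Finset.sum_congr rfl fun i _ => klDiv_poissonChannel ha hl hΔ (hx i)

theorem divRate_gap_le_mul (haE : 0 < aE) (hlB : 0 < lB) (hlE : 0 < lE) (hgain : aE ≤ aB)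
    (hdark : lB / aB ≤ lE / aE) (hstrict : aE < aB ∨ lB / aB < lE / aE) {x L : ℝ} (hA : 0 < A)
    (hL : divRate aB lB A - divRate aE lE A = A * L) (hx : x ∈ Set.Icc 0 A) :
    divRate aB lB x ≤ divRate aE lE x + L * x := by
  have h := divRate_gap_le haE hlB hlE hgain hdark hstrict hx.1 hx.2 hA
  rw [hL, div_mul_eq_mul_div, mul_left_comm, mul_div_cancel_left₀ _ hA.ne'] at h
  linarith

/-- The single-block converse. -/
theorem WiretapCode.converse (haE : 0 < aE) (hlB : 0 < lB) (hlE : 0 < lE) (hΔ : 0 < Δ)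
    (hA : 0 < A) (hgain : aE ≤ aB)
    (hdark : lB / aB ≤ lE / aE) (hstrict : aE < aB ∨ lB / aB < lE / aE) {L E : ℝ} (hL0 : 0 ≤ L)
    (hL : divRate aB lB A - divRate aE lE A = A * L) {n M : ℕ} [NeZero M]
    (c : WiretapCode A E n M) :
    ENNReal.ofReal (Real.log M) * (1 - c.errorProb (poissonChannel aB lB Δ))
      ≤ c.leakage (poissonChannel aE lE Δ) + ENNReal.ofReal (Δ * L * E * n) + 1 := by
  have haB : 0 < aB := haE.trans_le hgain
  have := c.markov
  set κ := poissonChannel aB lB Δ with hκ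
  set η := poissonChannel aE lE Δ with hη
  set U := uniformOn (Set.univ : Set (Fin M)) with hU
  have hUp : IsProbabilityMeasure U :=
    isProbabilityMeasure_uniformOn Set.finite_univ Set.univ_nonempty
  refine (mul_one_sub_error_le (memoryless κ n ∘ₖ c.enc) c.dec).trans ?_
  refine add_le_add ?_ le_rfl
  obtain ⟨T, hTm, hT⟩ := exists_degrading_kernel haE hlB hlE hΔ hgain hdark
  have hTn {x : Fin n → ℝ} (hx : ∀ i, 0 ≤ x i) :
      productKernel T n ∘ₘ memoryless κ n x = memoryless η n x := by
    rw [memoryless_apply, productKernel_comp_pi, memoryless_apply]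
    congr 1
    funext i
    exact hT _ (hx i)
  have hpeak (m : Fin M) : ∀ᵐ x ∂c.enc m, ∀ i, x i ∈ Set.Icc 0 A := c.peak m
  have hT0 : productKernel T n ∘ₘ memoryless κ n 0 = memoryless η n 0 := hTn fun i => le_rfl
  have hne {a l : ℝ} (ha : 0 < a) (hl : 0 < l) := memoryless_ne_zero (poissonChannel a l Δ)
    (n := n) (x := 0) fun i k => poissonChannel_ne_zero ha hl hΔ le_rfl k
  have h := mutualInfo_add_le_of_degraded U c.enc (memoryless κ n) (memoryless η n)
    (productKernel T n) (fun m => (hpeak m).mono fun x hx => hTn fun i => (hx i).1)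
    (memoryless κ n 0) (hne haB hlB) (by rw [hT0]; exact hne haE hlE)
  rw [hT0] at h
  -- This is the term cancelled from both sides at the end.
  have hfin : ∫⁻ w, ∫⁻ x, klDiv (memoryless η n x) (memoryless η n 0) ∂c.enc w ∂U ≠ ∞ := by
    refine ne_top_of_le_ne_top (b := ENNReal.ofReal
      (n * (Δ * ((aE * A + lE) * Real.log (1 + aE * A / lE))))) ENNReal.ofReal_ne_top ?_
    have h1 (w : Fin M) : ∫⁻ x, klDiv (memoryless η n x) (memoryless η n 0) ∂c.enc w
        ≤ ENNReal.ofReal (n * (Δ * ((aE * A + lE) * Real.log (1 + aE * A / lE)))) := by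
      refine (lintegral_mono_ae (g := fun _ => ENNReal.ofReal
        (n * (Δ * ((aE * A + lE) * Real.log (1 + aE * A / lE)))))
        ((hpeak w).mono fun x hx => ?_)).trans (by simp)
      rw [klDiv_memoryless_poisson haE hlE hΔ fun i => (hx i).1,
        ENNReal.ofReal_mul (Nat.cast_nonneg n), ENNReal.ofReal_natCast]
      refine (Finset.sum_le_card_nsmul _ _ _ fun i _ => ENNReal.ofReal_le_ofReal
        (mul_le_mul_of_nonneg_left (divRate_le haE hlE (hx i).1 (hx i).2) hΔ.le)).trans ?_
      simp
    exact (lintegral_mono h1).trans (by simp)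
  -- The chord bound, summed over the slots and averaged; the total mean intensity is at most n E.
  have hgap : ∫⁻ w, ∫⁻ x, klDiv (memoryless κ n x) (memoryless κ n 0) ∂c.enc w ∂U
      ≤ ∫⁻ w, ∫⁻ x, klDiv (memoryless η n x) (memoryless η n 0) ∂c.enc w ∂U
        + ENNReal.ofReal (Δ * L * E * n) := by
    have hcost : ∫⁻ w, ∫⁻ x, ∑ i, ENNReal.ofReal (Δ * L * x i) ∂c.enc w ∂U
        ≤ ENNReal.ofReal (Δ * L * E * n) := by
      have hae : ∀ᵐ x ∂(c.enc ∘ₘ U), ∀ i, x i ∈ Set.Icc 0 A :=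
        Measure.ae_comp_of_ae_ae (by
          rw [Set.ofPred_forall]
          exact MeasurableSet.iInter fun i => measurable_pi_apply i measurableSet_Icc)
          (ae_of_all _ hpeak)
      have hmeas (i : Fin n) : Measurable fun x : Fin n → ℝ => x i := measurable_pi_apply i
      have hmeas' (i : Fin n) : Measurable fun x : Fin n → ℝ => ENNReal.ofReal (Δ * L * x i) :=
        ((hmeas i).const_mul _).ennreal_ofReal
      rw [← Measure.lintegral_bind (Kernel.aemeasurable _)
        (Finset.measurable_sum _ fun i _ => hmeas' i).aemeasurable,
        lintegral_finsetSum _ fun i _ => hmeas' i]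
      have hi (i : Fin n) : ∫⁻ x, ENNReal.ofReal (Δ * L * x i) ∂(c.enc ∘ₘ U)
          = ENNReal.ofReal (Δ * L * ∫ x, x i ∂(c.enc ∘ₘ U)) := by
        rw [← integral_const_mul, ofReal_integral_eq_lintegral_ofReal]
        · refine Integrable.const_mul (Integrable.of_bound (hmeas i).aestronglyMeasurable A ?_) _
          filter_upwards [hae] with x hx
          rw [Real.norm_eq_abs, abs_of_nonneg (hx i).1]
          exact (hx i).2
        · filter_upwards [hae] with x hx
          exact mul_nonneg (by positivity) (hx i).1
      rw [Finset.sum_congr rfl fun i _ => hi i, ← ENNReal.ofReal_sum_of_nonneg, ← Finset.mul_sum]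
      · refine ENNReal.ofReal_le_ofReal ?_
        rw [mul_assoc (Δ * L)]
        refine mul_le_mul_of_nonneg_left ?_ (by positivity)
        have hav := c.average
        -- For n = 0 the average constraint divides by zero and says nothing about the sum, but the
        -- sum is empty.
        rcases Nat.eq_zero_or_pos n with hn | hn
        · subst hn; simp
        · rwa [div_le_iff₀ (by exact_mod_cast hn)] at hav
      · intro i _
        refine mul_nonneg (by positivity) (integral_nonneg_of_ae ?_)
        filter_upwards [hae] with x hx using (hx i).1
    refine le_trans ?_ (add_le_add le_rfl hcost)
    rw [← lintegral_add_left (measurable_of_countable _)]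
    refine lintegral_mono fun w => ?_
    rw [← lintegral_add_right _ (by fun_prop)]
    refine lintegral_mono_ae ((hpeak w).mono fun x hx => ?_)
    rw [klDiv_memoryless_poisson haE hlE hΔ fun i => (hx i).1,
      klDiv_memoryless_poisson haB hlB hΔ fun i => (hx i).1, ← Finset.sum_add_distrib]
    refine Finset.sum_le_sum fun i _ => ?_
    have := (hx i).1
    rw [← ENNReal.ofReal_add (mul_nonneg hΔ.le (divRate_nonneg haE hlE this)) (by positivity)]
    refine ENNReal.ofReal_le_ofReal ?_
    have := divRate_gap_le_mul haE hlB hlE hgain hdark hstrict hA hL (hx i)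
    nlinarith
  have h2 := h.trans (add_le_add le_rfl hgap)
  rw [← add_assoc, add_right_comm] at h2
  exact (ENNReal.add_le_add_iff_right hfin).1 h2

/-- The block converse divided by n: as the error probability and the normalized leakage vanish, so
does Fano's 1/n, leaving Δ R ≤ Δ L E. -/
theorem secureRates_le (haE : 0 < aE) (hlB : 0 < lB) (hlE : 0 < lE) (hΔ : 0 < Δ)
    (hA : 0 < A) (hgain : aE ≤ aB)
    (hdark : lB / aB ≤ lE / aE) (hstrict : aE < aB ∨ lB / aB < lE / aE) {L E : ℝ} (hL0 : 0 ≤ L)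
    (hE : 0 ≤ E) (hL : divRate aB lB A - divRate aE lE A = A * L) {R : ℝ}
    (hR : R ∈ secureRates (poissonChannel aB lB Δ) (poissonChannel aE lE Δ) Δ A E) :
    R ≤ L * E := by
  obtain ⟨hR0, c, herr, hleak⟩ := hR
  have key (n : ℕ) (hn : 1 ≤ n) :
      ENNReal.ofReal (Δ * R) * (1 - (c n).errorProb (poissonChannel aB lB Δ))
      ≤ (c n).leakage (poissonChannel aE lE Δ) / n + ENNReal.ofReal (Δ * L * E)
        + 1 / n := by
    have hM : 0 < ⌈Real.exp (n * Δ * R)⌉₊ := Nat.ceil_pos.2 (Real.exp_pos _)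
    have : NeZero ⌈Real.exp (n * Δ * R)⌉₊ := ⟨hM.ne'⟩
    have h := (c n).converse haE hlB hlE hΔ hA hgain hdark hstrict hL0 hL
    have hlog : n * (Δ * R) ≤ Real.log ⌈Real.exp (n * Δ * R)⌉₊ := by
      rw [Real.le_log_iff_exp_le (by exact_mod_cast hM), ← mul_assoc]
      exact Nat.le_ceil _
    have hn0 : (n : ℝ≥0∞) ≠ 0 := by exact_mod_cast (Nat.one_le_iff_ne_zero.1 hn)
    have h1 : n * (ENNReal.ofReal (Δ * R) * (1 - (c n).errorProb (poissonChannel aB lB Δ)))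
        ≤ (c n).leakage (poissonChannel aE lE Δ) + ENNReal.ofReal (Δ * L * E * n) + 1 := by
      refine le_trans ?_ h
      rw [← mul_assoc, ← ENNReal.ofReal_natCast, ← ENNReal.ofReal_mul (by positivity)]
      gcongr
    rw [ENNReal.ofReal_mul' (Nat.cast_nonneg n), ENNReal.ofReal_natCast] at h1
    calc _ ≤ ((c n).leakage (poissonChannel aE lE Δ) + ENNReal.ofReal (Δ * L * E) * n + 1) / n := by
          rw [ENNReal.le_div_iff_mul_le (Or.inl hn0) (Or.inl (ENNReal.natCast_ne_top n)), mul_comm]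
          exact h1
      _ = _ := by
          rw [ENNReal.add_div, ENNReal.add_div, ENNReal.mul_div_cancel_right hn0
            (ENNReal.natCast_ne_top n)]
  have hl : Tendsto (fun n : ℕ => ENNReal.ofReal (Δ * R) *
      (1 - (c n).errorProb (poissonChannel aB lB Δ))) atTop (𝓝 (ENNReal.ofReal (Δ * R) * (1 - 0))) :=
    ENNReal.Tendsto.const_mul (ENNReal.Tendsto.sub tendsto_const_nhds herr (Or.inl (by simp)))
      (Or.inr ENNReal.ofReal_ne_top)
  have h1n : Tendsto (fun n : ℕ => (1 : ℝ≥0∞) / n) atTop (𝓝 0) := by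
    simpa using ENNReal.tendsto_inv_nat_nhds_zero
  have hr := (hleak.add (tendsto_const_nhds (x := ENNReal.ofReal (Δ * L * E)))).add h1n
  have hle := le_of_tendsto_of_tendsto hl hr (eventually_atTop.2 ⟨1, key⟩)
  rw [tsub_zero, mul_one, zero_add, add_zero, ENNReal.ofReal_le_ofReal_iff (by positivity)] at hle
  rw [mul_assoc] at hle
  exact le_of_mul_le_mul_left hle hΔ

end Converse

/-! ### The single-letter expression and the binary input -/

section SingleLetter

variable {aB lB aE lE a l Δ A E : ℝ}

theorem lintegral_klDiv_poissonChannel (ha : 0 < a) (hl : 0 < l) (hΔ : 0 < Δ)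
    (μ : Measure ℝ) [IsProbabilityMeasure μ] :
    ∫⁻ x, klDiv (poissonChannel a l Δ x) (poissonChannel a l Δ 0) ∂μ
      = mutualInfo μ (poissonChannel a l Δ)
        + klDiv (poissonChannel a l Δ ∘ₘ μ) (poissonChannel a l Δ 0) :=
  lintegral_klDiv_eq μ _ _ fun _ => absolutelyContinuous_of_full_support
    (fun k => poissonChannel_ne_zero ha hl hΔ le_rfl k) _

theorem lintegral_klDiv_poissonChannel_ne_top (ha : 0 < a) (hl : 0 < l) (hΔ : 0 < Δ)
    {μ : Measure ℝ} (hμ : μ ∈ feasible A E) :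
    ∫⁻ x, klDiv (poissonChannel a l Δ x) (poissonChannel a l Δ 0) ∂μ ≠ ∞ := by
  obtain ⟨hp, hpeak, -⟩ := hμ
  refine ne_top_of_le_ne_top (b := ENNReal.ofReal
      (Δ * ((a * A + l) * Real.log (1 + a * A / l)))) ENNReal.ofReal_ne_top ?_
  refine (lintegral_mono_ae (g := fun _ => ENNReal.ofReal
    (Δ * ((a * A + l) * Real.log (1 + a * A / l)))) (hpeak.mono fun x hx => ?_)).trans (by simp)
  rw [klDiv_poissonChannel ha hl hΔ hx.1]
  exact ENNReal.ofReal_le_ofReal (mul_le_mul_of_nonneg_left (divRate_le ha hl hx.1 hx.2) hΔ.le)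

theorem mutualInfo_poissonChannel_ne_top (ha : 0 < a) (hl : 0 < l) (hΔ : 0 < Δ)
    {μ : Measure ℝ} (hμ : μ ∈ feasible A E) : mutualInfo μ (poissonChannel a l Δ) ≠ ∞ := by
  have := hμ.1
  have h := lintegral_klDiv_poissonChannel_ne_top ha hl hΔ hμ
  rw [lintegral_klDiv_poissonChannel ha hl hΔ] at h
  exact (ENNReal.add_ne_top.1 h).1

/-- The converse argument for one slot and without a message: compensation identity for both
channels at the dark output, data processing for the output divergences, chord bound for the rest.
-/
theorem infoDiff_le (haE : 0 < aE) (hlB : 0 < lB) (hlE : 0 < lE) (hΔ : 0 < Δ)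
    (hA : 0 < A) (hgain : aE ≤ aB)
    (hdark : lB / aB ≤ lE / aE) (hstrict : aE < aB ∨ lB / aB < lE / aE) {L : ℝ} (hL0 : 0 ≤ L)
    (hE : 0 ≤ E) (hL : divRate aB lB A - divRate aE lE A = A * L) {μ : Measure ℝ}
    (hμ : μ ∈ feasible A E) :
    infoDiff (poissonChannel aB lB Δ) (poissonChannel aE lE Δ) Δ μ ≤ L * E := by
  have haB : 0 < aB := haE.trans_le hgain
  have hIE := mutualInfo_poissonChannel_ne_top haE hlE hΔ hμ
  have hGE := lintegral_klDiv_poissonChannel_ne_top haE hlE hΔ hμ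
  obtain ⟨hp, hpeak, hmean⟩ := hμ
  obtain ⟨T, hTm, hT⟩ := exists_degrading_kernel haE hlB hlE hΔ hgain hdark
  have hcomp : T ∘ₘ (poissonChannel aB lB Δ ∘ₘ μ) = poissonChannel aE lE Δ ∘ₘ μ := by
    rw [Measure.comp_assoc]
    exact Measure.bind_congr_right (hpeak.mono fun x hx => by
      rw [Kernel.comp_apply, hT x hx.1])
  have hD := klDiv_comp_right_le (poissonChannel aB lB Δ ∘ₘ μ) (poissonChannel aB lB Δ 0) T
  rw [hcomp, hT 0 le_rfl] at hD
  have hG : ∫⁻ x, klDiv (poissonChannel aB lB Δ x) (poissonChannel aB lB Δ 0) ∂μ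
      ≤ ∫⁻ x, klDiv (poissonChannel aE lE Δ x) (poissonChannel aE lE Δ 0) ∂μ
        + ENNReal.ofReal (Δ * L * E) := by
    have hcost : ∫⁻ x, ENNReal.ofReal (Δ * L * x) ∂μ ≤ ENNReal.ofReal (Δ * L * E) := by
      rw [← ofReal_integral_eq_lintegral_ofReal, integral_const_mul]
      · gcongr
      · refine Integrable.const_mul (Integrable.of_bound (by fun_prop) A ?_) _
        filter_upwards [hpeak] with x hx
        rw [Real.norm_eq_abs, abs_of_nonneg hx.1]
        exact hx.2
      · filter_upwards [hpeak] with x hx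
        exact mul_nonneg (by positivity) hx.1
    refine le_trans ?_ (add_le_add le_rfl hcost)
    rw [← lintegral_add_right _ (by fun_prop)]
    refine lintegral_mono_ae (hpeak.mono fun x hx => ?_)
    have := hx.1
    rw [klDiv_poissonChannel haE hlE hΔ hx.1, klDiv_poissonChannel haB hlB hΔ hx.1,
      ← ENNReal.ofReal_add (mul_nonneg hΔ.le (divRate_nonneg haE hlE this)) (by positivity)]
    refine ENNReal.ofReal_le_ofReal ?_
    have := divRate_gap_le_mul haE hlB hlE hgain hdark hstrict hA hL hx
    nlinarith
  rw [lintegral_klDiv_poissonChannel haE hlE hΔ] at hG hGE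
  rw [lintegral_klDiv_poissonChannel haB hlB hΔ] at hG
  have h1 : mutualInfo μ (poissonChannel aB lB Δ)
      ≤ mutualInfo μ (poissonChannel aE lE Δ) + ENNReal.ofReal (Δ * L * E) := by
    have h2 := (add_le_add le_rfl hD).trans hG
    rw [add_right_comm] at h2
    exact (ENNReal.add_le_add_iff_right (ENNReal.add_ne_top.1 hGE).2).1 h2
  have h3 := ENNReal.toReal_mono (ENNReal.add_ne_top.2 ⟨hIE, ENNReal.ofReal_ne_top⟩) h1
  rw [ENNReal.toReal_add hIE ENNReal.ofReal_ne_top, ENNReal.toReal_ofReal (by positivity)] at h3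
  rw [infoDiff, div_le_iff₀ hΔ]
  linarith

theorem isProbabilityMeasure_binaryInput (hE : 0 ≤ E) (hEA : E ≤ A) (hA : 0 < A) :
    IsProbabilityMeasure (binaryInput A E) := by
  refine ⟨?_⟩
  rw [binaryInput]
  simp only [Measure.add_apply, Measure.smul_apply, measure_univ, smul_eq_mul, mul_one]
  rw [← ENNReal.ofReal_add (sub_nonneg.2 ((div_le_one hA).2 hEA)) (by positivity)]
  simp

theorem binaryInput_mem_feasible (hE : 0 ≤ E) (hEA : E ≤ A) (hA : 0 < A) :
    binaryInput A E ∈ feasible A E := by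
  refine ⟨isProbabilityMeasure_binaryInput hE hEA hA, ?_, ?_⟩
  · rw [binaryInput, ae_add_measure_iff]
    constructor
    · exact Measure.ae_smul_measure ((ae_dirac_iff measurableSet_Icc).2 ⟨le_rfl, hA.le⟩) _
    · exact Measure.ae_smul_measure ((ae_dirac_iff measurableSet_Icc).2 ⟨hA.le, le_rfl⟩) _
  · rw [binaryInput, integral_add_measure, integral_smul_measure, integral_smul_measure,
      integral_dirac, integral_dirac, smul_zero, zero_add,
      ENNReal.toReal_ofReal (div_nonneg hE hA.le), smul_eq_mul, div_mul_cancel₀ E hA.ne']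
    · exact (integrable_dirac (by simp)).smul_measure ENNReal.ofReal_ne_top
    · exact (integrable_dirac (by simp)).smul_measure ENNReal.ofReal_ne_top

theorem comp_binaryInput (κ : Kernel ℝ ℕ) :
    κ ∘ₘ binaryInput A E = ENNReal.ofReal (1 - E / A) • κ 0 + ENNReal.ofReal (E / A) • κ A := by
  rw [binaryInput, Measure.comp_add, Measure.comp_smul, Measure.comp_smul,
    Measure.dirac_bind κ.measurable, Measure.dirac_bind κ.measurable]

theorem lintegral_binaryInput (f : ℝ → ℝ≥0∞) :
    ∫⁻ x, f x ∂binaryInput A E = ENNReal.ofReal (1 - E / A) * f 0 + ENNReal.ofReal (E / A) * f A := by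
  rw [binaryInput, lintegral_add_measure, lintegral_smul_measure, lintegral_smul_measure,
    lintegral_dirac, lintegral_dirac]
  rfl

/-- The information rate of the binary input is the divergence rate up to a second order term. -/
theorem exists_mutualInfo_binaryInput_bound (ha : 0 < a) (hl : 0 < l) (hΔ : 0 < Δ) (hA : 0 < A) :
    ∃ C : ℝ, ∀ E, 0 ≤ E → E ≤ A →
      (mutualInfo (binaryInput A E) (poissonChannel a l Δ)).toReal ≤ E / A * (Δ * divRate a l A) ∧
      E / A * (Δ * divRate a l A) - C * E ^ 2
        ≤ (mutualInfo (binaryInput A E) (poissonChannel a l Δ)).toReal := by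
  set κ := poissonChannel a l Δ with hκ
  -- χ is the chi-square divergence between the outputs at intensities A and 0. It does not depend
  -- on E, so the output divergence of the binary input is at most χ (E/A)².
  obtain ⟨χ, hχ, hmix⟩ : ∃ χ : ℝ≥0∞, χ ≠ ∞ ∧ ∀ p, 0 ≤ p → p ≤ 1 →
      klDiv (ENNReal.ofReal (1 - p) • κ 0 + ENNReal.ofReal p • κ A) (κ 0)
        ≤ ENNReal.ofReal (p ^ 2) * χ :=
    ⟨_, lintegral_poisson_chiSq_ne_top _ _, fun p hp0 hp1 => klDiv_poisson_mixture_le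
      (Real.toNNReal_pos.2 (by positivity)) hp0 hp1⟩
  refine ⟨χ.toReal / A ^ 2, fun E hE hEA => ?_⟩
  have := isProbabilityMeasure_binaryInput hE hEA hA
  have hp0 : 0 ≤ E / A := by positivity
  have hD := hmix (E / A) hp0 ((div_le_one hA).2 hEA)
  rw [← comp_binaryInput] at hD
  have hDfin := ne_top_of_le_ne_top (ENNReal.mul_ne_top ENNReal.ofReal_ne_top hχ) hD
  have hIfin := mutualInfo_poissonChannel_ne_top ha hl hΔ (binaryInput_mem_feasible hE hEA hA)
  have h := lintegral_klDiv_poissonChannel ha hl hΔ (binaryInput A E)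
  rw [lintegral_binaryInput, klDiv_self, mul_zero, zero_add,
    klDiv_poissonChannel ha hl hΔ hA.le, ← ENNReal.ofReal_mul hp0] at h
  have h2 := congrArg ENNReal.toReal h
  rw [ENNReal.toReal_add hIfin hDfin, ENNReal.toReal_ofReal
    (mul_nonneg hp0 (mul_nonneg hΔ.le (divRate_nonneg ha hl hA.le)))] at h2
  have h3 := ENNReal.toReal_mono (ENNReal.mul_ne_top ENNReal.ofReal_ne_top hχ) hD
  rw [ENNReal.toReal_mul, ENNReal.toReal_ofReal (by positivity)] at h3
  have h4 : (E / A) ^ 2 * χ.toReal = χ.toReal / A ^ 2 * E ^ 2 := by ring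
  constructor
  · rw [h2]
    exact le_add_of_nonneg_right ENNReal.toReal_nonneg
  · rw [h2]
    linarith

/-- The second-order loss comes from the legitimate receiver alone: for the eavesdropper the
first-order term already bounds the information from above. -/
theorem exists_infoDiff_binaryInput_ge (haB : 0 < aB) (haE : 0 < aE) (hlB : 0 < lB)
    (hlE : 0 < lE) (hΔ : 0 < Δ) (hA : 0 < A) {L : ℝ}
    (hL : divRate aB lB A - divRate aE lE A = A * L) :
    ∃ C : ℝ, ∀ E, 0 ≤ E → E ≤ A → L * E - C * E ^ 2
      ≤ infoDiff (poissonChannel aB lB Δ) (poissonChannel aE lE Δ) Δ (binaryInput A E) := by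
  obtain ⟨C, hC⟩ := exists_mutualInfo_binaryInput_bound haB hlB hΔ hA
  obtain ⟨C', hC'⟩ := exists_mutualInfo_binaryInput_bound haE hlE hΔ hA
  refine ⟨C / Δ, fun E hE hEA => ?_⟩
  have h1 := (hC E hE hEA).2
  have h2 := (hC' E hE hEA).1
  rw [infoDiff, le_div_iff₀ hΔ]
  have h3 : (L * E - C / Δ * E ^ 2) * Δ
      = E / A * (Δ * divRate aB lB A) - E / A * (Δ * divRate aE lE A) - C * E ^ 2 := by
    rw [sub_mul, div_mul_eq_mul_div, div_mul_cancel₀ _ hΔ.ne', ← mul_sub, ← mul_sub, hL]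
    field_simp
  linarith

end SingleLetter

/-! ### Averages over random codebooks -/

section RandomCodebook

variable {X ι : Type*} [Fintype X] [Fintype ι] [DecidableEq ι]

/-- The probability of a codebook whose words are drawn independently from `p`. -/
def codebookWeight (p : X → ℝ) (c : ι → X) : ℝ := ∏ i, p (c i)

theorem codebookWeight_nonneg {X ι : Type*} [Fintype ι] {p : X → ℝ} (hp : ∀ x, 0 ≤ p x) (c : ι → X) :
    0 ≤ codebookWeight p c :=
  Finset.prod_nonneg fun _ _ => hp _

theorem sum_prod_codebook (h : ι → X → ℝ) : ∑ c : ι → X, ∏ i, h i (c i) = ∏ i, ∑ x, h i x := by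
  rw [Finset.prod_univ_sum, Fintype.piFinset_univ]

theorem sum_codebookWeight {p : X → ℝ} (hp : ∑ x, p x = 1) :
    ∑ c : ι → X, codebookWeight p c = 1 := by
  simp only [codebookWeight]
  rw [sum_prod_codebook fun _ => p]
  simp [hp]

theorem sum_codebookWeight_mul_mul {p : X → ℝ} (hp : ∑ x, p x = 1) {i j : ι} (hij : i ≠ j)
    (f g : X → ℝ) : ∑ c : ι → X, codebookWeight p c * (f (c i) * g (c j))
      = (∑ x, p x * f x) * ∑ x, p x * g x := by
  have h (c : ι → X) : codebookWeight p c * (f (c i) * g (c j))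
      = ∏ k, p (c k) * ((if k = i then f (c k) else 1) * (if k = j then g (c k) else 1)) := by
    rw [Finset.prod_mul_distrib, Finset.prod_mul_distrib, Finset.prod_ite_eq', Finset.prod_ite_eq']
    simp [codebookWeight]
  simp_rw [h]
  rw [sum_prod_codebook fun k x =>
    p x * ((if k = i then f x else 1) * (if k = j then g x else 1)),
    ← Finset.mul_prod_erase _ _ (Finset.mem_univ i),
    ← Finset.mul_prod_erase _ _ (Finset.mem_erase.2 ⟨hij.symm, Finset.mem_univ j⟩), ← mul_assoc]
  rw [Finset.prod_eq_one fun k hk => ?_]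
  · simp [hij, hij.symm]
  · have h1 := (Finset.mem_erase.1 hk).1
    have h2 := (Finset.mem_erase.1 (Finset.mem_erase.1 hk).2).1
    simp [h1, h2, hp]

/-- Words at distinct indices are independent. Expanding f in indicators of pairs of letters reduces
this to the case of a product. -/
theorem sum_codebookWeight_pair {p : X → ℝ} (hp : ∑ x, p x = 1) {i j : ι} (hij : i ≠ j)
    (f : X → X → ℝ) : ∑ c : ι → X, codebookWeight p c * f (c i) (c j)
      = ∑ x, p x * ∑ x', p x' * f x x' := by
  classical
  have h (c : ι → X) : codebookWeight p c * f (c i) (c j) = ∑ x, ∑ x', f x x' *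
      (codebookWeight p c * ((if c i = x then 1 else 0) * (if c j = x' then 1 else 0))) := by
    simp [mul_comm]
  simp_rw [h]
  rw [Finset.sum_comm]
  refine Finset.sum_congr rfl fun x _ => ?_
  rw [Finset.sum_comm, Finset.mul_sum]
  refine Finset.sum_congr rfl fun x' _ => ?_
  rw [← Finset.mul_sum, sum_codebookWeight_mul_mul hp hij (fun y => if y = x then 1 else 0)
    (fun y => if y = x' then 1 else 0)]
  simp
  ring

theorem sum_codebookWeight_single {p : X → ℝ} (hp : ∑ x, p x = 1) (i : ι) (f : X → ℝ) :
    ∑ c : ι → X, codebookWeight p c * f (c i) = ∑ x, p x * f x := by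
  have h (c : ι → X) : codebookWeight p c * f (c i)
      = ∏ k, p (c k) * (if k = i then f (c k) else 1) := by
    rw [Finset.prod_mul_distrib, Finset.prod_ite_eq']
    simp [codebookWeight]
  simp_rw [h]
  rw [sum_prod_codebook fun k x => p x * (if k = i then f x else 1),
    ← Finset.mul_prod_erase _ _ (Finset.mem_univ i), Finset.prod_eq_one fun k hk => ?_]
  · simp
  · simp [(Finset.mem_erase.1 hk).1, hp]

theorem exists_le_of_sum_weight_mul_le {C : Type*} [Fintype C] {w F : C → ℝ} (hw0 : ∀ c, 0 ≤ w c)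
    (hw : ∑ c, w c = 1) {b : ℝ} (h : ∑ c, w c * F c ≤ b) : ∃ c, F c ≤ b := by
  by_contra! hc
  have h1 : ∑ c, w c * b < ∑ c, w c * F c := by
    refine Finset.sum_lt_sum (fun c _ => mul_le_mul_of_nonneg_left (hc c).le (hw0 c)) ?_
    by_contra! h0
    have : ∑ c, w c ≤ 0 := Finset.sum_nonpos fun c _ => by
      by_contra! hpos
      exact absurd (h0 c (Finset.mem_univ c)) (not_le.2 (mul_lt_mul_of_pos_left (hc c) hpos))
    linarith
  rw [← Finset.sum_mul, hw, one_mul] at h1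
  linarith

end RandomCodebook

/-! ### One-shot error and resolvability bounds -/

section OneShot

variable {X : Type*} [Fintype X] {p : X → ℝ}
  {Y : Type*} [MeasurableSpace Y] [DiscreteMeasurableSpace Y] {Q : Measure Y}
  [IsProbabilityMeasure Q] {r : X → Y → ℝ} {B : ℝ}

/-- `r x` is the density of the output law for the input `x` relative to the output law `Q` that
is induced by the input law `p`. -/
structure IsChannelDensity (p : X → ℝ) (Q : Measure Y) (r : X → Y → ℝ) (B : ℝ) : Prop where
  weight_nonneg : ∀ x, 0 ≤ p x
  weight_sum : ∑ x, p x = 1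
  nonneg : ∀ x y, 0 ≤ r x y
  le : ∀ x y, r x y ≤ B
  integral : ∀ x, ∫ y, r x y ∂Q = 1
  mix : ∀ y, ∑ x, p x * r x y = 1

namespace IsChannelDensity

theorem integrable_mul (h : IsChannelDensity p Q r B) (x : X) {f : Y → ℝ} {C : ℝ}
    (hf : ∀ y, |f y| ≤ C) : Integrable (fun y => r x y * f y) Q := by
  refine Integrable.of_bound (Measurable.of_discrete.aestronglyMeasurable) (B * C)
    (ae_of_all _ fun y => ?_)
  rw [Real.norm_eq_abs, abs_mul, abs_of_nonneg (h.nonneg x y)]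
  have := (h.nonneg x y).trans (h.le x y)
  gcongr
  · exact h.le x y
  · exact hf y

theorem integrable (h : IsChannelDensity p Q r B) (x : X) : Integrable (r x) Q := by
  simpa using h.integrable_mul x (f := fun _ => 1) (C := 1) (by simp)

theorem sum_integral_mul (h : IsChannelDensity p Q r B) {f : Y → ℝ} {C : ℝ}
    (hf : ∀ y, |f y| ≤ C) : ∑ x, p x * ∫ y, r x y * f y ∂Q = ∫ y, f y ∂Q := by
  simp_rw [← integral_const_mul]
  rw [← integral_finsetSum _ fun x _ => (h.integrable_mul x hf).const_mul _]
  refine integral_congr_ae (ae_of_all _ fun y => ?_)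
  simp only
  simp_rw [← mul_assoc]
  rw [← Finset.sum_mul, h.mix, one_mul]

/-- Threshold decoding. -/
theorem exists_decoder {ι : Type*} [Fintype ι] [DecidableEq ι] [Nonempty ι]
    (h : IsChannelDensity p Q r B) (θ : ℝ) (c : ι → X) :
    ∃ D : Y → ι, ∀ i, ∫ y, r (c i) y * (if D y = i then 0 else 1) ∂Q
      ≤ ∫ y, r (c i) y * (if r (c i) y ≤ θ then 1 else 0) ∂Q
        + ∑ j ∈ Finset.univ.erase i, ∫ y, r (c i) y * (if r (c j) y ≤ θ then 0 else 1) ∂Q := by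
  classical
  -- Any index whose density exceeds θ will do. An error at i then forces either r (c i) ≤ θ or some
  -- other word above θ, whence the union bound.
  let D : Y → ι := fun y => if hy : ∃ i, θ < r (c i) y then hy.choose else Classical.arbitrary ι
  have hD (y : Y) (hy : ∃ i, θ < r (c i) y) : θ < r (c (D y)) y := by
    simp only [D, dif_pos hy]
    exact hy.choose_spec
  refine ⟨D, fun i => ?_⟩
  have hb (P : Y → Prop) [DecidablePred P] (y : Y) : |if P y then (0 : ℝ) else 1| ≤ 1 := by
    split_ifs <;> simp
  have hb' (P : Y → Prop) [DecidablePred P] (y : Y) : |if P y then (1 : ℝ) else 0| ≤ 1 := by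
    split_ifs <;> simp
  rw [← integral_finsetSum _ fun j _ => h.integrable_mul _ (hb fun y => r (c j) y ≤ θ),
    ← integral_add (h.integrable_mul _ (hb' fun y => r (c i) y ≤ θ))
      (integrable_finsetSum _ fun j _ => h.integrable_mul _ (hb fun y => r (c j) y ≤ θ))]
  refine integral_mono (h.integrable_mul _ (hb fun y => D y = i))
    ((h.integrable_mul _ (hb' fun y => r (c i) y ≤ θ)).add
      (integrable_finsetSum _ fun j _ => h.integrable_mul _ (hb fun y => r (c j) y ≤ θ)))
    fun y => ?_
  simp only
  rw [← Finset.mul_sum, ← mul_add]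
  refine mul_le_mul_of_nonneg_left ?_ (h.nonneg _ _)
  have hnn : (0 : ℝ) ≤ ∑ j ∈ Finset.univ.erase i, (if r (c j) y ≤ θ then (0 : ℝ) else 1) :=
    Finset.sum_nonneg fun j _ => by split_ifs <;> simp
  by_cases hi : r (c i) y ≤ θ
  · rw [if_pos hi]
    split_ifs <;> linarith
  · rw [if_neg hi, zero_add]
    by_cases hDi : D y = i
    · rwa [if_pos hDi]
    · rw [if_neg hDi]
      have hmem : D y ∈ Finset.univ.erase i := Finset.mem_erase.2 ⟨hDi, Finset.mem_univ _⟩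
      refine le_trans ?_ (Finset.single_le_sum
        (f := fun j => if r (c j) y ≤ θ then (0 : ℝ) else 1)
        (fun j _ => by split_ifs <;> simp) hmem)
      simp [not_le.2 (hD y ⟨i, not_le.1 hi⟩)]

/-- Averaged over the word actually sent, the output has law Q whatever the competing word x'. Since
r x' integrates to 1 against Q, Markov's inequality gives probability at most 1/θ of exceeding θ. -/
theorem sum_confusion_le (h : IsChannelDensity p Q r B) {θ : ℝ} (hθ : 0 < θ) :
    ∑ x, p x * ∑ x', p x' * ∫ y, r x y * (if r x' y ≤ θ then 0 else 1) ∂Q ≤ θ⁻¹ := by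
  have hb (P : Y → Prop) [DecidablePred P] (y : Y) : |if P y then (0 : ℝ) else 1| ≤ 1 := by
    split_ifs <;> simp
  have hswap : ∑ x, p x * ∑ x', p x' * ∫ y, r x y * (if r x' y ≤ θ then 0 else 1) ∂Q
      = ∑ x', p x' * ∫ y, (if r x' y ≤ θ then (0 : ℝ) else 1) ∂Q := by
    simp_rw [Finset.mul_sum]
    rw [Finset.sum_comm]
    refine Finset.sum_congr rfl fun x' _ => ?_
    rw [← h.sum_integral_mul (hb fun y => r x' y ≤ θ), Finset.mul_sum]
    exact Finset.sum_congr rfl fun x _ => by ring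
  rw [hswap]
  calc _ ≤ ∑ x', p x' * θ⁻¹ := by
        refine Finset.sum_le_sum fun x' _ => mul_le_mul_of_nonneg_left ?_ (h.weight_nonneg x')
        have : ∫ y, (if r x' y ≤ θ then (0 : ℝ) else 1) ∂Q ≤ ∫ y, r x' y * θ⁻¹ ∂Q := by
          refine integral_mono (Integrable.of_bound Measurable.of_discrete.aestronglyMeasurable 1
            (ae_of_all _ (hb fun y => r x' y ≤ θ))) ((h.integrable x').mul_const _) fun y => ?_
          simp only
          split_ifs with hy
          · exact mul_nonneg (h.nonneg _ _) (by positivity)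
          · rw [← div_eq_mul_inv, one_le_div hθ]
            exact (not_le.1 hy).le
        rwa [integral_mul_const, h.integral, one_mul] at this
    _ = θ⁻¹ := by rw [← Finset.sum_mul, h.weight_sum, one_mul]

/-- The relative entropy, with respect to the output law of the random input, of the output law
for a uniformly chosen word of a codebook. -/
theorem resolvability_le {K : ℕ} [NeZero K] (h : IsChannelDensity p Q r B) (c : Fin K → X) :
    ∫ y, ((K : ℝ)⁻¹ * ∑ k, r (c k) y) * Real.log ((K : ℝ)⁻¹ * ∑ k, r (c k) y) ∂Q
      ≤ (K : ℝ)⁻¹ * ∑ k, (∫ y, r (c k) y * Real.log (1 + r (c k) y / K) ∂Q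
        - ∫ y, r (c k) y * (1 + r (c k) y / K)⁻¹ ∂Q
        + ∑ j ∈ Finset.univ.erase k,
          (K : ℝ)⁻¹ * ∫ y, r (c j) y * (r (c k) y * (1 + r (c k) y / K)⁻¹) ∂Q) := by
  have hK : (0 : ℝ) < K := by exact_mod_cast Nat.pos_of_ne_zero (NeZero.ne K)
  have hv (x : X) (y : Y) : 1 ≤ 1 + r x y / K := by
    have := h.nonneg x y
    have : 0 ≤ r x y / K := by positivity
    linarith
  have hinv (x : X) (y : Y) : |(1 + r x y / K)⁻¹| ≤ 1 := by
    rw [abs_of_nonneg (inv_nonneg.2 (zero_le_one.trans (hv x y)))]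
    exact inv_le_one_of_one_le₀ (hv x y)
  have hlog (x : X) (y : Y) : |Real.log (1 + r x y / K)| ≤ B / K := by
    rw [abs_of_nonneg (Real.log_nonneg (hv x y))]
    have h1 := Real.log_le_sub_one_of_pos (zero_lt_one.trans_le (hv x y))
    have h2 : r x y / K ≤ B / K := by
      have := h.le x y
      gcongr
    linarith
  have hrinv (x : X) (y : Y) : |r x y * (1 + r x y / K)⁻¹| ≤ B := by
    rw [abs_mul, abs_of_nonneg (h.nonneg x y)]
    exact (mul_le_of_le_one_right (h.nonneg x y) (hinv x y)).trans (h.le x y)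
  have hi1 (k : Fin K) := h.integrable_mul (c k) (hlog (c k))
  have hi2 (k : Fin K) := h.integrable_mul (c k) (hinv (c k))
  have hi3 (k j : Fin K) := (h.integrable_mul (c j) (hrinv (c k))).const_mul (K : ℝ)⁻¹
  have hi3s (k : Fin K) := integrable_finsetSum (Finset.univ.erase k) fun j _ => hi3 k j
  have hi4 (k : Fin K) : Integrable (fun y => r (c k) y * Real.log (1 + r (c k) y / K)
        - r (c k) y * (1 + r (c k) y / K)⁻¹
        + ∑ j ∈ Finset.univ.erase k,
          (K : ℝ)⁻¹ * (r (c j) y * (r (c k) y * (1 + r (c k) y / K)⁻¹))) Q :=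
    ((hi1 k).sub (hi2 k)).add (hi3s k)
  have hrhs : (K : ℝ)⁻¹ * ∑ k, (∫ y, r (c k) y * Real.log (1 + r (c k) y / K) ∂Q
        - ∫ y, r (c k) y * (1 + r (c k) y / K)⁻¹ ∂Q
        + ∑ j ∈ Finset.univ.erase k,
          (K : ℝ)⁻¹ * ∫ y, r (c j) y * (r (c k) y * (1 + r (c k) y / K)⁻¹) ∂Q)
      = ∫ y, (K : ℝ)⁻¹ * ∑ k, (r (c k) y * Real.log (1 + r (c k) y / K)
        - r (c k) y * (1 + r (c k) y / K)⁻¹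
        + ∑ j ∈ Finset.univ.erase k,
          (K : ℝ)⁻¹ * (r (c j) y * (r (c k) y * (1 + r (c k) y / K)⁻¹))) ∂Q := by
    rw [integral_const_mul, integral_finsetSum _ fun k _ => hi4 k]
    congr 1
    refine Finset.sum_congr rfl fun k _ => ?_
    rw [integral_add (f := fun y => r (c k) y * Real.log (1 + r (c k) y / K)
        - r (c k) y * (1 + r (c k) y / K)⁻¹) ((hi1 k).sub (hi2 k)) (hi3s k), integral_sub (hi1 k) (hi2 k),
      integral_finsetSum _ fun j _ => hi3 k j]
    simp_rw [integral_const_mul]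
  rw [hrhs]
  have hu0 (y : Y) : 0 ≤ (K : ℝ)⁻¹ * ∑ k, r (c k) y :=
    mul_nonneg (by positivity) (Finset.sum_nonneg fun k _ => h.nonneg _ _)
  have huB (y : Y) : (K : ℝ)⁻¹ * ∑ k, r (c k) y ≤ B := by
    rw [inv_mul_le_iff₀ hK]
    refine (Finset.sum_le_card_nsmul _ _ B fun k _ => h.le _ _).trans (by simp)
  obtain ⟨C, hC⟩ := (isCompact_Icc (a := (0:ℝ)) (b := B)).exists_bound_of_continuousOn
    Real.continuous_mul_log.continuousOn
  refine integral_mono (Integrable.of_bound Measurable.of_discrete.aestronglyMeasurable C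
    (ae_of_all _ fun y => hC _ ⟨hu0 y, huB y⟩))
    ((integrable_finsetSum _ fun k _ => hi4 k).const_mul _)
    fun y => ?_
  simp only
  set u := (K : ℝ)⁻¹ * ∑ k, r (c k) y with hu
  have hstep : u * Real.log u = (K : ℝ)⁻¹ * ∑ k, r (c k) y * Real.log u := by
    rw [← Finset.sum_mul, ← mul_assoc, ← hu]
  rw [hstep]
  refine mul_le_mul_of_nonneg_left (Finset.sum_le_sum fun k _ => ?_) (by positivity)
  set v := 1 + r (c k) y / K with hvdef
  have hv1 : 1 ≤ v := hv _ _
  have hsplit : u = (K : ℝ)⁻¹ * r (c k) y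
      + ∑ j ∈ Finset.univ.erase k, (K : ℝ)⁻¹ * r (c j) y := by
    rw [hu, Finset.mul_sum, Finset.add_sum_erase _ (fun j => (K : ℝ)⁻¹ * r (c j) y) (Finset.mem_univ k)]
  have hkey : r (c k) y * Real.log u
      ≤ r (c k) y * (Real.log v - v⁻¹ + (∑ j ∈ Finset.univ.erase k, (K : ℝ)⁻¹ * r (c j) y) * v⁻¹) := by
    rcases (h.nonneg (c k) y).eq_or_lt with h0 | h0
    · simp [← h0]
    · refine mul_le_mul_of_nonneg_left ?_ h0.le
      have hs : 0 ≤ ∑ j ∈ Finset.univ.erase k, (K : ℝ)⁻¹ * r (c j) y :=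
        Finset.sum_nonneg fun j _ => mul_nonneg (by positivity) (h.nonneg _ _)
      have hupos : 0 < u := by
        have : 0 < (K : ℝ)⁻¹ * r (c k) y := by positivity
        linarith
      -- Tangent line of the logarithm at v = 1 + r (c k) y / K. It makes the bound linear in the
      -- other words, so that they can later be averaged by pairwise independence instead of by
      -- Jensen's inequality.
      have hlg := Real.log_le_sub_one_of_pos (div_pos hupos (zero_lt_one.trans_le hv1))
      rw [Real.log_div hupos.ne' (zero_lt_one.trans_le hv1).ne'] at hlg
      have : u / v - 1 = -v⁻¹ + (∑ j ∈ Finset.univ.erase k, (K : ℝ)⁻¹ * r (c j) y) * v⁻¹ := by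
        have hv0 : v ≠ 0 := (zero_lt_one.trans_le hv1).ne'
        have : u = v - 1 + ∑ j ∈ Finset.univ.erase k, (K : ℝ)⁻¹ * r (c j) y := by
          rw [hsplit, hvdef]; ring
        rw [this]
        field_simp
        ring
      linarith
  refine hkey.trans (le_of_eq ?_)
  rw [mul_add, mul_sub, Finset.sum_mul, Finset.mul_sum]
  congr 1
  exact Finset.sum_congr rfl fun j _ => by ring

/-- The expected error bound of the threshold decoder for a random codebook. -/
theorem sum_weight_error_le {ι : Type*} [Fintype ι] [DecidableEq ι] [Nonempty ι]
    (h : IsChannelDensity p Q r B) {θ : ℝ} (hθ : 0 < θ) :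
    ∑ c : ι → X, codebookWeight p c * ((Fintype.card ι : ℝ)⁻¹ * ∑ i,
      (∫ y, r (c i) y * (if r (c i) y ≤ θ then 1 else 0) ∂Q
        + ∑ j ∈ Finset.univ.erase i, ∫ y, r (c i) y * (if r (c j) y ≤ θ then 0 else 1) ∂Q))
      ≤ ∑ x, p x * ∫ y, r x y * (if r x y ≤ θ then 1 else 0) ∂Q + Fintype.card ι * θ⁻¹ := by
  have hN : (0 : ℝ) < Fintype.card ι := by exact_mod_cast Fintype.card_pos
  have hterm (i : ι) : ∑ c : ι → X, codebookWeight p c *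
      (∫ y, r (c i) y * (if r (c i) y ≤ θ then 1 else 0) ∂Q
        + ∑ j ∈ Finset.univ.erase i, ∫ y, r (c i) y * (if r (c j) y ≤ θ then 0 else 1) ∂Q)
      ≤ ∑ x, p x * ∫ y, r x y * (if r x y ≤ θ then 1 else 0) ∂Q + Fintype.card ι * θ⁻¹ := by
    simp_rw [mul_add, Finset.mul_sum, Finset.sum_add_distrib]
    rw [sum_codebookWeight_single h.weight_sum i
      fun x => ∫ y, r x y * (if r x y ≤ θ then 1 else 0) ∂Q, Finset.sum_comm]
    refine add_le_add le_rfl ?_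
    refine (Finset.sum_le_card_nsmul _ _ θ⁻¹ fun j hj => ?_).trans ?_
    · rw [sum_codebookWeight_pair h.weight_sum (Finset.ne_of_mem_erase hj).symm
        fun x x' => ∫ y, r x y * (if r x' y ≤ θ then 0 else 1) ∂Q]
      exact h.sum_confusion_le hθ
    · rw [nsmul_eq_mul]
      gcongr
      exact (Finset.univ.card_erase_le).trans le_rfl
  have hcomm : ∑ c : ι → X, codebookWeight p c * ((Fintype.card ι : ℝ)⁻¹ * ∑ i,
      (∫ y, r (c i) y * (if r (c i) y ≤ θ then 1 else 0) ∂Q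
        + ∑ j ∈ Finset.univ.erase i, ∫ y, r (c i) y * (if r (c j) y ≤ θ then 0 else 1) ∂Q))
      = (Fintype.card ι : ℝ)⁻¹ * ∑ i, ∑ c : ι → X, codebookWeight p c *
      (∫ y, r (c i) y * (if r (c i) y ≤ θ then 1 else 0) ∂Q
        + ∑ j ∈ Finset.univ.erase i, ∫ y, r (c i) y * (if r (c j) y ≤ θ then 0 else 1) ∂Q) := by
    rw [Finset.sum_comm, Finset.mul_sum]
    refine Finset.sum_congr rfl fun c _ => ?_
    rw [← Finset.mul_sum]
    ring
  rw [hcomm, inv_mul_le_iff₀ hN]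
  refine (Finset.sum_le_card_nsmul _ _ _ fun i _ => hterm i).trans ?_
  rw [nsmul_eq_mul, Finset.card_univ]

/-- The expected relative entropy of the output law of a block of a random codebook. -/
theorem sum_weight_resolvability_le {ι : Type*} [Fintype ι] [DecidableEq ι] {K : ℕ} [NeZero K]
    (h : IsChannelDensity p Q r B) (e : Fin K → ι) (he : Function.Injective e) :
    ∑ c : ι → X, codebookWeight p c * ∫ y, ((K : ℝ)⁻¹ * ∑ k, r (c (e k)) y)
        * Real.log ((K : ℝ)⁻¹ * ∑ k, r (c (e k)) y) ∂Q
      ≤ ∑ x, p x * ∫ y, r x y * Real.log (1 + r x y / K) ∂Q := by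
  have hK : (0 : ℝ) < K := by exact_mod_cast Nat.pos_of_ne_zero (NeZero.ne K)
  set φ : X → Y → ℝ := fun x y => r x y * (1 + r x y / K)⁻¹ with hφ
  have hv (x : X) (y : Y) : 1 ≤ 1 + r x y / K := by
    have := h.nonneg x y
    have : 0 ≤ r x y / K := by positivity
    linarith
  have hφ0 (x : X) (y : Y) : 0 ≤ φ x y :=
    mul_nonneg (h.nonneg x y) (inv_nonneg.2 (zero_le_one.trans (hv x y)))
  have hφB (x : X) (y : Y) : |φ x y| ≤ B := by
    rw [abs_of_nonneg (hφ0 x y)]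
    exact (mul_le_of_le_one_right (h.nonneg x y) (inv_le_one_of_one_le₀ (hv x y))).trans (h.le x y)
  set S : ℝ := ∑ x, p x * ∫ y, φ x y ∂Q with hS
  have hS0 : 0 ≤ S := Finset.sum_nonneg fun x _ => mul_nonneg (h.weight_nonneg x)
    (integral_nonneg (hφ0 x))
  set G : ℝ := ∑ x, p x * ∫ y, r x y * Real.log (1 + r x y / K) ∂Q with hG
  have hterm (k : Fin K) : ∑ c : ι → X, codebookWeight p c *
      (∫ y, r (c (e k)) y * Real.log (1 + r (c (e k)) y / K) ∂Q - ∫ y, φ (c (e k)) y ∂Q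
        + ∑ j ∈ Finset.univ.erase k, (K : ℝ)⁻¹ * ∫ y, r (c (e j)) y * φ (c (e k)) y ∂Q) ≤ G := by
    simp_rw [mul_add, mul_sub, Finset.mul_sum, Finset.sum_add_distrib, Finset.sum_sub_distrib]
    rw [sum_codebookWeight_single h.weight_sum (e k)
      fun x => ∫ y, r x y * Real.log (1 + r x y / K) ∂Q,
      sum_codebookWeight_single h.weight_sum (e k) fun x => ∫ y, φ x y ∂Q, Finset.sum_comm, ← hS,
      ← hG]
    have hpair (j : Fin K) (hj : j ∈ Finset.univ.erase k) :
        ∑ c : ι → X, codebookWeight p c * ((K : ℝ)⁻¹ * ∫ y, r (c (e j)) y * φ (c (e k)) y ∂Q)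
          = (K : ℝ)⁻¹ * S := by
      have hne : e k ≠ e j := fun heq => Finset.ne_of_mem_erase hj (he heq).symm
      simp_rw [mul_left_comm _ (K : ℝ)⁻¹]
      rw [← Finset.mul_sum, sum_codebookWeight_pair h.weight_sum hne
        fun x x' => ∫ y, r x' y * φ x y ∂Q]
      simp_rw [h.sum_integral_mul (hφB _)]
      rfl
    rw [Finset.sum_congr rfl hpair, Finset.sum_const, nsmul_eq_mul,
      Finset.card_erase_of_mem (Finset.mem_univ k), Finset.card_univ, Fintype.card_fin]
    -- The K - 1 cross terms average to S / K each; their sum is at most S and is absorbed by the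
    -- term -S.
    have h1 : ((K - 1 : ℕ) : ℝ) * ((K : ℝ)⁻¹ * S) ≤ K * ((K : ℝ)⁻¹ * S) := by
      gcongr
      exact Nat.sub_le K 1
    rw [← mul_assoc, ← mul_assoc, mul_inv_cancel₀ hK.ne', one_mul] at h1
    rw [← mul_assoc]
    linarith
  calc _ ≤ ∑ c : ι → X, codebookWeight p c * ((K : ℝ)⁻¹ * ∑ k,
      (∫ y, r (c (e k)) y * Real.log (1 + r (c (e k)) y / K) ∂Q - ∫ y, φ (c (e k)) y ∂Q
        + ∑ j ∈ Finset.univ.erase k, (K : ℝ)⁻¹ * ∫ y, r (c (e j)) y * φ (c (e k)) y ∂Q)) :=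
        Finset.sum_le_sum fun c _ => mul_le_mul_of_nonneg_left
          (h.resolvability_le fun k => c (e k)) (codebookWeight_nonneg h.weight_nonneg c)
    _ = (K : ℝ)⁻¹ * ∑ k, ∑ c : ι → X, codebookWeight p c *
      (∫ y, r (c (e k)) y * Real.log (1 + r (c (e k)) y / K) ∂Q - ∫ y, φ (c (e k)) y ∂Q
        + ∑ j ∈ Finset.univ.erase k, (K : ℝ)⁻¹ * ∫ y, r (c (e j)) y * φ (c (e k)) y ∂Q) := by
        rw [Finset.sum_comm, Finset.mul_sum]
        refine Finset.sum_congr rfl fun c _ => ?_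
        rw [← Finset.mul_sum]
        ring
    _ ≤ G := by
        rw [inv_mul_le_iff₀ hK]
        refine (Finset.sum_le_card_nsmul _ _ _ fun i _ => hterm i).trans ?_
        rw [nsmul_eq_mul, Finset.card_univ, Fintype.card_fin]

/-- The averaged density has integral 1, so this is the integral of the nonnegative function
`klFun`. It permits the first-moment argument and the passage to `ENNReal.ofReal`. -/
theorem integral_mul_log_nonneg {K : ℕ} [NeZero K] (h : IsChannelDensity p Q r B) (c : Fin K → X) :
    0 ≤ ∫ y, ((K : ℝ)⁻¹ * ∑ k, r (c k) y) * Real.log ((K : ℝ)⁻¹ * ∑ k, r (c k) y) ∂Q := by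
  have hK : (0 : ℝ) < K := by exact_mod_cast Nat.pos_of_ne_zero (NeZero.ne K)
  set u : Y → ℝ := fun y => (K : ℝ)⁻¹ * ∑ k, r (c k) y with hu
  have hu0 (y : Y) : 0 ≤ u y :=
    mul_nonneg (by positivity) (Finset.sum_nonneg fun k _ => h.nonneg _ _)
  have huB (y : Y) : u y ≤ B := by
    rw [hu, inv_mul_le_iff₀ hK]
    refine (Finset.sum_le_card_nsmul _ _ B fun k _ => h.le _ _).trans (by simp)
  have hui : Integrable u Q := (integrable_finsetSum _ fun k _ => h.integrable (c k)).const_mul _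
  have hu1 : ∫ y, u y ∂Q = 1 := by
    rw [hu, integral_const_mul, integral_finsetSum _ fun k _ => h.integrable (c k)]
    simp [h.integral, hK.ne']
  obtain ⟨C, hC⟩ := (isCompact_Icc (a := (0:ℝ)) (b := B)).exists_bound_of_continuousOn
    Real.continuous_mul_log.continuousOn
  have hli : Integrable (fun y => u y * Real.log (u y)) Q :=
    Integrable.of_bound Measurable.of_discrete.aestronglyMeasurable C
      (ae_of_all _ fun y => hC _ ⟨hu0 y, huB y⟩)
  have h0 : 0 ≤ ∫ y, (u y * Real.log (u y) + 1 - u y) ∂Q :=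
    integral_nonneg fun y => klFun_nonneg (hu0 y)
  rw [integral_sub (by fun_prop) hui, integral_add hli (integrable_const _), hu1] at h0
  simpa using h0

/-- A one-shot achievability result for the wiretap channel: there is a codebook that is good at
the same time for the input cost, the error probability and the leakage. -/
theorem exists_codebook {Z : Type*} [MeasurableSpace Z] [DiscreteMeasurableSpace Z]
    {Q' : Measure Z} [IsProbabilityMeasure Q'] {r' : X → Z → ℝ} {B' : ℝ}
    (h : IsChannelDensity p Q r B) (h' : IsChannelDensity p Q' r' B') {M K : ℕ} [NeZero M]
    [NeZero K] {cost : X → ℝ} (hcost : ∀ x, 0 ≤ cost x) {θ a b g : ℝ} (hθ : 0 < θ) (ha : 0 < a)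
    (hb : 0 < b) (hg : 0 < g)
    (hsum : (∑ x, p x * cost x) / a
      + (∑ x, p x * ∫ y, r x y * (if r x y ≤ θ then 1 else 0) ∂Q + (M * K : ℝ) * θ⁻¹) / b
      + (∑ x, p x * ∫ z, r' x z * Real.log (1 + r' x z / K) ∂Q') / g ≤ 1) :
    ∃ (c : Fin M × Fin K → X) (D : Y → Fin M × Fin K),
      (M * K : ℝ)⁻¹ * ∑ i, cost (c i) ≤ a ∧
      (M * K : ℝ)⁻¹ * ∑ i, ∫ y, r (c i) y * (if D y = i then 0 else 1) ∂Q ≤ b ∧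
      (M : ℝ)⁻¹ * ∑ m, ∫ z, ((K : ℝ)⁻¹ * ∑ k, r' (c (m, k)) z)
        * Real.log ((K : ℝ)⁻¹ * ∑ k, r' (c (m, k)) z) ∂Q' ≤ g := by
  have hM : (0 : ℝ) < M := by exact_mod_cast Nat.pos_of_ne_zero (NeZero.ne M)
  have hK : (0 : ℝ) < K := by exact_mod_cast Nat.pos_of_ne_zero (NeZero.ne K)
  have hcard : (Fintype.card (Fin M × Fin K) : ℝ) = M * K := by simp
  set F₁ : (Fin M × Fin K → X) → ℝ := fun c => (M * K : ℝ)⁻¹ * ∑ i, cost (c i) with hF₁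
  set F₂ : (Fin M × Fin K → X) → ℝ := fun c => (M * K : ℝ)⁻¹ * ∑ i,
      (∫ y, r (c i) y * (if r (c i) y ≤ θ then 1 else 0) ∂Q
        + ∑ j ∈ Finset.univ.erase i, ∫ y, r (c i) y * (if r (c j) y ≤ θ then 0 else 1) ∂Q) with hF₂
  set F₃ : (Fin M × Fin K → X) → ℝ := fun c => (M : ℝ)⁻¹ * ∑ m,
      ∫ z, ((K : ℝ)⁻¹ * ∑ k, r' (c (m, k)) z)
        * Real.log ((K : ℝ)⁻¹ * ∑ k, r' (c (m, k)) z) ∂Q' with hF₃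
  have h1 : ∑ c, codebookWeight p c * F₁ c = ∑ x, p x * cost x := by
    simp_rw [hF₁, Finset.mul_sum]
    rw [Finset.sum_comm]
    simp_rw [mul_left_comm _ (M * K : ℝ)⁻¹, ← Finset.mul_sum,
      sum_codebookWeight_single h.weight_sum _ cost]
    rw [Finset.sum_const, nsmul_eq_mul, Finset.card_univ, hcard, inv_mul_cancel_left₀ (by positivity)]
  have h2 : ∑ c, codebookWeight p c * F₂ c
      ≤ ∑ x, p x * ∫ y, r x y * (if r x y ≤ θ then 1 else 0) ∂Q + (M * K : ℝ) * θ⁻¹ := by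
    have := h.sum_weight_error_le (ι := Fin M × Fin K) hθ
    rwa [hcard] at this
  have h3 : ∑ c, codebookWeight p c * F₃ c
      ≤ ∑ x, p x * ∫ z, r' x z * Real.log (1 + r' x z / K) ∂Q' := by
    simp_rw [hF₃, Finset.mul_sum]
    rw [Finset.sum_comm]
    simp_rw [mul_left_comm _ (M : ℝ)⁻¹, ← Finset.mul_sum]
    rw [inv_mul_le_iff₀ hM]
    refine (Finset.sum_le_card_nsmul _ _ _ fun m _ => h'.sum_weight_resolvability_le
      (fun k => (m, k)) fun k k' hk => (Prod.mk.inj hk).2).trans ?_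
    rw [nsmul_eq_mul, Finset.card_univ, Fintype.card_fin]
  -- The three requirements are merged into one functional with mean at most 1. Some codebook
  -- attains a value at most 1, and as the summands are nonnegative each is at most 1.
  obtain ⟨c, hc⟩ := exists_le_of_sum_weight_mul_le (w := codebookWeight p)
    (F := fun c => F₁ c / a + F₂ c / b + F₃ c / g) (codebookWeight_nonneg h.weight_nonneg)
    (sum_codebookWeight h.weight_sum) (b := 1) (by
      refine le_trans (le_of_eq ?_) ((add_le_add (add_le_add
        (div_le_div_of_nonneg_right h1.le ha.le) (div_le_div_of_nonneg_right h2 hb.le))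
        (div_le_div_of_nonneg_right h3 hg.le)).trans hsum)
      rw [Finset.sum_div, Finset.sum_div, Finset.sum_div, ← Finset.sum_add_distrib,
        ← Finset.sum_add_distrib]
      exact Finset.sum_congr rfl fun c _ => by ring)
  have hn1 : 0 ≤ F₁ c := mul_nonneg (by positivity) (Finset.sum_nonneg fun i _ => hcost _)
  have hn2 : 0 ≤ F₂ c := by
    refine mul_nonneg (by positivity) (Finset.sum_nonneg fun i _ => add_nonneg
      (integral_nonneg fun y => mul_nonneg (h.nonneg _ _) (by split_ifs <;> simp))
      (Finset.sum_nonneg fun j _ => integral_nonneg fun y => mul_nonneg (h.nonneg _ _)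
        (by split_ifs <;> simp)))
  have hn3 : 0 ≤ F₃ c := mul_nonneg (by positivity) (Finset.sum_nonneg fun m _ =>
    h'.integral_mul_log_nonneg fun k => c (m, k))
  have hd1 : 0 ≤ F₁ c / a := by positivity
  have hd2 : 0 ≤ F₂ c / b := by positivity
  have hd3 : 0 ≤ F₃ c / g := by positivity
  obtain ⟨D, hD⟩ := h.exists_decoder θ c
  refine ⟨c, D, ?_, ?_, ?_⟩
  · exact (div_le_one ha).1 (by linarith)
  · refine le_trans ?_ ((div_le_one hb).1 (by linarith : F₂ c / b ≤ 1))
    exact mul_le_mul_of_nonneg_left (Finset.sum_le_sum fun i _ => hD i) (by positivity)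
  · exact (div_le_one hg).1 (by linarith)

end IsChannelDensity

end OneShot

/-! ### Memoryless uses and the variance of the information density -/

section Product

variable {X : Type*} [Fintype X] {p : X → ℝ}
  {Y : Type*} [MeasurableSpace Y] [Countable Y] [MeasurableSingletonClass Y] {Q : Measure Y}
  [IsProbabilityMeasure Q] {r : X → Y → ℝ} {B : ℝ}

namespace IsChannelDensity

theorem sum_integral_prod (n : ℕ) (f : Fin n → X → Y → ℝ) :
    ∑ x : Fin n → X, codebookWeight p x * ∫ y, ∏ i, f i (x i) (y i) ∂(Measure.pi fun _ => Q)
      = ∏ i, ∑ x, p x * ∫ y, f i x y ∂Q := by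
  rw [← sum_prod_codebook fun i x => p x * ∫ y, f i x y ∂Q]
  refine Finset.sum_congr rfl fun x _ => ?_
  rw [integral_fintype_prod_eq_prod (fun i y => f i (x i) y), Finset.prod_mul_distrib]
  rfl

/-- Memoryless uses. -/
theorem pi (h : IsChannelDensity p Q r B) (n : ℕ) :
    IsChannelDensity (codebookWeight p) (Measure.pi fun _ : Fin n => Q)
      (fun x y => ∏ i, r (x i) (y i)) (B ^ n) where
  weight_nonneg := codebookWeight_nonneg h.weight_nonneg
  weight_sum := sum_codebookWeight h.weight_sum
  nonneg x y := Finset.prod_nonneg fun i _ => h.nonneg _ _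
  le x y := (Finset.prod_le_prod (fun i _ => h.nonneg _ _) fun i _ => h.le _ _).trans (by simp)
  integral x := by
    rw [integral_fintype_prod_eq_prod (fun i y => r (x i) y)]
    simp [h.integral]
  mix y := by
    simp only [codebookWeight]
    simp_rw [← Finset.prod_mul_distrib]
    rw [sum_prod_codebook fun i x => p x * r x (y i)]
    simp [h.mix]

/-- The mutual information. -/
noncomputable def info (p : X → ℝ) (Q : Measure Y) (r : X → Y → ℝ) : ℝ :=
  ∑ x, p x * ∫ y, r x y * Real.log (r x y) ∂Q

/-- The variance of the information density. -/
noncomputable def infoVar (p : X → ℝ) (Q : Measure Y) (r : X → Y → ℝ) : ℝ :=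
  ∑ x, p x * ∫ y, r x y * (Real.log (r x y) - info p Q r) ^ 2 ∂Q

theorem infoVar_nonneg (h : IsChannelDensity p Q r B) : 0 ≤ infoVar p Q r :=
  Finset.sum_nonneg fun x _ => mul_nonneg (h.weight_nonneg x)
    (integral_nonneg fun y => mul_nonneg (h.nonneg _ _) (sq_nonneg _))

theorem exists_bound (h : IsChannelDensity p Q r B) (I : ℝ) : ∃ C : ℝ, ∀ x y,
    |r x y| ≤ C ∧ |r x y * (Real.log (r x y) - I)| ≤ C ∧
      |r x y * (Real.log (r x y) - I) ^ 2| ≤ C := by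
  have hc1 : Continuous fun t : ℝ => t * Real.log t - I * t := by
    have := Real.continuous_mul_log
    fun_prop
  -- The square is expanded with t log² t written as 4 (√t log √t)², so that continuity at 0 follows
  -- from that of t log t.
  have hc2 : Continuous fun t : ℝ => 4 * (√t * Real.log √t) ^ 2 - 2 * I * (t * Real.log t)
      + I ^ 2 * t := by
    have h1 := Real.continuous_mul_log
    have h2 : Continuous fun t : ℝ => √t * Real.log √t := h1.comp Real.continuous_sqrt
    fun_prop
  obtain ⟨C₁, hC₁⟩ := (isCompact_Icc (a := (0:ℝ)) (b := B)).exists_bound_of_continuousOn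
    hc1.continuousOn
  obtain ⟨C₂, hC₂⟩ := (isCompact_Icc (a := (0:ℝ)) (b := B)).exists_bound_of_continuousOn
    hc2.continuousOn
  refine ⟨max B (max C₁ C₂), fun x y => ⟨?_, ?_, ?_⟩⟩
  · rw [abs_of_nonneg (h.nonneg x y)]
    exact (h.le x y).trans (le_max_left _ _)
  · have := hC₁ (r x y) ⟨h.nonneg x y, h.le x y⟩
    rw [Real.norm_eq_abs] at this
    rw [mul_sub, mul_comm (r x y) I]
    exact this.trans ((le_max_left _ _).trans (le_max_right _ _))
  · have := hC₂ (r x y) ⟨h.nonneg x y, h.le x y⟩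
    rw [Real.norm_eq_abs, mul_pow, Real.sq_sqrt (h.nonneg x y), Real.log_sqrt (h.nonneg x y)] at this
    have heq : r x y * (Real.log (r x y) - I) ^ 2 = 4 * (r x y * (Real.log (r x y) / 2) ^ 2)
        - 2 * I * (r x y * Real.log (r x y)) + I ^ 2 * r x y := by ring
    rw [heq]
    exact this.trans ((le_max_right _ _).trans (le_max_right _ _))

theorem integrable_prod_mul_sub (h : IsChannelDensity p Q r B) (I : ℝ) {n : ℕ} (x : Fin n → X)
    (i j : Fin n) : Integrable (fun y => ∏ k, (r (x k) (y k)
      * ((if k = i then Real.log (r (x k) (y k)) - I else 1)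
        * (if k = j then Real.log (r (x k) (y k)) - I else 1)))) (Measure.pi fun _ => Q) := by
  obtain ⟨C, hC⟩ := h.exists_bound I
  refine Integrable.of_bound Measurable.of_discrete.aestronglyMeasurable (C ^ n)
    (ae_of_all _ fun y => ?_)
  rw [Real.norm_eq_abs, Finset.abs_prod]
  refine (Finset.prod_le_prod (fun k _ => abs_nonneg _) fun k _ => ?_).trans
    (by simp : ∏ _k : Fin n, C ≤ C ^ n)
  obtain ⟨h1, h2, h3⟩ := hC (x k) (y k)
  split_ifs
  · rwa [← sq]
  · rwa [mul_one]
  · rwa [one_mul]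
  · rwa [mul_one, mul_one]

/-- The squared sum of centred information densities becomes a double sum of products over
coordinates, each of which factorizes under the product measure. -/
theorem prod_mul_sq_eq (hr : ∀ x y, 0 < r x y) (I : ℝ) {n : ℕ} (x : Fin n → X) (y : Fin n → Y) :
    (∏ k, r (x k) (y k)) * (Real.log (∏ k, r (x k) (y k)) - n * I) ^ 2
      = ∑ i, ∑ j, ∏ k, (r (x k) (y k)
      * ((if k = i then Real.log (r (x k) (y k)) - I else 1)
        * (if k = j then Real.log (r (x k) (y k)) - I else 1))) := by
  have h1 : Real.log (∏ k, r (x k) (y k)) - n * I = ∑ k, (Real.log (r (x k) (y k)) - I) := by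
    rw [Real.log_prod fun k _ => (hr _ _).ne', Finset.sum_sub_distrib]
    simp
  rw [h1, sq, Finset.sum_mul_sum, Finset.mul_sum]
  refine Finset.sum_congr rfl fun i _ => ?_
  rw [Finset.mul_sum]
  refine Finset.sum_congr rfl fun j _ => ?_
  rw [Finset.prod_mul_distrib, Finset.prod_mul_distrib, Finset.prod_ite_eq', Finset.prod_ite_eq']
  simp

theorem integrable_prod_mul_sq (h : IsChannelDensity p Q r B) (hr : ∀ x y, 0 < r x y) (I : ℝ)
    {n : ℕ} (x : Fin n → X) : Integrable (fun y => (∏ k, r (x k) (y k))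
      * (Real.log (∏ k, r (x k) (y k)) - n * I) ^ 2) (Measure.pi fun _ => Q) := by
  simp_rw [prod_mul_sq_eq hr I]
  exact integrable_finsetSum _ fun i _ => integrable_finsetSum _ fun j _ =>
    h.integrable_prod_mul_sub I x i j

theorem sum_integral_sub (h : IsChannelDensity p Q r B) :
    ∑ x, p x * ∫ y, r x y * (Real.log (r x y) - info p Q r) ∂Q = 0 := by
  obtain ⟨C, hC⟩ := h.exists_bound 0
  have hi (x : X) : Integrable (fun y => r x y * Real.log (r x y)) Q :=
    Integrable.of_bound Measurable.of_discrete.aestronglyMeasurable C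
      (ae_of_all _ fun y => by simpa using (hC x y).2.1)
  have h1 (x : X) : ∫ y, r x y * (Real.log (r x y) - info p Q r) ∂Q
      = ∫ y, r x y * Real.log (r x y) ∂Q - info p Q r := by
    simp_rw [mul_sub]
    rw [integral_sub (hi x) ((h.integrable x).mul_const _), integral_mul_const, h.integral, one_mul]
  simp_rw [h1, mul_sub]
  rw [Finset.sum_sub_distrib, ← Finset.sum_mul, h.weight_sum, one_mul]
  exact sub_self _

/-- The information densities of `n` memoryless uses have variance `n` times that of one use. -/
theorem sum_integral_sq_eq (h : IsChannelDensity p Q r B) (hr : ∀ x y, 0 < r x y) (n : ℕ) :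
    ∑ x : Fin n → X, codebookWeight p x * ∫ y, (∏ k, r (x k) (y k))
      * (Real.log (∏ k, r (x k) (y k)) - n * info p Q r) ^ 2 ∂(Measure.pi fun _ => Q)
      = n * infoVar p Q r := by
  simp_rw [prod_mul_sq_eq hr]
  have h1 (x : Fin n → X) : ∫ y, ∑ i, ∑ j, ∏ k, (r (x k) (y k)
      * ((if k = i then Real.log (r (x k) (y k)) - info p Q r else 1)
        * (if k = j then Real.log (r (x k) (y k)) - info p Q r else 1))) ∂(Measure.pi fun _ => Q)
      = ∑ i, ∑ j, ∫ y, ∏ k, (r (x k) (y k)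
      * ((if k = i then Real.log (r (x k) (y k)) - info p Q r else 1)
        * (if k = j then Real.log (r (x k) (y k)) - info p Q r else 1)))
          ∂(Measure.pi fun _ => Q) := by
    rw [integral_finsetSum _ fun i _ => integrable_finsetSum _ fun j _ =>
      h.integrable_prod_mul_sub _ x i j]
    exact Finset.sum_congr rfl fun i _ => integral_finsetSum _ fun j _ =>
      h.integrable_prod_mul_sub _ x i j
  simp_rw [h1, Finset.mul_sum]
  rw [Finset.sum_comm]
  have h2 (i : Fin n) : ∑ x : Fin n → X, ∑ j, codebookWeight p x * ∫ y, ∏ k, (r (x k) (y k)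
      * ((if k = i then Real.log (r (x k) (y k)) - info p Q r else 1)
        * (if k = j then Real.log (r (x k) (y k)) - info p Q r else 1)))
          ∂(Measure.pi fun _ => Q) = infoVar p Q r := by
    rw [Finset.sum_comm]
    have h3 (j : Fin n) := sum_integral_prod (p := p) (Q := Q) n fun k x y => r x y
      * ((if k = i then Real.log (r x y) - info p Q r else 1)
        * (if k = j then Real.log (r x y) - info p Q r else 1))
    simp_rw [h3]
    -- For j ≠ i the factor at i is the centred information density, which averages to zero; only
    -- the diagonal survives.
    rw [Finset.sum_eq_single i]
    · rw [Finset.prod_eq_single i]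
      · simp only [if_true, ← sq]
        rfl
      · intro k _ hk
        simp [hk, h.integral, h.weight_sum]
      · simp
    · intro j _ hj
      refine Finset.prod_eq_zero (Finset.mem_univ i) ?_
      simp only [if_true, if_neg hj.symm, mul_one]
      exact h.sum_integral_sub
    · simp
  simp_rw [h2]
  simp

/-- The probability that the information density is small. -/
theorem sum_integral_threshold_le (h : IsChannelDensity p Q r B) (hr : ∀ x y, 0 < r x y) {n : ℕ}
    (hn : 0 < n) {γ : ℝ} (hγ : 0 < γ) :
    ∑ x : Fin n → X, codebookWeight p x * ∫ y, (∏ k, r (x k) (y k))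
      * (if ∏ k, r (x k) (y k) ≤ Real.exp (n * (info p Q r - γ)) then 1 else 0)
        ∂(Measure.pi fun _ => Q)
      ≤ infoVar p Q r / (n * γ ^ 2) := by
  have hn' : (0 : ℝ) < n := by exact_mod_cast hn
  have heq : infoVar p Q r / (n * γ ^ 2) = (n * infoVar p Q r) * ((n * γ) ^ 2)⁻¹ := by
    field_simp
  rw [heq, ← h.sum_integral_sq_eq hr n, Finset.sum_mul]
  refine Finset.sum_le_sum fun x _ => ?_
  rw [mul_assoc, ← integral_mul_const]
  refine mul_le_mul_of_nonneg_left ?_ (codebookWeight_nonneg h.weight_nonneg x)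
  refine integral_mono ((h.pi n).integrable_mul x (C := 1) fun y => by split_ifs <;> simp)
    ((h.integrable_prod_mul_sq hr _ x).mul_const _) fun y => ?_
  simp only
  have hpos : 0 < ∏ k, r (x k) (y k) := Finset.prod_pos fun k _ => hr _ _
  rw [mul_assoc]
  refine mul_le_mul_of_nonneg_left ?_ hpos.le
  -- Chebyshev: below the threshold the log-density deviates from n I by at least n γ.
  split_ifs with hle
  · rw [← div_eq_mul_inv, one_le_div (by positivity), sq_le_sq, abs_of_pos (by positivity),
      abs_sub_comm]
    have := (Real.log_le_iff_le_exp hpos).2 hle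
    refine le_trans ?_ (le_abs_self _)
    linarith
  · positivity

/-- Let t be the deviation of the log-density from n I. As K ≥ exp (n I), the logarithm is at most
log 2 + |t|, and |t| ≤ √n/2 + t²/(2√n), where t² has mean n times the variance. A bound of order √n
suffices because the leakage is divided by n, so K needs no rate margin. -/
theorem sum_integral_log_le (h : IsChannelDensity p Q r B) (hr : ∀ x y, 0 < r x y) {n K : ℕ}
    (hn : 0 < n) (hK : Real.exp (n * info p Q r) ≤ K) :
    ∑ x : Fin n → X, codebookWeight p x * ∫ y, (∏ k, r (x k) (y k))
      * Real.log (1 + (∏ k, r (x k) (y k)) / K) ∂(Measure.pi fun _ => Q)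
      ≤ Real.log 2 + √n * ((1 + infoVar p Q r) / 2) := by
  have hn' : (0 : ℝ) < n := by exact_mod_cast hn
  have hK0 : (0 : ℝ) < K := (Real.exp_pos _).trans_le hK
  have hs : 0 < √(n : ℝ) := Real.sqrt_pos.2 hn'
  have heq : Real.log 2 + √n * ((1 + infoVar p Q r) / 2)
      = ∑ x : Fin n → X, codebookWeight p x * ((Real.log 2 + √n / 2) + (∫ y, (∏ k, r (x k) (y k))
      * (Real.log (∏ k, r (x k) (y k)) - n * info p Q r) ^ 2 ∂(Measure.pi fun _ => Q))
        * (2 * √(n : ℝ))⁻¹) := by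
    simp_rw [mul_add, ← mul_assoc, Finset.sum_add_distrib]
    rw [← Finset.sum_mul, ← Finset.sum_mul, ← Finset.sum_mul, h.sum_integral_sq_eq hr n,
      sum_codebookWeight h.weight_sum]
    have hsq : (n : ℝ) = √n * √n := (Real.mul_self_sqrt hn'.le).symm
    have : (n : ℝ) * infoVar p Q r * (2 * √(n : ℝ))⁻¹ = √n * infoVar p Q r / 2 := by
      nth_rewrite 1 [hsq]
      field_simp
    rw [this]
    ring
  rw [heq]
  refine Finset.sum_le_sum fun x _ => mul_le_mul_of_nonneg_left ?_
    (codebookWeight_nonneg h.weight_nonneg x)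
  have hone : ∫ y, (∏ k, r (x k) (y k)) * (Real.log 2 + √n / 2) ∂(Measure.pi fun _ => Q)
      = Real.log 2 + √n / 2 := by
    rw [integral_mul_const, (h.pi n).integral x, one_mul]
  rw [← hone, ← integral_mul_const, ← integral_add (((h.pi n).integrable x).mul_const _)
    ((h.integrable_prod_mul_sq hr _ x).mul_const _)]
  have hpos (y : Fin n → Y) : 0 < ∏ k, r (x k) (y k) := Finset.prod_pos fun k _ => hr _ _
  refine integral_mono ((h.pi n).integrable_mul x (C := B ^ n / K) fun y => ?_)
    ((((h.pi n).integrable x).mul_const _).add ((h.integrable_prod_mul_sq hr _ x).mul_const _))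
    fun y => ?_
  · have h1 : 0 ≤ (∏ k, r (x k) (y k)) / K := div_nonneg (hpos y).le hK0.le
    rw [abs_of_nonneg (Real.log_nonneg (by linarith))]
    have h2 := Real.log_le_sub_one_of_pos (by linarith : 0 < 1 + (∏ k, r (x k) (y k)) / K)
    have h3 : (∏ k, r (x k) (y k)) / K ≤ B ^ n / K :=
      div_le_div_of_nonneg_right ((h.pi n).le x y) hK0.le
    linarith
  · simp only
    rw [mul_assoc (∏ k, r (x k) (y k)), ← mul_add]
    refine mul_le_mul_of_nonneg_left ?_ (hpos y).le
    set t := Real.log (∏ k, r (x k) (y k)) - n * info p Q r with ht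
    have hdiv : (∏ k, r (x k) (y k)) / K ≤ Real.exp |t| := by
      rw [div_le_iff₀ hK0]
      calc _ = Real.exp t * Real.exp (n * info p Q r) := by
            rw [← Real.exp_add, ht, sub_add_cancel, Real.exp_log (hpos y)]
        _ ≤ Real.exp |t| * K := by
            gcongr
            exact le_abs_self t
    have h1 : Real.log (1 + (∏ k, r (x k) (y k)) / K) ≤ Real.log 2 + |t| := by
      rw [← Real.log_exp |t|, ← Real.log_mul two_ne_zero (Real.exp_pos _).ne']
      refine Real.log_le_log (by have := div_nonneg (hpos y).le hK0.le; linarith) ?_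
      have := Real.one_le_exp (abs_nonneg t)
      linarith
    have h2 : |t| ≤ √n / 2 + t ^ 2 * (2 * √(n : ℝ))⁻¹ := by
      have h3 : √n / 2 + t ^ 2 * (2 * √(n : ℝ))⁻¹ - |t| = (|t| - √n) ^ 2 * (2 * √(n : ℝ))⁻¹ := by
        rw [← sq_abs t]
        field_simp
        ring
      have : 0 ≤ (|t| - √n) ^ 2 * (2 * √(n : ℝ))⁻¹ := by positivity
      linarith
    linarith

end IsChannelDensity

end Product

/-! ### Wiretap codes built from codebooks -/

section Code

theorem lintegral_uniformOn_univ {M : ℕ} (f : Fin M → ℝ≥0∞) :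
    ∫⁻ m, f m ∂uniformOn (Set.univ : Set (Fin M)) = (M : ℝ≥0∞)⁻¹ * ∑ m, f m := by
  rw [lintegral_fintype, Finset.mul_sum]
  refine Finset.sum_congr rfl fun m _ => ?_
  rw [uniformOn_univ]
  simp [mul_comm]

/-- The encoder that sends a uniformly chosen one of the `K` words that belong to the message. -/
noncomputable def blockEncoder {n M K : ℕ} (x : Fin M × Fin K → Fin n → ℝ) :
    Kernel (Fin M) (Fin n → ℝ) :=
  Kernel.ofFunOfCountable fun m => (K : ℝ≥0∞)⁻¹ • ∑ k, Measure.dirac (x (m, k))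

theorem blockEncoder_apply {n M K : ℕ} (x : Fin M × Fin K → Fin n → ℝ) (m : Fin M) :
    blockEncoder x m = (K : ℝ≥0∞)⁻¹ • ∑ k, Measure.dirac (x (m, k)) := rfl

instance {n M K : ℕ} [NeZero K] (x : Fin M × Fin K → Fin n → ℝ) :
    IsMarkovKernel (blockEncoder x) := by
  refine ⟨fun m => ⟨?_⟩⟩
  rw [blockEncoder_apply]
  simp only [Measure.smul_apply, Measure.finsetSum_apply, measure_univ, Finset.sum_const,
    Finset.card_univ, Fintype.card_fin, nsmul_eq_mul, mul_one, smul_eq_mul]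
  exact ENNReal.inv_mul_cancel (by simp [NeZero.ne K]) (ENNReal.natCast_ne_top K)

theorem comp_blockEncoder_apply {n M K : ℕ} {β : Type*} [MeasurableSpace β]
    (x : Fin M × Fin K → Fin n → ℝ) (κ : Kernel (Fin n → ℝ) β) (m : Fin M) :
    (κ ∘ₖ blockEncoder x) m = (K : ℝ≥0∞)⁻¹ • ∑ k, κ (x (m, k)) := by
  ext s hs
  rw [Kernel.comp_apply' _ _ _ hs, blockEncoder_apply, lintegral_smul_measure,
    lintegral_finsetSum_measure]
  simp_rw [lintegral_dirac' _ (κ.measurable_coe hs)]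
  simp

theorem ae_blockEncoder {n M K : ℕ} {x : Fin M × Fin K → Fin n → ℝ} {P : (Fin n → ℝ) → Prop}
    (hP : MeasurableSet {z | P z}) {m : Fin M} (h : ∀ k, P (x (m, k))) :
    ∀ᵐ z ∂blockEncoder x m, P z := by
  rw [blockEncoder_apply]
  refine Measure.ae_smul_measure ?_ _
  rw [ae_iff]
  simp only [Measure.finsetSum_apply]
  refine Finset.sum_eq_zero fun k _ => ?_
  refine (Measure.dirac_apply' (x (m, k)) hP.compl).trans ?_
  rw [Set.indicator_of_notMem]
  exact fun hmem => hmem (h k)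

theorem integral_comp_blockEncoder {n M K : ℕ} [NeZero M] [NeZero K] {A : ℝ}
    {x : Fin M × Fin K → Fin n → ℝ} (hx : ∀ i j, x i j ∈ Set.Icc 0 A) (j : Fin n) :
    ∫ z, z j ∂(blockEncoder x ∘ₘ uniformOn (Set.univ : Set (Fin M)))
      = (M * K : ℝ)⁻¹ * ∑ i, x i j := by
  have hmeas : Measurable fun z : Fin n → ℝ => z j := measurable_pi_apply j
  have hae (m : Fin M) : ∀ᵐ z ∂blockEncoder x m, 0 ≤ z j :=
    ae_blockEncoder (measurableSet_le measurable_const hmeas) fun k => (hx (m, k) j).1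
  have hae' : ∀ᵐ z ∂(blockEncoder x ∘ₘ uniformOn (Set.univ : Set (Fin M))), 0 ≤ z j :=
    Measure.ae_comp_of_ae_ae (measurableSet_le measurable_const hmeas) (ae_of_all _ hae)
  rw [integral_eq_lintegral_of_nonneg_ae hae' hmeas.aestronglyMeasurable,
    Measure.lintegral_bind (Kernel.aemeasurable _) hmeas.ennreal_ofReal.aemeasurable,
    lintegral_uniformOn_univ]
  have h1 (m : Fin M) : ∫⁻ z, ENNReal.ofReal (z j) ∂blockEncoder x m
      = (K : ℝ≥0∞)⁻¹ * ∑ k, ENNReal.ofReal (x (m, k) j) := by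
    rw [blockEncoder_apply, lintegral_smul_measure, lintegral_finsetSum_measure]
    simp_rw [lintegral_dirac' _ hmeas.ennreal_ofReal]
    rfl
  simp_rw [h1]
  rw [← Finset.mul_sum, ← mul_assoc, ENNReal.toReal_mul, ENNReal.toReal_mul, Fintype.sum_prod_type]
  have h2 : (∑ m : Fin M, ∑ k : Fin K, ENNReal.ofReal (x (m, k) j)).toReal
      = ∑ m : Fin M, ∑ k : Fin K, x (m, k) j := by
    rw [ENNReal.toReal_sum fun m _ => ENNReal.sum_ne_top.2 fun k _ => ENNReal.ofReal_ne_top]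
    refine Finset.sum_congr rfl fun m _ => ?_
    rw [ENNReal.toReal_sum fun k _ => ENNReal.ofReal_ne_top]
    exact Finset.sum_congr rfl fun k _ => ENNReal.toReal_ofReal (hx _ _).1
  rw [h2]
  simp only [ENNReal.toReal_inv, ENNReal.toReal_natCast]
  rw [mul_inv]

/-- The code given by a codebook of `M * K` words. -/
noncomputable def codebookCode {A E : ℝ} {n M K : ℕ} [NeZero M] [NeZero K]
    (x : Fin M × Fin K → Fin n → ℝ) (hx : ∀ i j, x i j ∈ Set.Icc 0 A)
    (havg : (M * K : ℝ)⁻¹ * ∑ i, (∑ j, x i j) / n ≤ E) (dec : (Fin n → ℕ) → Fin M) :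
    WiretapCode A E n M where
  enc := blockEncoder x
  markov := inferInstance
  dec := dec
  peak m := by
    refine ae_blockEncoder ?_ fun k => hx (m, k)
    rw [Set.ofPred_forall]
    exact MeasurableSet.iInter fun i => measurable_pi_apply i measurableSet_Icc
  average := by
    simp_rw [integral_comp_blockEncoder hx]
    refine le_trans (le_of_eq ?_) havg
    rw [← Finset.mul_sum, Finset.sum_comm, ← Finset.sum_div, mul_div_assoc]

/-- Recovering the pair of message and randomization index is harder than recovering the message. -/
theorem errorProb_codebookCode_le {A E : ℝ} {n M K : ℕ} [NeZero M] [NeZero K]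
    {x : Fin M × Fin K → Fin n → ℝ} {hx : ∀ i j, x i j ∈ Set.Icc 0 A}
    {havg : (M * K : ℝ)⁻¹ * ∑ i, (∑ j, x i j) / n ≤ E} (D : (Fin n → ℕ) → Fin M × Fin K)
    (κ : Kernel ℝ ℕ) [IsMarkovKernel κ] :
    (codebookCode x hx havg fun y => (D y).1).errorProb κ
      ≤ (M : ℝ≥0∞)⁻¹ * (K : ℝ≥0∞)⁻¹ * ∑ i, memoryless κ n (x i) {y | D y ≠ i} := by
  have hUp : IsProbabilityMeasure (uniformOn (Set.univ : Set (Fin M))) :=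
    isProbabilityMeasure_uniformOn Set.finite_univ Set.univ_nonempty
  have hs : MeasurableSet {p : Fin M × (Fin n → ℕ) | (D p.2).1 ≠ p.1} :=
    (measurableSet_eq_fun ((measurable_of_countable fun y => (D y).1).comp measurable_snd)
      measurable_fst).compl
  show (uniformOn (Set.univ : Set (Fin M)) ⊗ₘ (memoryless κ n ∘ₖ blockEncoder x))
    {p | (D p.2).1 ≠ p.1} ≤ _
  rw [Measure.compProd_apply hs, lintegral_uniformOn_univ, Fintype.sum_prod_type, mul_assoc]
  gcongr
  rw [Finset.mul_sum]
  refine Finset.sum_le_sum fun m _ => ?_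
  rw [comp_blockEncoder_apply]
  simp only [Measure.smul_apply, Measure.finsetSum_apply, smul_eq_mul]
  gcongr with k
  intro y hy hD
  exact hy (by rw [hD])

/-- By the compensation identity the mean divergence from any reference law exceeds the leakage by a
divergence, which is dropped. -/
theorem leakage_codebookCode_le {A E : ℝ} {n M K : ℕ} [NeZero M] [NeZero K]
    {x : Fin M × Fin K → Fin n → ℝ} {hx : ∀ i j, x i j ∈ Set.Icc 0 A}
    {havg : (M * K : ℝ)⁻¹ * ∑ i, (∑ j, x i j) / n ≤ E} {dec : (Fin n → ℕ) → Fin M}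
    (κ : Kernel ℝ ℕ) [IsMarkovKernel κ] (ν : Measure (Fin n → ℕ)) [IsProbabilityMeasure ν]
    (hν : ∀ y, ν {y} ≠ 0) :
    (codebookCode x hx havg dec).leakage κ
      ≤ (M : ℝ≥0∞)⁻¹ * ∑ m, klDiv ((K : ℝ≥0∞)⁻¹ • ∑ k, memoryless κ n (x (m, k))) ν := by
  have hUp : IsProbabilityMeasure (uniformOn (Set.univ : Set (Fin M))) :=
    isProbabilityMeasure_uniformOn Set.finite_univ Set.univ_nonempty
  have h := lintegral_klDiv_eq (uniformOn (Set.univ : Set (Fin M)))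
    (memoryless κ n ∘ₖ blockEncoder x) ν fun m => absolutelyContinuous_of_full_support hν _
  rw [lintegral_uniformOn_univ] at h
  simp_rw [comp_blockEncoder_apply] at h
  rw [h]
  exact le_self_add

end Code

/-! ### Output densities of a finite input alphabet -/

section Density

variable {X : Type*} [Fintype X] {p : X → ℝ} {φ : X → ℝ} {κ : Kernel ℝ ℕ} [IsMarkovKernel κ]
  {Q : Measure ℕ} [IsProbabilityMeasure Q]

/-- The density of the output for the input letter `x` relative to `Q`. -/
noncomputable def outputDensity (κ : Kernel ℝ ℕ) (φ : X → ℝ) (Q : Measure ℕ) (x : X) (y : ℕ) : ℝ :=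
  (κ (φ x)).real {y} / Q.real {y}

theorem real_singleton_pos {Y : Type*} [MeasurableSpace Y] {μ : Measure Y} [IsFiniteMeasure μ]
    {y : Y} (h : μ {y} ≠ 0) : 0 < μ.real {y} :=
  ENNReal.toReal_pos h (measure_ne_top _ _)

theorem withDensity_outputDensity (hQ : ∀ y, Q {y} ≠ 0) (x : X) :
    κ (φ x) = Q.withDensity fun y => ENNReal.ofReal (outputDensity κ φ Q x y) := by
  refine Measure.ext_of_singleton fun y => ?_
  have h := real_singleton_pos (hQ y)
  rw [withDensity_apply _ (measurableSet_singleton y), lintegral_singleton, outputDensity,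
    ENNReal.ofReal_div_of_pos h, ofReal_measureReal, ofReal_measureReal,
    ENNReal.div_mul_cancel (hQ y) (measure_ne_top _ _)]

theorem outputDensity_pos (hκ : ∀ x y, κ (φ x) {y} ≠ 0) (hQ : ∀ y, Q {y} ≠ 0) (x : X) (y : ℕ) :
    0 < outputDensity κ φ Q x y :=
  div_pos (real_singleton_pos (hκ x y)) (real_singleton_pos (hQ y))

/-- Since Q {y} ≥ p x · κ (φ x) {y}, the density for x is at most 1 / p x. This is why all weights
must be positive; the sum of the inverses is a bound common to all letters. -/
theorem isChannelDensity_outputDensity (hp : ∀ x, 0 < p x) (hp1 : ∑ x, p x = 1)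
    (hκ : ∀ x y, κ (φ x) {y} ≠ 0) (hQ : ∀ y, Q {y} ≠ 0)
    (hmix : ∀ y, Q.real {y} = ∑ x, p x * (κ (φ x)).real {y}) :
    IsChannelDensity p Q (outputDensity κ φ Q) (∑ x, (p x)⁻¹) where
  weight_nonneg x := (hp x).le
  weight_sum := hp1
  nonneg x y := (outputDensity_pos hκ hQ x y).le
  le x y := by
    refine le_trans ?_ (Finset.single_le_sum (f := fun x => (p x)⁻¹)
      (fun x _ => (inv_pos.2 (hp x)).le) (Finset.mem_univ x))
    rw [outputDensity, div_le_iff₀ (real_singleton_pos (hQ y)), ← div_eq_inv_mul,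
      le_div_iff₀ (hp x), hmix, mul_comm]
    exact Finset.single_le_sum (f := fun x => p x * (κ (φ x)).real {y})
      (fun x _ => mul_nonneg (hp x).le measureReal_nonneg) (Finset.mem_univ x)
  integral x := by
    rw [integral_eq_lintegral_of_nonneg_ae (ae_of_all _ fun y => (outputDensity_pos hκ hQ x y).le)
      Measurable.of_discrete.aestronglyMeasurable]
    have h := congrArg (fun μ : Measure ℕ => μ Set.univ)
      (withDensity_outputDensity (κ := κ) (φ := φ) hQ x)
    simp only [measure_univ, withDensity_apply _ MeasurableSet.univ, Measure.restrict_univ] at h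
    rw [← h]
    rfl
  mix y := by
    have h := real_singleton_pos (hQ y)
    simp_rw [outputDensity, mul_div_assoc', ← Finset.sum_div, ← hmix]
    exact div_self h.ne'

theorem memoryless_eq_withDensity (hκ : ∀ x y, κ (φ x) {y} ≠ 0) (hQ : ∀ y, Q {y} ≠ 0) {n : ℕ}
    (x : Fin n → X) : memoryless κ n (fun i => φ (x i))
      = (Measure.pi fun _ => Q).withDensity fun y =>
          ENNReal.ofReal (∏ i, outputDensity κ φ Q (x i) (y i)) := by
  refine Measure.ext_of_singleton fun y => ?_
  rw [withDensity_apply _ (measurableSet_singleton y), lintegral_singleton, memoryless_apply,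
    Measure.pi_singleton, Measure.pi_singleton,
    ENNReal.ofReal_prod_of_nonneg fun i _ => (outputDensity_pos hκ hQ _ _).le,
    ← Finset.prod_mul_distrib]
  refine Finset.prod_congr rfl fun i _ => ?_
  rw [withDensity_outputDensity hQ (x i), withDensity_apply _ (measurableSet_singleton _),
    lintegral_singleton]

end Density

/-! ### Random coding for the wiretap channel -/

section BlockCode

variable {X : Type*} [Fintype X] {p : X → ℝ} {φ : X → ℝ} {κ : Kernel ℝ ℕ} [IsMarkovKernel κ]
  {Q : Measure ℕ} [IsProbabilityMeasure Q]

theorem pi_ne_zero (hQ : ∀ y, Q {y} ≠ 0) {n : ℕ} (y : Fin n → ℕ) :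
    (Measure.pi fun _ : Fin n => Q) {y} ≠ 0 := by
  rw [Measure.pi_singleton]
  exact Finset.prod_ne_zero_iff.2 fun i _ => hQ _

theorem withDensity_measure_eq {Y : Type*} [MeasurableSpace Y] [DiscreteMeasurableSpace Y]
    {ν : Measure Y} [IsProbabilityMeasure ν] {u : Y → ℝ} (hu0 : ∀ y, 0 ≤ u y)
    (hui : Integrable u ν) (s : Set Y) [DecidablePred (· ∈ s)] :
    ν.withDensity (fun y => ENNReal.ofReal (u y)) s
      = ENNReal.ofReal (∫ y, u y * (if y ∈ s then 1 else 0) ∂ν) := by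
  have heq : (fun y => u y * (if y ∈ s then 1 else 0)) = s.indicator u := by
    funext y
    by_cases hy : y ∈ s <;> simp [hy]
  rw [heq, integral_indicator .of_discrete, withDensity_apply _ .of_discrete,
    ofReal_integral_eq_lintegral_ofReal hui.integrableOn (ae_of_all _ hu0)]

theorem smul_sum_memoryless_eq_withDensity (hκ : ∀ x y, κ (φ x) {y} ≠ 0) (hQ : ∀ y, Q {y} ≠ 0)
    {n K : ℕ} [NeZero K] (c : Fin K → Fin n → X) :
    (K : ℝ≥0∞)⁻¹ • ∑ k, memoryless κ n (fun i => φ (c k i))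
      = (Measure.pi fun _ => Q).withDensity fun y => ENNReal.ofReal ((K : ℝ)⁻¹ *
          ∑ k, ∏ i, outputDensity κ φ Q (c k i) (y i)) := by
  have hK : (0 : ℝ) < K := by exact_mod_cast Nat.pos_of_ne_zero (NeZero.ne K)
  simp_rw [memoryless_eq_withDensity hκ hQ]
  refine Measure.ext_of_singleton fun y => ?_
  simp only [Measure.smul_apply, Measure.finsetSum_apply,
    withDensity_apply _ (measurableSet_singleton y), lintegral_singleton, smul_eq_mul]
  rw [← Finset.sum_mul, ← ENNReal.ofReal_sum_of_nonneg fun k _ =>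
    Finset.prod_nonneg fun i _ => (outputDensity_pos hκ hQ _ _).le,
    ENNReal.ofReal_mul (inv_nonneg.2 hK.le), ENNReal.ofReal_inv_of_pos hK, ENNReal.ofReal_natCast,
    mul_assoc]

theorem sum_codebookWeight_cost (hp1 : ∑ x, p x = 1) {n : ℕ} (hn : 0 < n) :
    ∑ x : Fin n → X, codebookWeight p x * ((∑ j, φ (x j)) / n) = ∑ x, p x * φ x := by
  have hn' : (n : ℝ) ≠ 0 := by exact_mod_cast hn.ne'
  simp_rw [mul_div_assoc', Finset.mul_sum]
  rw [← Finset.sum_div, Finset.sum_comm]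
  simp_rw [sum_codebookWeight_single hp1 _ φ]
  simp [hn']

open IsChannelDensity in
/-- Codes for the wiretap channel by random coding. -/
theorem exists_wiretapCode {κB κE : Kernel ℝ ℕ} [IsMarkovKernel κB] [IsMarkovKernel κE]
    {QB QE : Measure ℕ} [IsProbabilityMeasure QB] [IsProbabilityMeasure QE] {A E : ℝ} (hE : 0 < E)
    (hφ : ∀ x, φ x ∈ Set.Icc 0 A) (hp : ∀ x, 0 < p x) (hp1 : ∑ x, p x = 1)
    (hκB : ∀ x y, κB (φ x) {y} ≠ 0) (hκE : ∀ x y, κE (φ x) {y} ≠ 0)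
    (hQB : ∀ y, QB {y} ≠ 0) (hQE : ∀ y, QE {y} ≠ 0)
    (hmixB : ∀ y, QB.real {y} = ∑ x, p x * (κB (φ x)).real {y})
    (hmixE : ∀ y, QE.real {y} = ∑ x, p x * (κE (φ x)).real {y})
    {n M K : ℕ} [NeZero M] [NeZero K] (hn : 0 < n) {γ b g : ℝ} (hγ : 0 < γ) (hb : 0 < b)
    (hg : 0 < g) (hK : Real.exp (n * info p QE (outputDensity κE φ QE)) ≤ K)
    (hsum : (∑ x, p x * φ x) / E
      + (infoVar p QB (outputDensity κB φ QB) / (n * γ ^ 2)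
        + (M * K : ℝ) * (Real.exp (n * (info p QB (outputDensity κB φ QB) - γ)))⁻¹) / b
      + (Real.log 2 + √n * ((1 + infoVar p QE (outputDensity κE φ QE)) / 2)) / g ≤ 1) :
    ∃ c : WiretapCode A E n M, c.errorProb κB ≤ ENNReal.ofReal b ∧
      c.leakage κE ≤ ENNReal.ofReal g := by
  have hM0 : (0 : ℝ) < M := by exact_mod_cast Nat.pos_of_ne_zero (NeZero.ne M)
  have hK0 : (0 : ℝ) < K := by exact_mod_cast Nat.pos_of_ne_zero (NeZero.ne K)
  have hdB := isChannelDensity_outputDensity hp hp1 hκB hQB hmixB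
  have hdE := isChannelDensity_outputDensity hp hp1 hκE hQE hmixE
  have hrB := outputDensity_pos hκB hQB
  have hrE := outputDensity_pos hκE hQE
  -- The decoding threshold is exp (n (I - γ)), with I the information of the main channel; the cost
  -- of a word is its average intensity, with budget E.
  obtain ⟨c, D, hc1, hc2, hc3⟩ := (hdB.pi n).exists_codebook (hdE.pi n) (M := M) (K := K)
    (cost := fun x => (∑ j, φ (x j)) / n)
    (fun x => div_nonneg (Finset.sum_nonneg fun j _ => (hφ _).1) (Nat.cast_nonneg n))
    (Real.exp_pos _) hE hb hg (by
      refine le_trans ?_ hsum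
      rw [sum_codebookWeight_cost hp1 hn]
      gcongr
      · exact hdB.sum_integral_threshold_le hrB hn hγ
      · exact hdE.sum_integral_log_le hrE hn hK)
  refine ⟨codebookCode (fun i j => φ (c i j)) (fun i j => hφ _) hc1 fun y => (D y).1, ?_, ?_⟩
  · refine (errorProb_codebookCode_le D κB).trans ?_
    have h1 (i : Fin M × Fin K) : memoryless κB n (fun j => φ (c i j)) {y | D y ≠ i}
        = ENNReal.ofReal (∫ y, (∏ j, outputDensity κB φ QB (c i j) (y j))
          * (if D y = i then 0 else 1) ∂(Measure.pi fun _ => QB)) := by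
      classical
      rw [memoryless_eq_withDensity hκB hQB, withDensity_measure_eq
        (fun y => (hdB.pi n).nonneg (c i) y) ((hdB.pi n).integrable (c i))]
      simp only [Set.mem_ofPred_eq, ne_eq, ite_not]
    simp_rw [h1]
    rw [← ENNReal.ofReal_sum_of_nonneg, ← ENNReal.ofReal_natCast, ← ENNReal.ofReal_natCast,
      ← ENNReal.ofReal_inv_of_pos hM0, ← ENNReal.ofReal_inv_of_pos hK0,
      ← ENNReal.ofReal_mul (by positivity), ← ENNReal.ofReal_mul (by positivity), ← mul_inv]
    · exact ENNReal.ofReal_le_ofReal hc2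
    · intro i _
      exact integral_nonneg fun y => mul_nonneg ((hdB.pi n).nonneg (c i) y) (by split_ifs <;> simp)
  · refine (leakage_codebookCode_le κE (Measure.pi fun _ => QE) (pi_ne_zero hQE)).trans ?_
    have h1 (m : Fin M) : klDiv ((K : ℝ≥0∞)⁻¹ • ∑ k, memoryless κE n fun j => φ (c (m, k) j))
        (Measure.pi fun _ => QE) = ENNReal.ofReal (∫ y, ((K : ℝ)⁻¹ *
          ∑ k, ∏ j, outputDensity κE φ QE (c (m, k) j) (y j)) * Real.log ((K : ℝ)⁻¹ *
          ∑ k, ∏ j, outputDensity κE φ QE (c (m, k) j) (y j)) ∂(Measure.pi fun _ => QE)) := by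
      rw [smul_sum_memoryless_eq_withDensity hκE hQE fun k => c (m, k)]
      refine klDiv_withDensity Measurable.of_discrete (fun y => mul_nonneg (by positivity)
        (Finset.sum_nonneg fun k _ => (hdE.pi n).nonneg (c (m, k)) y))
        (B := (∑ x, (p x)⁻¹) ^ n) (fun y => ?_) ?_
      · rw [inv_mul_le_iff₀ hK0]
        refine (Finset.sum_le_card_nsmul _ _ _ fun k _ => (hdE.pi n).le (c (m, k)) y).trans
          (by simp)
      · rw [integral_const_mul, integral_finsetSum _ fun k _ => (hdE.pi n).integrable (c (m, k))]
        simp_rw [(hdE.pi n).integral]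
        simp [hK0.ne']
    simp_rw [h1]
    rw [← ENNReal.ofReal_sum_of_nonneg, ← ENNReal.ofReal_natCast,
      ← ENNReal.ofReal_inv_of_pos hM0, ← ENNReal.ofReal_mul (by positivity)]
    · exact ENNReal.ofReal_le_ofReal hc3
    · intro m _
      exact (hdE.pi n).integral_mul_log_nonneg fun k => c (m, k)

end BlockCode

/-! ### Secure rates from a fixed input distribution -/

section Achievability

variable {X : Type*} [Fintype X] {p : X → ℝ} {φ : X → ℝ} {κB κE : Kernel ℝ ℕ} [IsMarkovKernel κB]
  [IsMarkovKernel κE] {QB QE : Measure ℕ} [IsProbabilityMeasure QB] [IsProbabilityMeasure QE]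
  {Δ A E R : ℝ}

theorem ceil_exp_le {t : ℝ} (ht : 0 ≤ t) : (⌈Real.exp t⌉₊ : ℝ) ≤ 2 * Real.exp t := by
  have h1 := Nat.ceil_lt_add_one (Real.exp_pos t).le
  have h2 := Real.one_le_exp ht
  linarith

theorem neZero_ceil_exp (t : ℝ) : NeZero ⌈Real.exp t⌉₊ :=
  ⟨(Nat.ceil_pos.2 (Real.exp_pos t)).ne'⟩

theorem exists_wiretapCode_zero (M : ℕ) [NeZero M] (hE : 0 ≤ E) :
    Nonempty (WiretapCode A E 0 M) :=
  ⟨codebookCode (K := 1) (fun _ j => j.elim0) (fun _ j => j.elim0) (by simpa using hE) fun _ => 0⟩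

open IsChannelDensity in
/-- Every rate below the information difference of a finitely supported input is secure. -/
theorem mem_secureRates_of_lt
    (hφ : ∀ x, φ x ∈ Set.Icc 0 A) (hp : ∀ x, 0 < p x) (hp1 : ∑ x, p x = 1)
    (hκB : ∀ x y, κB (φ x) {y} ≠ 0) (hκE : ∀ x y, κE (φ x) {y} ≠ 0)
    (hQB : ∀ y, QB {y} ≠ 0) (hQE : ∀ y, QE {y} ≠ 0)
    (hmixB : ∀ y, QB.real {y} = ∑ x, p x * (κB (φ x)).real {y})
    (hmixE : ∀ y, QE.real {y} = ∑ x, p x * (κE (φ x)).real {y})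
    (hΔ : 0 ≤ Δ) (hE : 0 < E) (hcost : ∑ x, p x * φ x < E) (hR0 : 0 ≤ R)
    (hIE : 0 ≤ info p QE (outputDensity κE φ QE))
    (hR : Δ * R < info p QB (outputDensity κB φ QB) - info p QE (outputDensity κE φ QE)) :
    R ∈ secureRates κB κE Δ A E := by
  have hVB := (isChannelDensity_outputDensity hp hp1 hκB hQB hmixB).infoVar_nonneg
  have hVE := (isChannelDensity_outputDensity hp hp1 hκE hQE hmixE).infoVar_nonneg
  set IB := info p QB (outputDensity κB φ QB) with hIBdef
  set IE := info p QE (outputDensity κE φ QE) with hIEdef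
  set VB := infoVar p QB (outputDensity κB φ QB)
  set VE := infoVar p QE (outputDensity κE φ QE)
  -- Half of the slack in the rate: one γ lowers the decoding threshold, the other makes M K over
  -- the threshold decay like exp (-n γ).
  obtain ⟨γ, hγ0, hγ⟩ : ∃ γ, 0 < γ ∧ Δ * R + IE + 2 * γ = IB :=
    ⟨(IB - IE - Δ * R) / 2, by linarith, by ring⟩
  -- The strict cost inequality leaves a fixed share of the budget 1, divided equally between error
  -- and leakage.
  obtain ⟨θ, hθ0, hθ⟩ : ∃ θ, 0 < θ ∧ (∑ x, p x * φ x) / E + θ + θ = 1 := by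
    refine ⟨(1 - (∑ x, p x * φ x) / E) / 2, ?_, by ring⟩
    have := (div_lt_one hE).2 hcost
    linarith
  -- The factor 4 pays for rounding up both M and K, each at most doubled.
  set e : ℕ → ℝ := fun n => VB / (n * γ ^ 2) + 4 * Real.exp (-(n * γ)) with he
  set l : ℕ → ℝ := fun n => Real.log 2 + √n * ((1 + VE) / 2) with hl
  have hepos (n : ℕ) : 0 < e n := by positivity
  have hlpos (n : ℕ) : 0 < l n := by
    have := Real.log_pos one_lt_two
    positivity
  have hcode (n : ℕ) (hn : 0 < n) : ∃ c : WiretapCode A E n ⌈Real.exp (n * Δ * R)⌉₊,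
      c.errorProb κB ≤ ENNReal.ofReal (e n / θ) ∧ c.leakage κE ≤ ENNReal.ofReal (l n / θ) := by
    have := neZero_ceil_exp (n * Δ * R)
    have := neZero_ceil_exp (n * IE)
    refine exists_wiretapCode (K := ⌈Real.exp (n * IE)⌉₊) hE hφ hp hp1 hκB hκE hQB hQE hmixB hmixE
      hn hγ0 (div_pos (hepos n) hθ0) (div_pos (hlpos n) hθ0) (Nat.le_ceil _) ?_
    have h1 : VB / (n * γ ^ 2) + (⌈Real.exp (n * Δ * R)⌉₊ * ⌈Real.exp (n * IE)⌉₊ : ℝ)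
        * (Real.exp (n * (IB - γ)))⁻¹ ≤ e n := by
      refine add_le_add le_rfl ?_
      calc _ ≤ (2 * Real.exp (n * Δ * R)) * (2 * Real.exp (n * IE))
            * (Real.exp (n * (IB - γ)))⁻¹ := by
            gcongr
            · exact ceil_exp_le (by positivity)
            · exact ceil_exp_le (by positivity)
        _ = 4 * (Real.exp (n * Δ * R) * Real.exp (n * IE) * Real.exp (-(n * (IB - γ)))) := by
            rw [Real.exp_neg]
            ring
        _ = 4 * Real.exp (-(n * γ)) := by
            rw [← Real.exp_add, ← Real.exp_add, ← hγ]
            congr 2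
            ring
    have h2 : (VB / (n * γ ^ 2) + (⌈Real.exp (n * Δ * R)⌉₊ * ⌈Real.exp (n * IE)⌉₊ : ℝ)
        * (Real.exp (n * (IB - γ)))⁻¹) / (e n / θ) ≤ θ := by
      rw [div_le_iff₀ (div_pos (hepos n) hθ0), mul_div_cancel₀ _ hθ0.ne']
      exact h1
    have h3 : l n / (l n / θ) = θ := div_div_cancel₀ (hlpos n).ne'
    refine le_trans (add_le_add (add_le_add le_rfl h2) h3.le) hθ.le
  have hcode' (n : ℕ) : ∃ c : WiretapCode A E n ⌈Real.exp (n * Δ * R)⌉₊, 0 < n →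
      c.errorProb κB ≤ ENNReal.ofReal (e n / θ) ∧ c.leakage κE ≤ ENNReal.ofReal (l n / θ) := by
    -- A code is demanded for every block length; at n = 0 any code does, since only the limit
    -- matters.
    rcases Nat.eq_zero_or_pos n with rfl | hn
    · have := neZero_ceil_exp ((0 : ℕ) * Δ * R)
      obtain ⟨c⟩ := exists_wiretapCode_zero (A := A) ⌈Real.exp ((0 : ℕ) * Δ * R)⌉₊ hE.le
      exact ⟨c, fun h => absurd h (lt_irrefl 0)⟩
    · obtain ⟨c, hc⟩ := hcode n hn
      exact ⟨c, fun _ => hc⟩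
  choose c hc using hcode'
  have hnat : Tendsto (fun n : ℕ => (n : ℝ)) atTop atTop := tendsto_natCast_atTop_atTop
  refine ⟨hR0, c, ?_, ?_⟩
  · have hlim : Tendsto (fun n => e n / θ) atTop (𝓝 0) := by
      have h1 : Tendsto (fun n : ℕ => VB / (n * γ ^ 2)) atTop (𝓝 0) :=
        (hnat.atTop_mul_const (by positivity)).const_div_atTop VB
      have h2 : Tendsto (fun n : ℕ => Real.exp (-(n * γ))) atTop (𝓝 0) :=
        Real.tendsto_exp_neg_atTop_nhds_zero.comp (hnat.atTop_mul_const hγ0)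
      simpa using (h1.add (h2.const_mul 4)).div_const θ
    have hlim' := ENNReal.tendsto_ofReal hlim
    rw [ENNReal.ofReal_zero] at hlim'
    refine tendsto_of_tendsto_of_tendsto_of_le_of_le' tendsto_const_nhds hlim'
      (Eventually.of_forall fun n => zero_le) ?_
    filter_upwards [eventually_gt_atTop 0] with n hn
    exact (hc n hn).1
  · have hlim : Tendsto (fun n : ℕ => l n / θ / n) atTop (𝓝 0) := by
      have h1 : Tendsto (fun n : ℕ => Real.log 2 / n) atTop (𝓝 0) := hnat.const_div_atTop _
      have h2 : Tendsto (fun n : ℕ => (√(n : ℝ))⁻¹) atTop (𝓝 0) :=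
        tendsto_inv_atTop_zero.comp (Real.tendsto_sqrt_atTop.comp hnat)
      have h3 := (h1.add (h2.mul_const ((1 + VE) / 2))).div_const θ
      simp only [zero_mul, add_zero, zero_div] at h3
      refine h3.congr fun n => ?_
      rw [hl, ← Real.sqrt_div_self]
      ring
    have hlim' := ENNReal.tendsto_ofReal hlim
    rw [ENNReal.ofReal_zero] at hlim'
    refine tendsto_of_tendsto_of_tendsto_of_le_of_le' tendsto_const_nhds hlim'
      (Eventually.of_forall fun n => zero_le) ?_
    filter_upwards [eventually_gt_atTop 0] with n hn
    rw [ENNReal.ofReal_div_of_pos (by exact_mod_cast hn), ENNReal.ofReal_natCast]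
    exact ENNReal.div_le_div_right (hc n hn).2 _

/-- A single message sent as darkness has neither error nor leakage. Hence the set of secure rates
is nonempty and, where it is bounded above, the capacity is nonnegative. -/
theorem zero_mem_secureRates (hκE : ∀ y, κE 0 {y} ≠ 0) (hA : 0 ≤ A) (hE : 0 ≤ E) :
    (0 : ℝ) ∈ secureRates κB κE Δ A E := by
  have hM (n : ℕ) : ⌈Real.exp (n * Δ * 0)⌉₊ = 1 := by simp
  have (n : ℕ) := neZero_ceil_exp (n * Δ * 0)
  refine ⟨le_rfl, fun n => codebookCode (K := 1) (fun _ _ => 0) (fun _ _ => ⟨le_rfl, hA⟩)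
    (by simpa using hE) fun y => ((fun _ => (0, 0) : (Fin n → ℕ) → _ × Fin 1) y).1, ?_, ?_⟩
  · refine tendsto_const_nhds.congr fun n => ?_
    have hsub : Subsingleton (Fin ⌈Real.exp (n * Δ * 0)⌉₊) := by
      rw [hM]
      infer_instance
    refine (le_antisymm ((errorProb_codebookCode_le _ κB).trans (le_of_eq ?_)) zero_le).symm
    simp [Subsingleton.elim _ (0 : Fin ⌈Real.exp (n * Δ * 0)⌉₊ × Fin 1)]
  · refine tendsto_const_nhds.congr fun n => ?_
    symm
    have h : (codebookCode (K := 1) (E := E) (fun _ _ => 0) (fun _ _ => ⟨le_rfl, hA⟩)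
        (by simpa using hE) fun y => ((fun _ => (0, 0) : (Fin n → ℕ) → _ × Fin 1) y).1 :
          WiretapCode A E n ⌈Real.exp (n * Δ * 0)⌉₊).leakage κE = 0 := by
      refine le_antisymm ((leakage_codebookCode_le κE (Measure.pi fun _ => κE 0)
        (pi_ne_zero hκE)).trans (le_of_eq ?_)) zero_le
      have h1 : memoryless κE n (fun _ => 0) = Measure.pi fun _ => κE 0 := rfl
      simp [h1]
    rw [h, ENNReal.zero_div]

end Achievability

/-! ### The binary input as a finite-alphabet input -/

section Binary

variable {κ κB κE : Kernel ℝ ℕ} [IsMarkovKernel κ] [IsMarkovKernel κB] [IsMarkovKernel κE]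
  {Δ A E : ℝ}

/-- The letters of the binary input. -/
def binaryLetter (A : ℝ) (b : Bool) : ℝ := if b then A else 0

/-- The probabilities of the letters of the binary input. -/
noncomputable def binaryWeight (A E : ℝ) (b : Bool) : ℝ := if b then E / A else 1 - E / A

theorem binaryWeight_pos (hE : 0 < E) (hEA : E < A) (b : Bool) : 0 < binaryWeight A E b := by
  have hA := hE.trans hEA
  have := (div_lt_one hA).2 hEA
  cases b
  · simpa [binaryWeight]
  · simpa [binaryWeight] using div_pos hE hA

theorem sum_binaryWeight : ∑ b, binaryWeight A E b = 1 := by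
  simp [binaryWeight]

theorem sum_binaryWeight_mul_letter (hA : A ≠ 0) :
    ∑ b, binaryWeight A E b * binaryLetter A b = E := by
  simp [binaryWeight, binaryLetter, hA]

theorem binaryLetter_mem (hA : 0 ≤ A) (b : Bool) : binaryLetter A b ∈ Set.Icc 0 A := by
  cases b <;> simp [binaryLetter, hA]

theorem lintegral_binaryInput_eq_sum (f : ℝ → ℝ≥0∞) :
    ∫⁻ x, f x ∂binaryInput A E
      = ∑ b, ENNReal.ofReal (binaryWeight A E b) * f (binaryLetter A b) := by
  rw [lintegral_binaryInput, Fintype.sum_bool, add_comm]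
  rfl

theorem real_comp_binaryInput (hE : 0 < E) (hEA : E < A) (y : ℕ) :
    (κ ∘ₘ binaryInput A E).real {y}
      = ∑ b, binaryWeight A E b * (κ (binaryLetter A b)).real {y} := by
  rw [measureReal_def, Measure.bind_apply (measurableSet_singleton y) κ.aemeasurable,
    lintegral_binaryInput_eq_sum, ENNReal.toReal_sum fun b _ =>
      ENNReal.mul_ne_top ENNReal.ofReal_ne_top (measure_ne_top _ _)]
  refine Finset.sum_congr rfl fun b _ => ?_
  rw [ENNReal.toReal_mul, ENNReal.toReal_ofReal (binaryWeight_pos hE hEA b).le]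
  rfl

theorem comp_binaryInput_ne_zero (hE : 0 < E) (hEA : E < A)
    (hκ : ∀ b y, κ (binaryLetter A b) {y} ≠ 0) (y : ℕ) : (κ ∘ₘ binaryInput A E) {y} ≠ 0 := by
  have h : (κ ∘ₘ binaryInput A E).real {y} ≠ 0 := by
    rw [real_comp_binaryInput hE hEA]
    exact (Finset.sum_pos (fun b _ => mul_pos (binaryWeight_pos hE hEA b)
      (real_singleton_pos (hκ b y))) Finset.univ_nonempty).ne'
  intro h0
  exact h (by rw [measureReal_def, h0, ENNReal.toReal_zero])

-- Taking the actual output law as reference kills the last term of the compensation identity, so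
-- the finite sum used in coding agrees with the divergence that defines the mutual information.
open IsChannelDensity in
theorem info_binaryInput (hE : 0 < E) (hEA : E < A)
    (hκ : ∀ b y, κ (binaryLetter A b) {y} ≠ 0) :
    info (binaryWeight A E) (κ ∘ₘ binaryInput A E)
      (outputDensity κ (binaryLetter A) (κ ∘ₘ binaryInput A E))
      = (mutualInfo (binaryInput A E) κ).toReal := by
  have := isProbabilityMeasure_binaryInput hE.le hEA.le (hE.trans hEA)
  have hQ := comp_binaryInput_ne_zero hE hEA hκ
  have hd := isChannelDensity_outputDensity (binaryWeight_pos hE hEA) sum_binaryWeight hκ hQ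
    (real_comp_binaryInput hE hEA)
  have h := lintegral_klDiv_eq (binaryInput A E) κ (κ ∘ₘ binaryInput A E) fun _ =>
    absolutelyContinuous_of_full_support hQ _
  rw [klDiv_self, add_zero, lintegral_binaryInput_eq_sum] at h
  rw [← h]
  have hkl (b : Bool) : klDiv (κ (binaryLetter A b)) (κ ∘ₘ binaryInput A E)
      = ENNReal.ofReal (∫ y, outputDensity κ (binaryLetter A) (κ ∘ₘ binaryInput A E) b y
        * Real.log (outputDensity κ (binaryLetter A) (κ ∘ₘ binaryInput A E) b y)
          ∂(κ ∘ₘ binaryInput A E)) := by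
    conv_lhs => rw [withDensity_outputDensity (φ := binaryLetter A) hQ b]
    exact klDiv_withDensity Measurable.of_discrete (hd.nonneg b) (hd.le b) (hd.integral b)
  rw [ENNReal.toReal_sum fun b _ => ENNReal.mul_ne_top ENNReal.ofReal_ne_top (by
    rw [hkl]; exact ENNReal.ofReal_ne_top), info]
  refine Finset.sum_congr rfl fun b _ => ?_
  have h0 := hd.integral_mul_log_nonneg (K := 1) fun _ => b
  simp only [Nat.cast_one, inv_one, one_mul, Finset.univ_unique, Finset.sum_singleton] at h0
  rw [hkl, ENNReal.toReal_mul, ENNReal.toReal_ofReal (binaryWeight_pos hE hEA b).le,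
    ENNReal.toReal_ofReal h0]

/-- The secrecy capacity is at least the information difference of every binary input of smaller
mean. -/
theorem infoDiff_binaryInput_le_secrecyCapacity {E' : ℝ} (hΔ : 0 < Δ) (hE : 0 < E) (hEA : E < A)
    (hEE' : E < E') (hκB : ∀ x ∈ Set.Icc 0 A, ∀ y, κB x {y} ≠ 0)
    (hκE : ∀ x ∈ Set.Icc 0 A, ∀ y, κE x {y} ≠ 0)
    (hbdd : BddAbove (secureRates κB κE Δ A E')) :
    infoDiff κB κE Δ (binaryInput A E) ≤ secrecyCapacity κB κE Δ A E' := by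
  have hA := hE.trans hEA
  have hE' := hE.trans hEE'
  have := isProbabilityMeasure_binaryInput hE.le hEA.le hA
  have h0 : 0 ≤ secrecyCapacity κB κE Δ A E' :=
    le_csSup hbdd (zero_mem_secureRates (hκE 0 ⟨le_rfl, hA.le⟩) hA.le hE'.le)
  refine le_of_forall_lt fun R hR => ?_
  obtain ⟨S, hRS, hS⟩ := exists_between hR
  -- Only nonnegative numbers qualify as rates; a negative S lies below the capacity because rate
  -- zero is secure.
  rcases lt_or_ge S 0 with hS0 | hS0
  · exact hRS.trans (hS0.trans_le h0)
  have hB (b : Bool) := hκB _ (binaryLetter_mem hA.le b)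
  have hE2 (b : Bool) := hκE _ (binaryLetter_mem hA.le b)
  refine hRS.trans_le (le_csSup hbdd (mem_secureRates_of_lt (binaryLetter_mem hA.le)
    (binaryWeight_pos hE hEA) sum_binaryWeight hB hE2 (comp_binaryInput_ne_zero hE hEA hB)
    (comp_binaryInput_ne_zero hE hEA hE2) (real_comp_binaryInput hE hEA)
    (real_comp_binaryInput hE hEA) hΔ.le hE' ?_ hS0 ?_ ?_))
  · rwa [sum_binaryWeight_mul_letter hA.ne']
  · rw [info_binaryInput hE hEA hE2]
    exact ENNReal.toReal_nonneg
  · rw [info_binaryInput hE hEA hE2, info_binaryInput hE hEA hB]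
    rw [infoDiff, lt_div_iff₀ hΔ] at hS
    linarith

end Binary

end PoissonWiretap

/-- The degraded discrete-time Poisson wiretap channel with gains `aB`, `aE`, dark currents `lB`,
`lE` and pulse duration `Δ`, for a fixed peak intensity `A` and average intensity `E → 0`. -/
theorem theorem6 (aB lB aE lE Δ A : ℝ) (haE : 0 < aE) (hlB : 0 < lB) (hlE : 0 < lE)
    (hΔ : 0 < Δ) (hA : 0 < A) (hgain : aE ≤ aB) (hdark : lB / aB ≤ lE / aE)
    (hstrict : aE < aB ∨ lB / aB < lE / aE) :
    let κB := PoissonWiretap.poissonChannel aB lB Δ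
    let κE := PoissonWiretap.poissonChannel aE lE Δ
    let L : ℝ := (aB + lB / A) * Real.log (1 + aB * A / lB)
      - (aE + lE / A) * Real.log (1 + aE * A / lE) + (aE - aB)
    -- the suprema below are over nonempty bounded sets, and all informations are finite
    (∀ E, 0 < E →
      (PoissonWiretap.secureRates κB κE Δ A E).Nonempty ∧
      BddAbove (PoissonWiretap.secureRates κB κE Δ A E) ∧
      BddAbove (PoissonWiretap.infoDiff κB κE Δ '' PoissonWiretap.feasible A E) ∧
      ∀ μ ∈ PoissonWiretap.feasible A E,
        PoissonWiretap.mutualInfo μ κB ≠ ∞ ∧ PoissonWiretap.mutualInfo μ κE ≠ ∞) ∧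
    -- the limit, for the operational secrecy capacity and for its single-letter expression
    Tendsto (fun E => PoissonWiretap.secrecyCapacity κB κE Δ A E / E) (𝓝[>] 0) (𝓝 L) ∧
    Tendsto (fun E => PoissonWiretap.singleLetter κB κE Δ A E / E) (𝓝[>] 0) (𝓝 L) ∧
    0 < L ∧
    -- the binary input is feasible and achieves the secrecy capacity asymptotically
    (∀ E, 0 < E → E ≤ A →
      PoissonWiretap.binaryInput A E ∈ PoissonWiretap.feasible A E) ∧
    Tendsto (fun E => PoissonWiretap.infoDiff κB κE Δ (PoissonWiretap.binaryInput A E) / E)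
      (𝓝[>] 0) (𝓝 L) ∧
    Tendsto (fun E => PoissonWiretap.infoDiff κB κE Δ (PoissonWiretap.binaryInput A E) /
      PoissonWiretap.secrecyCapacity κB κE Δ A E) (𝓝[>] 0) (𝓝 1) := by
  intro κB κE L
  have haB : 0 < aB := haE.trans_le hgain
  have hgap : PoissonWiretap.divRate aB lB A - PoissonWiretap.divRate aE lE A = A * L :=
    PoissonWiretap.divRate_gap_eq hA
  have hL : 0 < L := by
    have h := PoissonWiretap.divRate_gap_pos haE hlB hlE hgain hdark hstrict hA
    rw [hgap] at h
    exact pos_of_mul_pos_right h hA.le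
  have hκB : ∀ x ∈ Set.Icc 0 A, ∀ y, κB x {y} ≠ 0 := fun x hx y =>
    PoissonWiretap.poissonChannel_ne_zero haB hlB hΔ hx.1 y
  have hκE : ∀ x ∈ Set.Icc 0 A, ∀ y, κE x {y} ≠ 0 := fun x hx y =>
    PoissonWiretap.poissonChannel_ne_zero haE hlE hΔ hx.1 y
  have hrate (E : ℝ) (hE : 0 < E) : L * E ∈ upperBounds (PoissonWiretap.secureRates κB κE Δ A E) :=
    fun R hR =>
      PoissonWiretap.secureRates_le haE hlB hlE hΔ hA hgain hdark hstrict hL.le hE.le hgap hR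
  have hinfo (E : ℝ) (hE : 0 < E) :
      L * E ∈ upperBounds (PoissonWiretap.infoDiff κB κE Δ '' PoissonWiretap.feasible A E) := by
    rintro _ ⟨μ, hμ, rfl⟩
    exact PoissonWiretap.infoDiff_le haE hlB hlE hΔ hA hgain hdark hstrict hL.le hE.le hgap hμ
  have hne (E : ℝ) (hE : 0 < E) : (PoissonWiretap.secureRates κB κE Δ A E).Nonempty :=
    ⟨0, PoissonWiretap.zero_mem_secureRates (hκE 0 ⟨le_rfl, hA.le⟩) hA.le hE.le⟩
  have hfeas (E : ℝ) (hE : 0 < E) (hEA : E ≤ A) :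
      PoissonWiretap.binaryInput A E ∈ PoissonWiretap.feasible A E :=
    PoissonWiretap.binaryInput_mem_feasible hE.le hEA hA
  obtain ⟨C, hC⟩ := PoissonWiretap.exists_infoDiff_binaryInput_ge haB haE hlB hlE hΔ hA hgap
  -- All three limits of the form f(E)/E follow from one pair of bounds. The factor 1 - E in the
  -- lower one leaves room for the reduced mean used for the capacity; E < 1 keeps that mean
  -- positive.
  have hsqueeze (f : ℝ → ℝ) (hle : ∀ E, 0 < E → E < min A 1 → f E ≤ L * E)
      (hge : ∀ E, 0 < E → E < min A 1 → L * (E * (1 - E)) - |C| * E ^ 2 ≤ f E) :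
      Tendsto (fun E => f E / E) (𝓝[>] 0) (𝓝 L) := by
    have hlow : Tendsto (fun E : ℝ => L * (1 - E) - |C| * E) (𝓝[>] 0) (𝓝 L) := by
      refine Tendsto.mono_left ?_ nhdsWithin_le_nhds
      have h : Continuous fun E : ℝ => L * (1 - E) - |C| * E := by fun_prop
      simpa using h.tendsto 0
    have hev : ∀ᶠ E : ℝ in 𝓝[>] 0, E ∈ Set.Ioo 0 (min A 1) :=
      Ioo_mem_nhdsGT (lt_min hA one_pos)
    refine tendsto_of_tendsto_of_tendsto_of_le_of_le' hlow tendsto_const_nhds ?_ ?_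
    · filter_upwards [hev] with E hE
      rw [le_div_iff₀ hE.1]
      exact le_trans (le_of_eq (by ring)) (hge E hE.1 hE.2)
    · filter_upwards [hev] with E hE
      rw [div_le_iff₀ hE.1]
      exact hle E hE.1 hE.2
  have hbin (E : ℝ) (hE : 0 < E) (hEA : E < min A 1) : L * (E * (1 - E)) - |C| * E ^ 2
      ≤ PoissonWiretap.infoDiff κB κE Δ (PoissonWiretap.binaryInput A E) := by
    refine le_trans ?_ (hC E hE.le (hEA.le.trans (min_le_left _ _)))
    nlinarith [mul_nonneg hL.le (sq_nonneg E),
      mul_le_mul_of_nonneg_right (le_abs_self C) (sq_nonneg E)]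
  have hcap (E : ℝ) (hE : 0 < E) (hEA : E < min A 1) : L * (E * (1 - E)) - |C| * E ^ 2
      ≤ PoissonWiretap.secrecyCapacity κB κE Δ A E := by
    have h1 : 0 < 1 - E := sub_pos.2 (hEA.trans_le (min_le_right _ _))
    have h2 : E * (1 - E) < E := by nlinarith
    have h3 : E * (1 - E) < A := h2.trans (hEA.trans_le (min_le_left _ _))
    have h4 : 0 < E * (1 - E) := mul_pos hE h1
    -- Random coding requires a mean strictly below E; the binary input of mean E (1 - E) has it and
    -- loses only L E².
    refine le_trans ?_ ((hC _ h4.le h3.le).trans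
      (PoissonWiretap.infoDiff_binaryInput_le_secrecyCapacity hΔ h4 h3 h2 hκB hκE
        ⟨_, hrate E hE⟩))
    have h5 : C * (E * (1 - E)) ^ 2 ≤ |C| * E ^ 2 :=
      mul_le_mul (le_abs_self C) (pow_le_pow_left₀ h4.le h2.le 2) (sq_nonneg _) (abs_nonneg C)
    linarith
  have hlimC : Tendsto (fun E => PoissonWiretap.secrecyCapacity κB κE Δ A E / E) (𝓝[>] 0) (𝓝 L) :=
    hsqueeze _ (fun E hE _ => csSup_le (hne E hE) (hrate E hE)) hcap
  have hlimB : Tendsto (fun E => PoissonWiretap.infoDiff κB κE Δ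
      (PoissonWiretap.binaryInput A E) / E) (𝓝[>] 0) (𝓝 L) :=
    hsqueeze _ (fun E hE hEA => hinfo E hE
      ⟨_, hfeas E hE (hEA.le.trans (min_le_left _ _)), rfl⟩) hbin
  refine ⟨fun E hE => ⟨hne E hE, ⟨_, hrate E hE⟩, ⟨_, hinfo E hE⟩, fun μ hμ =>
    ⟨PoissonWiretap.mutualInfo_poissonChannel_ne_top haB hlB hΔ hμ,
      PoissonWiretap.mutualInfo_poissonChannel_ne_top haE hlE hΔ hμ⟩⟩,
    hlimC, ?_, hL, hfeas, hlimB, ?_⟩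
  · refine hsqueeze _ (fun E hE hEA => csSup_le ?_ (hinfo E hE)) fun E hE hEA =>
      (hbin E hE hEA).trans (le_csSup ⟨_, hinfo E hE⟩ ?_)
    · exact ⟨_, _, hfeas E hE (hEA.le.trans (min_le_left _ _)), rfl⟩
    · exact ⟨_, hfeas E hE (hEA.le.trans (min_le_left _ _)), rfl⟩
  · have h := hlimB.div hlimC hL.ne'
    rw [div_self hL.ne'] at h
    refine h.congr' ?_
    filter_upwards [self_mem_nhdsWithin] with E hE
    exact div_div_div_cancel_right₀ (ne_of_gt hE) _ _
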